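/- Let $p$ be a prime, $s\ge 1$ an integer, $\underline a=(a_1,\dots,a_s)\in\mathbb Z_p^s$ and $\underline b=(b_1,\dots,b_{s-1})\in(\mathbb Z_p\setminus\mathbb Z_{\le 0})^{s-1}$. For $\alpha\in\mathbb Z_p$ let $[\alpha]_0\in\{0,\dots,p-1\}$ be the integer with $\alpha+[\alpha]_0\equiv 0 \pmod p$, let $\alpha'=(\alpha+[\alpha]_0)/p$ be its Dwork prime, and put $\alpha^{(0)}=\alpha$, $\alpha^{(i)}=(\alpha^{(i-1)})'$ and $[\alpha]_n=[\alpha^{(n)}]_0$, so that $\alpha=-\sum_{n\ge0}[\alpha]_np^n$. Let $q$ be the number of indices $j$ with $b_j\ne1$. Suppose that (i) $|b_j^{(i)}|_p=1$ for all $i\ge0$ and all $j$ with $b_j\neq 1$; (ii) for each fixed $n\ge0$, if the indices are rearranged so that $[a_1]_n\le\cdots\le[a_s]_n$ and $[b_1]_n\le\cdots\le[b_{s-1}]_n$, then $[a_{j+1}]_n<[b_j]_n$ for $j=1,\dots,q$; and that $a_i\notin\mathbb Z_{\le0}$ for all $i$. Write $(\alpha)_n=\alpha(\alpha+1)\cdots(\alpha+n-1)$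 and $$F_{\underline a,\underline b}(t)=\sum_{n\ge0}\frac{(a_1)_n\cdots(a_s)_n}{(b_1)_n\cdots(b_{s-1})_n(1)_n}t^n,$$ and let $F^{(1)}_{\underline a,\underline b}(t)$ be the same series with all $a_i,b_j$ replaced by $a_i',b_j'$. Let $W=W(\overline{\mathbb F}_p)$ be the Witt ring of $\overline{\mathbb F}_p$, with Frobenius $w\mapsto w^F$, and $K=\operatorname{Frac}W$ with the induced Frobenius. Let $c\in1+pW$ and let $\sigma$ be given by $\left(\sum_i w_it^i\right)^\sigma=\sum_i w_i^Fc^it^{ip}$. Let $\log$ be the Iwasawa logarithm, and put $$\gamma_p=\lim_{m\to\infty}\frac1{p^m}\sum_{0\le j<p^m,\ p\nmid j}\log(j),\qquad \psi_p(z)=-\gamma_p+\lim_{n\in\mathbb Z_{>0},\ n\to z}\ \sum_{1\le k<n,\ p\nmid k}\frac1k\quad(z\in\mathbb Z_p),$$ $$G_{\underline a,\underline b}(t)=\sum_{i=1}^s\psi_p(a_i)-\sum_{j=1}^{s-1}\psi_p(b_j)+\gamma_p-p^{-1}\log(c)+\int_0^t\left(F_{\underline a,\underline b}(t)-F^{(1)}_{\underline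 a,\underline b}(t^\sigma)\right)\frac{dt}t\in K[[t]],$$ where $F^{(1)}_{\underline a,\underline b}(t^\sigma)$ denotes $\left(F^{(1)}_{\underline a,\underline b}(t)\right)^\sigma$ and $\int_0^t(-)\frac{dt}t$ sends $\sum_{n\ge1}x_nt^n$ to $\sum_{n\ge1}\frac{x_n}nt^n$. Define the generalized $p$-adic hypergeometric function of logarithmic type by $\mathscr F^{(\sigma)}_{\underline a,\underline b}(t)=G_{\underline a,\underline b}(t)/F_{\underline a,\underline b}(t)$, and for $f=\sum x_it^i$ write $[f]_{<m}=\sum_{i<m}x_it^i$. Then $\mathscr F^{(\sigma)}_{\underline a,\underline b}(t)\in W[[t]]$. If $p$ is odd, then for all $n\ge1$ $$\mathscr F^{(\sigma)}_{\underline a,\underline b}(t)\equiv\frac{[G_{\underline a,\underline b}(t)]_{<p^n}}{[F_{\underline a,\underline b}(t)]_{<p^n}}\pmod{p^nW[[t]]}.$$ If $p=2$, then for all $n\ge1$ the same congruence holds modulo $p^{n-1}W[[t]]$. -/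

import Mathlib

open Filter Topology PowerSeries

noncomputable section

namespace LogHyp

/-! ### Dwork primes and digits -/

section Dwork

variable {p : ℕ} [Fact p.Prime]

/-- The integer `l ∈ {0, …, p-1}` with `α + l ≡ 0 mod p`. -/
def lastDigit (α : ℤ_[p]) : ℕ := (-α).zmodRepr

theorem dvd_add_lastDigit (α : ℤ_[p]) : (p : ℤ_[p]) ∣ α + (lastDigit α : ℤ_[p]) := by
  have h := PadicInt.sub_zmodRepr_mem (-α)
  rw [PadicInt.maximalIdeal_eq_span_p, Ideal.mem_span_singleton] at h
  have h2 := (dvd_neg (a := (p : ℤ_[p]))).2 h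
  have e : -(-α - ((-α).zmodRepr : ℤ_[p])) = α + (lastDigit α : ℤ_[p]) := by
    unfold lastDigit; ring
  rwa [e] at h2

/-- The Dwork prime `α' = (α + l) / p`. -/
def dworkPrime (α : ℤ_[p]) : ℤ_[p] := (dvd_add_lastDigit α).choose

theorem mul_dworkPrime (α : ℤ_[p]) :
    (p : ℤ_[p]) * dworkPrime α = α + (lastDigit α : ℤ_[p]) :=
  (dvd_add_lastDigit α).choose_spec.symm

/-- The iterated Dwork prime `α^{(i)}`. -/
def dworkIter (i : ℕ) (α : ℤ_[p]) : ℤ_[p] := dworkPrime^[i] α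

/-- The digit `[α]_n` in the expansion `α = -[α]_0 - [α]_1 p - [α]_2 p^2 - ⋯`. -/
def dworkDigit (n : ℕ) (α : ℤ_[p]) : ℕ := lastDigit (dworkIter n α)

/-- Dwork's conditions on `a = (a_1, …, a_{r+1})` and `b = (b_1, …, b_r)`, where `q` is the number
of indices `j` with `b_j ≠ 1`:
(i) `|b_j^{(i)}| = 1` for all `i` and all `j` with `b_j ≠ 1`;
(ii) for every `n`, once `a` and `b` are rearranged so that `[a_1]_n ≤ ⋯ ≤ [a_{r+1}]_n` and
`[b_1]_n ≤ ⋯ ≤ [b_r]_n`, one has `[a_{j+1}]_n < [b_j]_n` for `1 ≤ j ≤ q`. -/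
structure DworkConditions {r : ℕ} (a : Fin (r + 1) → ℤ_[p]) (b : Fin r → ℤ_[p]) : Prop where
  norm_eq_one : ∀ j, b j ≠ 1 → ∀ i, ‖dworkIter i (b j)‖ = 1
  digit_lt : ∀ (n : ℕ) (e : Equiv.Perm (Fin (r + 1))) (f : Equiv.Perm (Fin r)),
    Monotone (fun i => dworkDigit n (a (e i))) →
    Monotone (fun j => dworkDigit n (b (f j))) →
    ∀ j : Fin r, (j : ℕ) < {j | b j ≠ 1}.ncard →
      dworkDigit n (a (e j.succ)) < dworkDigit n (b (f j))

/-- The hypergeometric series `∑ (a_1)_n ⋯ (a_{r+1})_n / ((b_1)_n ⋯ (b_r)_n (1)_n) t^n`. -/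
def hypSeries {r : ℕ} (a : Fin (r + 1) → ℤ_[p]) (b : Fin r → ℤ_[p]) : ℚ_[p]⟦X⟧ :=
  PowerSeries.mk fun n =>
    (∏ i, (ascPochhammer ℚ_[p] n).eval (a i : ℚ_[p])) /
      ((∏ j, (ascPochhammer ℚ_[p] n).eval (b j : ℚ_[p])) * (ascPochhammer ℚ_[p] n).eval 1)

/-- `ψ̃_p(z)`, the limit of `∑_{1 ≤ k < n, p ∤ k} 1/k` as the positive integer `n` tends
`p`-adically to `z`. -/
def psiTilde (z : ℤ_[p]) : ℚ_[p] :=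
  limUnder (comap (fun n : ℕ => (n : ℤ_[p])) (𝓝 z) ⊓ 𝓟 {n | 0 < n})
    (fun n : ℕ => ∑ k ∈ (Finset.Ico 1 n).filter (fun k => ¬ p ∣ k), (1 / (k : ℚ_[p])))

end Dwork

/-! ### The Witt ring of the algebraic closure of `𝔽_p` and its fraction field -/

section Witt

variable (p : ℕ) [Fact p.Prime]

/-- `W = W(𝔽̄_p)`. -/
abbrev W : Type := WittVector p (AlgebraicClosure (ZMod p))

/-- `K = Frac W`. -/
abbrev K : Type := FractionRing (W p)

/-- The inclusion `ℤ_p = W(𝔽_p) → W(𝔽̄_p)`. -/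
def zpToW : ℤ_[p] →+* W p :=
  (WittVector.map (algebraMap (ZMod p) (AlgebraicClosure (ZMod p)))).comp
    (WittVector.equiv p).symm.toRingHom

theorem zpToW_injective : Function.Injective (zpToW p) :=
  (WittVector.map_injective _ (algebraMap (ZMod p) (AlgebraicClosure (ZMod p))).injective).comp
    (WittVector.equiv p).symm.injective

/-- The inclusion `ℚ_p → K`. -/
def qpToK : ℚ_[p] →+* K p :=
  IsFractionRing.lift (A := ℤ_[p]) (g := (algebraMap (W p) (K p)).comp (zpToW p))
    ((IsFractionRing.injective (W p) (K p)).comp (zpToW_injective p))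

variable {p}

/-- `p`-adic convergence of a sequence in `K`: for each `N`, eventually `u n - x ∈ p^N W`. -/
def HasPadicLimit (u : ℕ → K p) (x : K p) : Prop :=
  ∀ N : ℕ, ∀ᶠ n in atTop, ∃ w : W p, u n - x = (p : K p) ^ N * algebraMap (W p) (K p) w

open Classical in
/-- The `p`-adic limit of a sequence in `K` (with value `0` if there is none). -/
def padicLimit (u : ℕ → K p) : K p :=
  if h : ∃ x, HasPadicLimit u x then h.choose else 0

/-- `|z - 1| < 1` for `z ∈ K`, that is, `z ∈ 1 + pW`. -/
def IsPrincipalUnit (z : K p) : Prop :=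
  ∃ w : W p, z = 1 + (p : K p) * algebraMap (W p) (K p) w

/-- The series `-∑_{n ≥ 1} (1 - z)^n / n`. -/
def logSeries (z : K p) : K p :=
  padicLimit fun m => -∑ n ∈ Finset.Icc 1 m, (1 - z) ^ n / (n : K p)

open Classical in
/-- The Iwasawa logarithm on `K` (with value `0` at `0`). It is given by the series on `1 + pW`.
Any `z ≠ 0` has a power of the form `z ^ N = p ^ M * y` with `N ≥ 1` and `y ∈ 1 + pW`, and then
`log z = (log y) / N`, because `log` is a homomorphism with `log p = 0`. -/
def iwasawaLog (z : K p) : K p :=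
  if IsPrincipalUnit z then logSeries z
  else if h : ∃ t : ℕ × ℤ × K p, 0 < t.1 ∧ IsPrincipalUnit t.2.2 ∧
      z ^ t.1 = (p : K p) ^ t.2.1 * t.2.2 then
    logSeries h.choose.2.2 / (h.choose.1 : K p)
  else 0

variable (p) in
/-- The `p`-adic Euler constant `γ_p = lim_s p^{-s} ∑_{0 ≤ j < p^s, p ∤ j} log j`. -/
def eulerConst : K p :=
  padicLimit fun s => 1 / (p : K p) ^ s *
    ∑ j ∈ (Finset.range (p ^ s)).filter (fun j => ¬ p ∣ j), iwasawaLog (j : K p)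

/-- The `p`-adic digamma function `ψ_p(z) = -γ_p + ψ̃_p(z)`. -/
def digamma (z : ℤ_[p]) : K p := -eulerConst p + qpToK p (psiTilde z)

/-- The Frobenius `σ` with `σ(t) = c t^p`, that is, `(∑ a_i t^i)^σ = ∑ a_i^F c^i t^{ip}`, where
`F` is the Frobenius of `K` induced by that of `W`. -/
def sigma (c : W p) (f : (K p)⟦X⟧) : (K p)⟦X⟧ :=
  PowerSeries.mk fun m =>
    if p ∣ m then
      WittVector.FractionRing.frobenius p (AlgebraicClosure (ZMod p)) (coeff (m / p) f) *
        algebraMap (W p) (K p) c ^ (m / p)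
    else 0

/-- The operator `∫_0^t (-) dt/t` sending `∑ a_n t^n` (with `a_0 = 0`) to `∑ (a_n / n) t^n`. -/
def logIntegral (f : (K p)⟦X⟧) : (K p)⟦X⟧ :=
  PowerSeries.mk fun n => coeff n f / (n : K p)

/-- `F_{a,b}(t)` as a power series over `K`. -/
def hypF {r : ℕ} (a : Fin (r + 1) → ℤ_[p]) (b : Fin r → ℤ_[p]) : (K p)⟦X⟧ :=
  PowerSeries.map (qpToK p) (hypSeries a b)

/-- `F^{(i)}_{a,b}(t)`, the series with parameters `a_j^{(i)}`, `b_j^{(i)}`. -/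
def hypFIter (i : ℕ) {r : ℕ} (a : Fin (r + 1) → ℤ_[p]) (b : Fin r → ℤ_[p]) : (K p)⟦X⟧ :=
  hypF (fun k => dworkIter i (a k)) (fun j => dworkIter i (b j))

/-- The power series `G_{a,b}(t)`. -/
def hypG (c : W p) {r : ℕ} (a : Fin (r + 1) → ℤ_[p]) (b : Fin r → ℤ_[p]) : (K p)⟦X⟧ :=
  PowerSeries.C (∑ i, digamma (a i) - ∑ j, digamma (b j) + eulerConst p
      - (p : K p)⁻¹ * iwasawaLog (algebraMap (W p) (K p) c))
    + logIntegral (hypF a b - sigma c (hypFIter 1 a b))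

/-- The generalized `p`-adic hypergeometric function of logarithmic type `G_{a,b}(t)/F_{a,b}(t)`.
The denominator has constant term `1`. -/
def logTypeHyp (c : W p) {r : ℕ} (a : Fin (r + 1) → ℤ_[p]) (b : Fin r → ℤ_[p]) : (K p)⟦X⟧ :=
  hypG c a b * (hypF a b)⁻¹

/-- The truncation `[f]_{<m}`, regarded as a power series. -/
def truncLT (m : ℕ) (f : (K p)⟦X⟧) : (K p)⟦X⟧ := (PowerSeries.trunc m f : Polynomial (K p))

/-- `f ∈ W[[t]]`. -/
def IsIntegralSeries (f : (K p)⟦X⟧) : Prop :=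
  ∃ h : (W p)⟦X⟧, f = PowerSeries.map (algebraMap (W p) (K p)) h

/-- `f ≡ g mod p^m W[[t]]`. -/
def CongrModPow (m : ℕ) (f g : (K p)⟦X⟧) : Prop :=
  ∃ h : (W p)⟦X⟧,
    f - g = PowerSeries.C ((p : K p) ^ m) * PowerSeries.map (algebraMap (W p) (K p)) h

end Witt

end LogHyp

end

noncomputable section

namespace LogHyp

/-! ### Dwork's congruences for truncated series -/

section DworkCongruence

/-! Write `F = ∑ A_k t^k` and `G = ∑ A_k α_k t^k`, with `A_k ∈ ℤ_p`. The theorem combines two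
independent facts.

Continuity of `α`: each `α_k` lies in `W`, and `k ≡ k' mod p^n` implies `p^n ∣ 2(α_k - α_{k'})`. For
`p ∤ k` one has `α_k = 1/k`. For `k = pm` one has `α_k = (1 - f(m))/(pm)`, where `f(m) = c^m A'_m /
A_{pm}` and `A'_m / A_{pm}` is a quotient of products of `p`-adic units over intervals of length
`pm`. Up to a factor 2, such products are multiplicative in the length modulo `(pm)(pn)` and are
known modulo `(pm)^2` through the digamma values, while `c^m` is known through `log c`. So `f(m)`
resembles `exp(-pmθ₀)` with `θ₀ = α_0` the constant term of `G`, which forces the continuity of its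
difference quotient (`exists_theta`, `exists_theta_of_log`).

Dwork's congruences: for `l < p^d`, the sequence `j ↦ A_{l+jp^d}` and the coefficients of `F^{(d)}`
have antisymmetric convolution over `j < p^s` divisible by `p^(s+1)` (`DworkData.dvd_sum_range`).
This follows from a general induction on blocks (`DworkChain.norm_blockSum_le`), once the ratios of
coefficients are compared digit by digit (`DworkData.congr`).

Combination: the coefficient of `t^N` in `G [F]_{<p^n} - F [G]_{<p^n}` is the sum of `A_i A_{N-i}
(α_{N-i} - α_i)` over `i < p^n`, `i ≤ N`. Replace `α_i` by `α_{i mod p^k}` and telescope over `k`: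
the change from `k` to `k + 1` depends only on the residue modulo `p^(k+1)` and has a factor `p^k`,
while Dwork's congruences make the corresponding difference of sums of `A_i A_{N-i}` divisible by
`p^(n-k)` (`pow_dvd_two_mul_sum`). Since `F` and its truncation are units, division yields the
congruence. The accumulated factor 2 is invertible for odd `p` and costs one power of `p` for `p =
2`. -/

theorem sum_range_mul_eq {M : Type*} [AddCommMonoid M] (a b : ℕ) (f : ℕ → M) :
    ∑ j ∈ Finset.range (a * b), f j =
      ∑ i ∈ Finset.range b, ∑ j ∈ Finset.range a, f (j + i * a) := by
  induction b with
  | zero => simp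
  | succ b ih =>
    rw [Nat.mul_succ, Finset.sum_range_add, ih, Finset.sum_range_succ]
    congr 1
    refine Finset.sum_congr rfl fun j _ => ?_
    rw [add_comm, mul_comm]

variable {k : Type*} [NormedField k]

/-- Extension of a sequence by zero to negative indices. -/
def zext (X : ℕ → k) (z : ℤ) : k := if 0 ≤ z then X z.toNat else 0

theorem zext_natCast (X : ℕ → k) (n : ℕ) : zext X n = X n := by simp [zext]

theorem zext_of_neg (X : ℕ → k) {z : ℤ} (hz : z < 0) : zext X z = 0 := by
  simp [zext, not_le.2 hz]

theorem norm_zext_le {X : ℕ → k} {c : ℝ} (hc : 0 ≤ c) (hX : ∀ n, ‖X n‖ ≤ c) (z : ℤ) :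
    ‖zext X z‖ ≤ c := by
  unfold zext
  split_ifs
  · exact hX _
  · simpa using hc

/-- The antisymmetric convolution of two sequences over the block of indices
`m p^s ≤ j < (m+1) p^s`. -/
def blockSum (p : ℕ) (X Y : ℕ → k) (N : ℤ) (s m : ℕ) : k :=
  ∑ j ∈ Finset.range (p ^ s),
    (zext X (N - (j + m * p ^ s : ℕ)) * Y (j + m * p ^ s)
      - zext Y (N - (j + m * p ^ s : ℕ)) * X (j + m * p ^ s))

theorem blockSum_succ (p : ℕ) (X Y : ℕ → k) (N : ℤ) (s m : ℕ) :
    blockSum p X Y N (s + 1) m = ∑ i ∈ Finset.range p, blockSum p X Y N s (i + m * p) := by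
  unfold blockSum
  rw [pow_succ, sum_range_mul_eq]
  refine Finset.sum_congr rfl fun i _ => Finset.sum_congr rfl fun j _ => ?_
  have : j + i * p ^ s + m * (p ^ s * p) = j + (i + m * p) * p ^ s := by ring
  rw [this]

theorem sum_antisymm_eq_zero (X Y : ℕ → k) (N : ℤ) (M : ℕ) (hM : N < M) :
    ∑ j ∈ Finset.range M, (zext X (N - (j : ℕ)) * Y j - zext Y (N - (j : ℕ)) * X j) = 0 := by
  rcases lt_or_ge N 0 with hN | hN
  · refine Finset.sum_eq_zero fun j _ => ?_
    rw [zext_of_neg _ (by lia), zext_of_neg _ (by lia)]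
    simp
  · lift N to ℕ using hN
    have hNM : N + 1 ≤ M := by lia
    obtain ⟨d, rfl⟩ := Nat.exists_eq_add_of_le hNM
    rw [Finset.sum_range_add, Finset.sum_eq_zero (s := Finset.range d), add_zero]
    · rw [Finset.sum_sub_distrib, sub_eq_zero, ← Finset.sum_range_reflect]
      refine Finset.sum_congr rfl fun j hj => ?_
      have hj' : j ≤ N := by simpa [Nat.lt_succ_iff] using hj
      have e : N + 1 - 1 - j = N - j := by lia
      rw [e]
      have e1 : (N : ℤ) - ((N - j : ℕ) : ℤ) = (j : ℕ) := by lia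
      have e2 : (N : ℤ) - (j : ℤ) = ((N - j : ℕ) : ℤ) := by lia
      rw [e1, e2, zext_natCast, zext_natCast, mul_comm]
    · intro j _
      rw [zext_of_neg _ (by lia), zext_of_neg _ (by lia)]
      simp

theorem sum_blockSum (p : ℕ) (X Y : ℕ → k) (N : ℤ) (s M : ℕ) (hM : N < (p ^ s * M : ℕ)) :
    ∑ m ∈ Finset.range M, blockSum p X Y N s m = 0 := by
  have h := sum_antisymm_eq_zero X Y N (p ^ s * M) hM
  rw [sum_range_mul_eq] at h
  exact h

/-- A chain of sequences `A 0, A 1, …` satisfying Dwork's congruences with respect to the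
gauge functions `G 0, G 1, …`. -/
structure DworkChain (p : ℕ) (ε : ℝ) (A : ℕ → ℕ → k) (G : ℕ → ℕ → ℝ) : Prop where
  zero : ∀ r, A r 0 = 1
  ne_zero : ∀ r n, A r n ≠ 0
  norm_le : ∀ r n, ‖A r n‖ ≤ G r n
  gauge_le : ∀ r n, G r n ≤ 1
  congr : ∀ r s l u n, l < p → u < p ^ s →
    G r (l + u * p) * ‖A r (l + u * p + n * p ^ (s + 1)) / A r (l + u * p)
      - A (r + 1) (u + n * p ^ s) / A (r + 1) u‖ ≤ ε ^ (s + 1) * G (r + s + 1) n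

variable {p : ℕ} {ε : ℝ} {A : ℕ → ℕ → k} {G : ℕ → ℕ → ℝ}

theorem DworkChain.gauge_nonneg (h : DworkChain p ε A G) (r n : ℕ) : 0 ≤ G r n :=
  (norm_nonneg _).trans (h.norm_le r n)

theorem DworkChain.norm_le_one (h : DworkChain p ε A G) (r n : ℕ) : ‖A r n‖ ≤ 1 :=
  (h.norm_le r n).trans (h.gauge_le r n)

variable [IsUltrametricDist k]

theorem norm_sum_le_of_le {ι : Type*} {s : Finset ι} {f : ι → k} {c : ℝ} (hc : 0 ≤ c)
    (h : ∀ i ∈ s, ‖f i‖ ≤ c) : ‖∑ i ∈ s, f i‖ ≤ c :=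
  IsUltrametricDist.norm_sum_le_of_forall_le_of_nonneg hc h

theorem norm_add_le_of_le {x y : k} {c : ℝ} (hx : ‖x‖ ≤ c) (hy : ‖y‖ ≤ c) : ‖x + y‖ ≤ c :=
  (IsUltrametricDist.norm_add_le_max x y).trans (max_le hx hy)

/-- The block `m` is compared with blocks near the origin at ever coarser scales `t`. At `t = 0` the
hypothesis on `B` extracts a multiplier from each term. Going from `t` to `t + 1` merges `p`
neighbouring blocks and replaces their multipliers by a common one taken from `A (t + 1)`; the error
is the chain congruence times the known bound for blocks of scale `t`, whose gauge is precisely the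
one in the chain congruence. -/
theorem DworkChain.blockSum_step (h : DworkChain p ε A G) (hε : 0 ≤ ε)
    {B : ℕ → k} (hB : ∀ s u n, u < p ^ s →
      ‖B (u + n * p ^ s) - B u * (A 0 (u + n * p ^ s) / A 0 u)‖ ≤ ε ^ (s + 1) * G s n)
    (s : ℕ) (ih : ∀ t < s, ∀ N m, ‖blockSum p B (A 0) N t m‖ ≤ ε ^ (t + 1) * G t m)
    (t : ℕ) (ht : t ≤ s) (N : ℤ) (m : ℕ) :
    ‖blockSum p B (A 0) (N + (m * p ^ s : ℕ)) s m
      - ∑ j ∈ Finset.range (p ^ (s - t)),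
        A t (j + m * p ^ (s - t)) / A t j * blockSum p B (A 0) N t j‖ ≤ ε ^ (s + 1) * G s m := by
  have hc : 0 ≤ ε ^ (s + 1) * G s m := mul_nonneg (pow_nonneg hε _) (h.gauge_nonneg _ _)
  induction t with
  | zero =>
    unfold blockSum
    rw [Nat.sub_zero, ← Finset.sum_sub_distrib]
    refine norm_sum_le_of_le hc fun j hj => ?_
    have hj' := Finset.mem_range.1 hj
    have e : N + ((m * p ^ s : ℕ) : ℤ) - ((j + m * p ^ s : ℕ) : ℤ) = N - (j : ℕ) := by
      push_cast; ring
    have h0 := h.ne_zero 0 j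
    -- The terms with `zext B` cancel, leaving only the deviation of `B` from proportionality to `A
    -- 0`.
    have e2 : zext B (N - (j : ℕ)) * A 0 (j + m * p ^ s)
        - zext (A 0) (N - (j : ℕ)) * B (j + m * p ^ s)
        - A 0 (j + m * p ^ s) / A 0 j *
          (zext B (N - (j : ℕ)) * A 0 j - zext (A 0) (N - (j : ℕ)) * B j)
        = -(zext (A 0) (N - (j : ℕ)) *
          (B (j + m * p ^ s) - B j * (A 0 (j + m * p ^ s) / A 0 j))) := by
      field_simp
      ring
    rw [e]
    simp only [pow_zero, Finset.range_one, Finset.sum_singleton, mul_one, zero_add]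
    rw [e2, norm_neg, norm_mul]
    calc _ ≤ 1 * (ε ^ (s + 1) * G s m) := by
          refine mul_le_mul (norm_zext_le zero_le_one (h.norm_le_one 0) _) (hB s j m hj')
            (norm_nonneg _) zero_le_one
      _ = _ := one_mul _
  | succ t iht =>
    have h1 := iht (by lia)
    obtain ⟨d, hd⟩ : ∃ d, s - t = d + 1 := ⟨s - t - 1, by lia⟩
    have hd' : s - (t + 1) = d := by lia
    have hs : t + d + 1 = s := by lia
    rw [hd, pow_succ, mul_comm (p ^ d) p, sum_range_mul_eq] at h1
    rw [hd']
    refine (congrArg norm (sub_add_sub_cancel _ _ _).symm).trans_le (norm_add_le_of_le h1 ?_)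
    rw [← Finset.sum_sub_distrib]
    refine norm_sum_le_of_le hc fun u hu => ?_
    have hu' := Finset.mem_range.1 hu
    rw [blockSum_succ, Finset.mul_sum, ← Finset.sum_sub_distrib]
    refine norm_sum_le_of_le hc fun i hi => ?_
    have hi' := Finset.mem_range.1 hi
    rw [← sub_mul, norm_mul]
    have h2 := ih t (by lia) N (i + u * p)
    have h3 := h.congr t d i u m hi' hu'
    rw [hs] at h3
    rw [show m * (p * p ^ d) = m * p ^ (d + 1) by ring]
    calc _ ≤ _ * (ε ^ (t + 1) * G t (i + u * p)) :=
          mul_le_mul_of_nonneg_left h2 (norm_nonneg _)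
      _ = ε ^ (t + 1) * (G t (i + u * p) * ‖A t (i + u * p + m * p ^ (d + 1)) / A t (i + u * p)
          - A (t + 1) (u + m * p ^ d) / A (t + 1) u‖) := by ring
      _ ≤ ε ^ (t + 1) * (ε ^ (d + 1) * G s m) :=
          mul_le_mul_of_nonneg_left h3 (pow_nonneg hε _)
      _ = _ := by rw [← mul_assoc, ← pow_add]; congr 2; lia

/-- Dwork's congruence: if the sequence `B` lies over the chain `A`, the antisymmetric convolution
of `B` and `A 0` over a block of length `p ^ s` is divisible by `p ^ (s + 1)`. -/
theorem DworkChain.norm_blockSum_le (h : DworkChain p ε A G) (hp : 0 < p) (hε : 0 ≤ ε)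
    {B : ℕ → k} (hB : ∀ s u n, u < p ^ s →
      ‖B (u + n * p ^ s) - B u * (A 0 (u + n * p ^ s) / A 0 u)‖ ≤ ε ^ (s + 1) * G s n)
    (s : ℕ) (N : ℤ) (m : ℕ) : ‖blockSum p B (A 0) N s m‖ ≤ ε ^ (s + 1) * G s m := by
  induction s using Nat.strong_induction_on generalizing N m with
  | _ s ih =>
  -- At `t = s` a single block at the origin is left, with multiplier `A s m` because `A s 0 = 1`.
  have step : ∀ (N : ℤ) (m : ℕ), ‖blockSum p B (A 0) (N + (m * p ^ s : ℕ)) s m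
      - A s m * blockSum p B (A 0) N s 0‖ ≤ ε ^ (s + 1) * G s m := fun N m => by
    simpa [h.zero] using h.blockSum_step hε hB s ih s le_rfl N m
  have hs : 0 < p ^ s := pow_pos hp s
  -- Induction on `N` for the block at the origin: all blocks together cancel by antisymmetry, and
  -- every other block is, up to the allowed error, a multiple of the origin block for a smaller
  -- `N`.
  have zero : ∀ (M : ℕ) (N : ℤ), N < M → ‖blockSum p B (A 0) N s 0‖ ≤ ε ^ (s + 1) := by
    intro M
    induction M with
    | zero =>
      intro N hN
      have : blockSum p B (A 0) N s 0 = 0 := by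
        refine Finset.sum_eq_zero fun j _ => ?_
        rw [zext_of_neg _ (by push_cast at hN ⊢; lia), zext_of_neg _ (by push_cast at hN ⊢; lia)]
        simp
      rw [this, norm_zero]
      positivity
    | succ M ihM =>
      intro N hN
      have hsum := sum_blockSum p B (A 0) N s (M + 1) (lt_of_lt_of_le hN (by
        exact_mod_cast Nat.le_mul_of_pos_left _ hs))
      rw [Finset.sum_range_succ', add_comm] at hsum
      rw [eq_neg_of_add_eq_zero_left hsum, norm_neg]
      refine norm_sum_le_of_le (by positivity) fun i _ => ?_
      have h1 := step (N - ((i + 1) * p ^ s : ℕ)) (i + 1)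
      rw [sub_add_cancel] at h1
      have h2 := ihM (N - ((i + 1) * p ^ s : ℕ)) (by
        have : 1 ≤ (i + 1) * p ^ s := Nat.mul_pos (Nat.succ_pos _) hs
        push_cast at hN ⊢
        have : (1 : ℤ) ≤ (i + 1) * p ^ s := by exact_mod_cast this
        lia)
      rw [← sub_add_cancel (blockSum p B (A 0) N s (i + 1)) _]
      refine norm_add_le_of_le (h1.trans ?_) ?_
      · exact mul_le_of_le_one_right (by positivity) (h.gauge_le _ _)
      · rw [norm_mul]
        exact (mul_le_of_le_one_left (norm_nonneg _) (h.norm_le_one _ _)).trans h2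
  have h1 := step (N - (m * p ^ s : ℕ)) m
  rw [sub_add_cancel] at h1
  rw [← sub_add_cancel (blockSum p B (A 0) N s m) _]
  refine norm_add_le_of_le h1 ?_
  rw [norm_mul, mul_comm]
  refine mul_le_mul (zero ((N - (m * p ^ s : ℕ)).toNat + 1) _ (by lia)) (h.norm_le _ _)
    (norm_nonneg _) (by positivity)

end DworkCongruence

/-! ### Products and harmonic sums over `p`-adic units in an interval -/

section UnitProducts

theorem dvd_prod_sub_prod {R ι : Type*} [CommRing R] (d : R) (s : Finset ι) (f g : ι → R)
    (h : ∀ i ∈ s, d ∣ f i - g i) : d ∣ ∏ i ∈ s, f i - ∏ i ∈ s, g i := by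
  simp only [← Ideal.mem_span_singleton, ← Ideal.Quotient.eq] at h ⊢
  rw [map_prod, map_prod]
  exact Finset.prod_congr rfl h

theorem sq_dvd_prod_one_add_sub {R ι : Type*} [CommRing R] (d : R) (s : Finset ι) (y : ι → R) :
    d ^ 2 ∣ ∏ i ∈ s, (1 + d * y i) - (1 + d * ∑ i ∈ s, y i) := by
  classical
  induction s using Finset.induction_on with
  | empty => simp
  | insert a s ha ih =>
    rw [Finset.prod_insert ha, Finset.sum_insert ha]
    obtain ⟨c, hc⟩ := ih
    rw [sub_eq_iff_eq_add] at hc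
    rw [hc]
    exact ⟨c * (1 + d * y a) + y a * ∑ i ∈ s, y i, by ring⟩

variable {p : ℕ} [Fact p.Prime]

theorem isUnit_of_not_dvd {x : ℤ_[p]} (h : ¬ (p : ℤ_[p]) ∣ x) : IsUnit x := by
  by_contra hx
  exact h ((PadicInt.norm_lt_one_iff_dvd x).1 (PadicInt.not_isUnit_iff.1 hx))

theorem exists_nat_dvd_sub {d : ℤ_[p]} (hd : d ≠ 0) (x : ℤ_[p]) : ∃ n : ℕ, d ∣ x - n := by
  have h := PadicInt.appr_spec d.valuation x
  rw [Ideal.mem_span_singleton] at h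
  refine ⟨_, dvd_trans ?_ h⟩
  conv_lhs => rw [PadicInt.unitCoeff_spec hd]
  exact Units.mul_left_dvd.2 dvd_rfl

theorem norm_le_inv_pow_iff (x : ℤ_[p]) (n : ℕ) :
    ‖(x : ℚ_[p])‖ ≤ (p : ℝ)⁻¹ ^ n ↔ (p : ℤ_[p]) ^ n ∣ x := by
  rw [← Ideal.mem_span_singleton, ← PadicInt.norm_le_pow_iff_mem_span_pow, PadicInt.norm_def,
    zpow_neg, zpow_natCast, inv_pow]

theorem coe_prod {ι : Type*} (s : Finset ι) (f : ι → ℤ_[p]) :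
    ((∏ i ∈ s, f i : ℤ_[p]) : ℚ_[p]) = ∏ i ∈ s, (f i : ℚ_[p]) :=
  map_prod (PadicInt.Coe.ringHom (p := p)) f s

open Classical in
/-- The prime-to-`p` part of the factor `x`: it is `x` for units and `1` otherwise. -/
def unitPart (x : ℤ_[p]) : ℤ_[p] := if (p : ℤ_[p]) ∣ x then 1 else x

open Classical in
/-- The complementary part: `x` if `p ∣ x` and `1` otherwise. -/
def multPart (x : ℤ_[p]) : ℤ_[p] := if (p : ℤ_[p]) ∣ x then x else 1

open Classical in
/-- The inverse of `x` for units `x`, and `0` otherwise. -/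
def unitInv (x : ℤ_[p]) : ℤ_[p] := if (p : ℤ_[p]) ∣ x then 0 else x.inv

theorem unitPart_mul_multPart (x : ℤ_[p]) : unitPart x * multPart x = x := by
  unfold unitPart multPart; split_ifs <;> simp

theorem isUnit_unitPart (x : ℤ_[p]) : IsUnit (unitPart x) := by
  unfold unitPart
  split_ifs with h
  · exact isUnit_one
  · exact isUnit_of_not_dvd h

theorem mul_unitInv {x : ℤ_[p]} (h : ¬ (p : ℤ_[p]) ∣ x) : x * unitInv x = 1 := by
  rw [unitInv, if_neg h]
  exact PadicInt.mul_inv (PadicInt.isUnit_iff.1 (isUnit_of_not_dvd h))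

theorem unitInv_neg (x : ℤ_[p]) : unitInv (-x) = -unitInv x := by
  by_cases h : (p : ℤ_[p]) ∣ x
  · rw [unitInv, unitInv, if_pos h, if_pos ((dvd_neg).2 h), neg_zero]
  · have h' : ¬ (p : ℤ_[p]) ∣ -x := by rwa [dvd_neg]
    refine (isUnit_of_not_dvd h').mul_left_cancel ?_
    rw [mul_unitInv h', neg_mul_neg, mul_unitInv h]

theorem dvd_iff_of_dvd_sub {d x y : ℤ_[p]} (hd : (p : ℤ_[p]) ∣ d) (h : d ∣ x - y) :
    (p : ℤ_[p]) ∣ x ↔ (p : ℤ_[p]) ∣ y :=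
  dvd_iff_dvd_of_dvd_sub (hd.trans h)

theorem unitPart_congr {d x y : ℤ_[p]} (hd : (p : ℤ_[p]) ∣ d) (h : d ∣ x - y) :
    d ∣ unitPart x - unitPart y := by
  unfold unitPart
  rw [dvd_iff_of_dvd_sub hd h]
  split_ifs <;> simp [h]

theorem unitInv_congr {d x y : ℤ_[p]} (hd : (p : ℤ_[p]) ∣ d) (h : d ∣ x - y) :
    d ∣ unitInv x - unitInv y := by
  have hxy := dvd_iff_of_dvd_sub hd h
  by_cases hy : (p : ℤ_[p]) ∣ y
  · rw [unitInv, unitInv, if_pos hy, if_pos (hxy.2 hy)]; simp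
  · have hx := fun hx => hy (hxy.1 hx)
    have e : unitInv x - unitInv y = -(x - y) * (unitInv x * unitInv y) := by
      linear_combination unitInv y * mul_unitInv hx - unitInv x * mul_unitInv hy
    rw [e]
    exact Dvd.dvd.mul_right ((dvd_neg).2 h) _

theorem unitPart_add {d : ℤ_[p]} (hd : (p : ℤ_[p]) ∣ d) (x : ℤ_[p]) :
    unitPart (x + d) = unitPart x * (1 + d * unitInv x) := by
  have hxy : (p : ℤ_[p]) ∣ x + d ↔ (p : ℤ_[p]) ∣ x := dvd_add_left hd
  by_cases hx : (p : ℤ_[p]) ∣ x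
  · rw [unitPart, unitPart, unitInv, if_pos hx, if_pos hx, if_pos (hxy.2 hx)]; simp
  · rw [unitPart, unitPart, if_neg hx, if_neg (fun h => hx (hxy.1 h))]
    linear_combination (-d) * mul_unitInv hx

/-- The product of the units in `{α, α + 1, …, α + M - 1}`. -/
def unitProd (α : ℤ_[p]) (M : ℕ) : ℤ_[p] := ∏ i ∈ Finset.range M, unitPart (α + (i : ℤ_[p]))

/-- The sum of the inverses of the units in `{α, α + 1, …, α + M - 1}`. -/
def unitHarm (α : ℤ_[p]) (M : ℕ) : ℤ_[p] := ∑ i ∈ Finset.range M, unitInv (α + (i : ℤ_[p]))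

theorem isUnit_unitProd (α : ℤ_[p]) (M : ℕ) : IsUnit (unitProd α M) := by
  rw [unitProd, IsUnit.prod_iff]
  exact fun i _ => isUnit_unitPart _

theorem unitProd_add (α : ℤ_[p]) (M N : ℕ) :
    unitProd α (M + N) = unitProd α M * unitProd (α + (M : ℤ_[p])) N := by
  simp only [unitProd, Finset.prod_range_add, Nat.cast_add, add_assoc]

theorem unitHarm_add (α : ℤ_[p]) (M N : ℕ) :
    unitHarm α (M + N) = unitHarm α M + unitHarm (α + (M : ℤ_[p])) N := by
  simp only [unitHarm, Finset.sum_range_add, Nat.cast_add, add_assoc]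

theorem unitProd_congr_left {d α β : ℤ_[p]} (hd : (p : ℤ_[p]) ∣ d) (h : d ∣ α - β) (M : ℕ) :
    d ∣ unitProd α M - unitProd β M :=
  dvd_prod_sub_prod d _ _ _ fun i _ => unitPart_congr hd (by simpa using h)

theorem unitHarm_congr_left {d α β : ℤ_[p]} (hd : (p : ℤ_[p]) ∣ d) (h : d ∣ α - β) (M : ℕ) :
    d ∣ unitHarm α M - unitHarm β M := by
  rw [unitHarm, unitHarm, ← Finset.sum_sub_distrib]
  exact Finset.dvd_sum fun i _ => unitInv_congr hd (by simpa using h)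

/-- Split the interval of length `n + M` from `α` in both orders. The two pieces of length `n` start
at points congruent modulo `d`, and they are units, so they can be cancelled. -/
theorem dvd_unitProd_shift {d : ℤ_[p]} (hd : (p : ℤ_[p]) ∣ d) {M : ℕ} (hM : d ∣ M)
    (α : ℤ_[p]) (n : ℕ) : d ∣ unitProd (α + (n : ℤ_[p])) M - unitProd α M := by
  have h1 := unitProd_add α n M
  rw [add_comm n M, unitProd_add α M n] at h1
  have h2 : d ∣ unitProd (α + (M : ℤ_[p])) n - unitProd α n := unitProd_congr_left hd (by simpa using hM) n
  have h3 : d ∣ unitProd α n * (unitProd (α + (n : ℤ_[p])) M - unitProd α M) := by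
    rw [show unitProd α n * (unitProd (α + (n : ℤ_[p])) M - unitProd α M)
      = unitProd α M * (unitProd (α + (M : ℤ_[p])) n - unitProd α n) by linear_combination -h1]
    exact Dvd.dvd.mul_left h2 _
  exact (isUnit_unitProd α n).dvd_mul_left.1 h3

theorem dvd_unitHarm_shift {d : ℤ_[p]} (hd : (p : ℤ_[p]) ∣ d) {M : ℕ} (hM : d ∣ M)
    (α : ℤ_[p]) (n : ℕ) : d ∣ unitHarm (α + (n : ℤ_[p])) M - unitHarm α M := by
  have h1 := unitHarm_add α n M
  rw [add_comm n M, unitHarm_add α M n] at h1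
  have h2 : d ∣ unitHarm (α + (M : ℤ_[p])) n - unitHarm α n := unitHarm_congr_left hd (by simpa using hM) n
  rwa [show unitHarm (α + (n : ℤ_[p])) M - unitHarm α M = unitHarm (α + (M : ℤ_[p])) n - unitHarm α n by
    linear_combination -h1]

/-- Modulo `d` the shift `α - β` is a natural number, since `ℕ` is dense in `ℤ_p`. -/
theorem dvd_unitProd_sub {d : ℤ_[p]} (hd : (p : ℤ_[p]) ∣ d) (hd0 : d ≠ 0) {M : ℕ} (hM : d ∣ M)
    (α β : ℤ_[p]) : d ∣ unitProd α M - unitProd β M := by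
  obtain ⟨n, hn⟩ := exists_nat_dvd_sub hd0 (α - β)
  have h1 := dvd_unitProd_shift hd hM β n
  have h2 := unitProd_congr_left (β := β + n) hd (by rwa [← sub_sub]) M (α := α)
  simpa using dvd_add h2 h1

theorem dvd_unitHarm_sub {d : ℤ_[p]} (hd : (p : ℤ_[p]) ∣ d) (hd0 : d ≠ 0) {M : ℕ} (hM : d ∣ M)
    (α β : ℤ_[p]) : d ∣ unitHarm α M - unitHarm β M := by
  obtain ⟨n, hn⟩ := exists_nat_dvd_sub hd0 (α - β)
  have h1 := dvd_unitHarm_shift hd hM β n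
  have h2 := unitHarm_congr_left (β := β + n) hd (by rwa [← sub_sub]) M (α := α)
  simpa using dvd_add h2 h1

theorem unitHarm_reflect (α : ℤ_[p]) (M : ℕ) :
    unitHarm (-α - (M : ℤ_[p]) + 1) M = -unitHarm α M := by
  rw [unitHarm, unitHarm, ← Finset.sum_range_reflect, ← Finset.sum_neg_distrib]
  refine Finset.sum_congr rfl fun i hi => ?_
  have hi' := Finset.mem_range.1 hi
  rw [← unitInv_neg, Nat.sub_sub, Nat.cast_sub (by lia)]
  congr 1
  push_cast
  ring

/-- Reflecting `x ↦ -x` reverses the sign of the sum, whose class modulo `d` does not depend on the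
starting point; hence it is congruent to its own negative. The 2 is needed at `p = 2`, already for
`M = 2`, and is the source of the factors 2 for the unit products. -/
theorem dvd_two_mul_unitHarm {d : ℤ_[p]} (hd : (p : ℤ_[p]) ∣ d) (hd0 : d ≠ 0) {M : ℕ}
    (hM : d ∣ M) (α : ℤ_[p]) : d ∣ 2 * unitHarm α M := by
  have h := dvd_unitHarm_sub hd hd0 hM α (-α - (M : ℤ_[p]) + 1)
  rwa [unitHarm_reflect, sub_neg_eq_add, ← two_mul] at h

theorem unitProd_add_left {d : ℤ_[p]} (hd : (p : ℤ_[p]) ∣ d) (α : ℤ_[p]) (M : ℕ) :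
    unitProd (α + d) M =
      unitProd α M * ∏ i ∈ Finset.range M, (1 + d * unitInv (α + (i : ℤ_[p]))) := by
  rw [unitProd, unitProd, ← Finset.prod_mul_distrib]
  refine Finset.prod_congr rfl fun i _ => ?_
  rw [← unitPart_add hd]
  ring_nf

theorem sq_dvd_unitProd_add_left {d : ℤ_[p]} (hd : (p : ℤ_[p]) ∣ d) (α : ℤ_[p]) (M : ℕ) :
    d ^ 2 ∣ unitProd (α + d) M - unitProd α M * (1 + d * unitHarm α M) := by
  rw [unitProd_add_left hd, ← mul_sub]
  exact Dvd.dvd.mul_left (sq_dvd_prod_one_add_sub d (Finset.range M) _) _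

/-- Let `M ∣ N`. Shifting the interval of length `M` by `N` multiplies its product by `1 + N H`
modulo `N^2`, with `H` its harmonic sum, and `2H` is divisible by `M`. -/
theorem mul_dvd_unitProd_add {M N : ℕ} (hM : p ∣ M) (hN : p ∣ N) (α : ℤ_[p]) :
    (M * N : ℤ_[p]) ∣ 2 * (unitProd α (M + N) - unitProd α M * unitProd α N) := by
  wlog h : (M : ℤ_[p]) ∣ N generalizing M N
  · have h' : (N : ℤ_[p]) ∣ M := (ValuationRing.dvd_total _ _).resolve_left h
    have := this hN hM h'
    rwa [add_comm, mul_comm (N : ℤ_[p]), mul_comm (unitProd α N)] at this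
  rcases eq_or_ne M 0 with rfl | hM0
  · simp [unitProd]
  have hN' : (p : ℤ_[p]) ∣ N := Nat.cast_dvd_cast hN
  have hM' : (p : ℤ_[p]) ∣ M := Nat.cast_dvd_cast hM
  rw [add_comm, unitProd_add]
  have h1 := sq_dvd_unitProd_add_left hN' α M
  have h2 := dvd_two_mul_unitHarm hM' (by exact_mod_cast hM0) dvd_rfl α (M := M)
  have h3 : (M * N : ℤ_[p]) ∣ (N : ℤ_[p]) ^ 2 := by rw [sq]; exact mul_dvd_mul_right h _
  have h4 : (M * N : ℤ_[p]) ∣ N * (2 * unitHarm α M) := by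
    rw [mul_comm]; exact mul_dvd_mul_left _ h2
  rw [show 2 * (unitProd α N * unitProd (α + (N : ℤ_[p])) M - unitProd α M * unitProd α N) =
    (unitProd (α + (N : ℤ_[p])) M - unitProd α M * (1 + (N : ℤ_[p]) * unitHarm α M)) * (2 * unitProd α N) +
    (N : ℤ_[p]) * (2 * unitHarm α M) * (unitProd α M * unitProd α N) by ring]
  exact dvd_add (Dvd.dvd.mul_right (h3.trans h1) _) (Dvd.dvd.mul_right h4 _)

/-- Rearranging the interval of length `n + M` trades a shift by `n` of the length-`M` product for a
shift by `M` of the length-`n` product; only the latter shift is small enough to expand. -/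
theorem sq_dvd_unitProd_one_add {M : ℕ} (hM : p ∣ M) (n : ℕ) :
    (M : ℤ_[p]) ^ 2 ∣ unitProd (1 + (n : ℤ_[p])) M - unitProd 1 M * (1 + (M : ℤ_[p]) * unitHarm 1 n) := by
  have hM' : (p : ℤ_[p]) ∣ M := Nat.cast_dvd_cast hM
  have h1 := unitProd_add (1 : ℤ_[p]) n M
  rw [add_comm n M, unitProd_add] at h1
  have h2 := sq_dvd_unitProd_add_left hM' 1 n
  refine (isUnit_unitProd 1 n).dvd_mul_left.1 ?_
  rw [show unitProd 1 n * (unitProd (1 + (n : ℤ_[p])) M - unitProd 1 M * (1 + (M : ℤ_[p]) * unitHarm 1 n)) =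
    unitProd 1 M * (unitProd (1 + (M : ℤ_[p])) n - unitProd 1 n * (1 + (M : ℤ_[p]) * unitHarm 1 n)) by
    linear_combination -h1]
  exact Dvd.dvd.mul_left h2 _

/-- The rising factorial `α (α + 1) ⋯ (α + n - 1)`. -/
def rising (α : ℤ_[p]) (n : ℕ) : ℤ_[p] := ∏ i ∈ Finset.range n, (α + (i : ℤ_[p]))

theorem coe_rising (α : ℤ_[p]) (n : ℕ) :
    (rising α n : ℚ_[p]) = (ascPochhammer ℚ_[p] n).eval (α : ℚ_[p]) := by
  induction n with
  | zero => simp [rising]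
  | succ n ih =>
    rw [ascPochhammer_succ_eval, ← ih]
    simp [rising, Finset.prod_range_succ]

theorem rising_ne_zero {α : ℤ_[p]} (h : ∀ m : ℕ, α ≠ -(m : ℤ_[p])) (n : ℕ) : rising α n ≠ 0 := by
  rw [rising, Finset.prod_ne_zero_iff]
  exact fun i _ hi => h i (eq_neg_of_add_eq_zero_left hi)

theorem lastDigit_lt (α : ℤ_[p]) : lastDigit α < p := PadicInt.zmodRepr_lt_p _

theorem dvd_add_iff_eq_lastDigit (α : ℤ_[p]) {l : ℕ} (hl : l < p) (u : ℕ) :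
    (p : ℤ_[p]) ∣ α + ((l + u * p : ℕ) : ℤ_[p]) ↔ l = lastDigit α := by
  have e : α + ((l + u * p : ℕ) : ℤ_[p]) = (α + l) + p * u := by push_cast; ring
  rw [e, dvd_add_left (dvd_mul_right _ _)]
  constructor
  · intro h
    refine (PadicInt.zmodRepr_unique _ _ hl ?_).symm
    rw [PadicInt.maximalIdeal_eq_span_p, Ideal.mem_span_singleton]
    rw [← dvd_neg]
    convert h using 1
    ring
  · rintro rfl
    exact dvd_add_lastDigit α

theorem add_lastDigit_eq (α : ℤ_[p]) (u : ℕ) :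
    α + ((lastDigit α + u * p : ℕ) : ℤ_[p]) = p * (dworkPrime α + u) := by
  rw [mul_add, mul_dworkPrime]
  push_cast
  ring

theorem prod_multPart (α : ℤ_[p]) {l : ℕ} (hl : l ≤ p) (u : ℕ) :
    ∏ i ∈ Finset.range l, multPart (α + ((i + u * p : ℕ) : ℤ_[p])) =
      if lastDigit α < l then (p : ℤ_[p]) * (dworkPrime α + u) else 1 := by
  have h : ∀ i ∈ Finset.range l, multPart (α + ((i + u * p : ℕ) : ℤ_[p])) =
      if i = lastDigit α then (p : ℤ_[p]) * (dworkPrime α + u) else 1 := by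
    intro i hi
    have hi' : i < p := (Finset.mem_range.1 hi).trans_le hl
    unfold multPart
    rw [dvd_add_iff_eq_lastDigit α hi' u]
    split_ifs with h
    · rw [h, add_lastDigit_eq]
    · rfl
  rw [Finset.prod_congr rfl h, Finset.prod_ite_eq']
  simp

theorem prod_range_mul_eq {M : Type*} [CommMonoid M] (a b : ℕ) (f : ℕ → M) :
    ∏ j ∈ Finset.range (a * b), f j =
      ∏ i ∈ Finset.range b, ∏ j ∈ Finset.range a, f (j + i * a) :=
  sum_range_mul_eq (M := Additive M) a b f

/-- The decomposition of a rising factorial into its unit part and a rising factorial of the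
Dwork prime. -/
theorem rising_eq (α : ℤ_[p]) {l : ℕ} (hl : l ≤ p) (u : ℕ) :
    rising α (l + u * p) = unitProd α (l + u * p) * (p ^ u * rising (dworkPrime α) u *
      if lastDigit α < l then (p : ℤ_[p]) * (dworkPrime α + u) else 1) := by
  have h1 : rising α (l + u * p) =
      unitProd α (l + u * p) * ∏ i ∈ Finset.range (l + u * p), multPart (α + (i : ℤ_[p])) := by
    rw [rising, unitProd, ← Finset.prod_mul_distrib]
    exact Finset.prod_congr rfl fun i _ => (unitPart_mul_multPart _).symm
  rw [h1, add_comm l, Finset.prod_range_add, mul_comm u p, prod_range_mul_eq]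
  congr 2
  · have h2 : ∀ i ∈ Finset.range u, ∏ j ∈ Finset.range p, multPart (α + ((j + i * p : ℕ) : ℤ_[p])) =
        p * (dworkPrime α + i) := fun i _ => by
      rw [prod_multPart α le_rfl, if_pos (lastDigit_lt α)]
    rw [Finset.prod_congr rfl h2, Finset.prod_mul_distrib]
    simp [rising]
  · rw [← prod_multPart α hl u]
    refine Finset.prod_congr rfl fun i _ => ?_
    rw [mul_comm p u, add_comm (u * p) i]

end UnitProducts

/-! ### The coefficients of a hypergeometric series form a Dwork chain -/

section Chain

variable {k : Type*} [NormedField k]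
  {p : ℕ} {ε : ℝ} {A : ℕ → ℕ → k} {G : ℕ → ℕ → ℝ}

theorem DworkChain.shift (h : DworkChain p ε A G) (d : ℕ) :
    DworkChain p ε (fun r => A (d + r)) (fun r => G (d + r)) where
  zero r := h.zero _
  ne_zero r := h.ne_zero _
  norm_le r := h.norm_le _
  gauge_le r := h.gauge_le _
  congr r s l u n hl hu := by
    simpa only [add_assoc] using h.congr (d + r) s l u n hl hu

variable [IsUltrametricDist k]

theorem DworkChain.congr_iterate (h : DworkChain p ε A G) (hp : 0 < p) (hε : 0 ≤ ε) (hε1 : ε ≤ 1)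
    (hG : ∀ r l u, l < p → G r (l + u * p) ≤ G (r + 1) u)
    (d r l s u n : ℕ) (hl : l < p ^ d) (hu : u < p ^ s) :
    G r (l + u * p ^ d) * ‖A r (l + (u + n * p ^ s) * p ^ d) / A r (l + u * p ^ d)
      - A (r + d) (u + n * p ^ s) / A (r + d) u‖ ≤ ε ^ (s + 1) * G (r + d + s) n := by
  induction d generalizing r l with
  | zero =>
    obtain rfl : l = 0 := by simpa using hl
    have := mul_nonneg (pow_nonneg hε (s + 1)) (h.gauge_nonneg (r + s) n)
    simpa using this
  | succ d ih =>
    have hl0 : l % p < p := Nat.mod_lt _ hp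
    have hl1 : l / p < p ^ d := Nat.div_lt_of_lt_mul (by rwa [pow_succ'] at hl)
    have hl2 : l = l % p + l / p * p := by rw [mul_comm, Nat.mod_add_div]
    set l0 := l % p
    set l1 := l / p
    have hu1 : l1 + u * p ^ d < p ^ (d + s) := by
      calc l1 + u * p ^ d < p ^ d + u * p ^ d := by lia
        _ = (u + 1) * p ^ d := by ring
        _ ≤ p ^ s * p ^ d := Nat.mul_le_mul_right _ hu
        _ = _ := by ring
    have e1 : l + u * p ^ (d + 1) = l0 + (l1 + u * p ^ d) * p := by rw [hl2]; ring
    have e2 : l + (u + n * p ^ s) * p ^ (d + 1)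
        = l0 + (l1 + u * p ^ d) * p + n * p ^ (d + s + 1) := by rw [hl2]; ring
    have e3 : l1 + u * p ^ d + n * p ^ (d + s) = l1 + (u + n * p ^ s) * p ^ d := by ring
    have h1 := h.congr r (d + s) l0 (l1 + u * p ^ d) n hl0 hu1
    have h2 := ih (r + 1) l1 hl1
    rw [e1, e2]
    rw [e3] at h1
    rw [show r + 1 + d = r + (d + 1) by ring] at h2
    rw [show r + (d + s) + 1 = r + (d + 1) + s by ring] at h1
    have hg := h.gauge_nonneg (r + (d + 1) + s) n
    have h3 : ‖A r (l0 + (l1 + u * p ^ d) * p + n * p ^ (d + s + 1)) /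
        A r (l0 + (l1 + u * p ^ d) * p) - A (r + (d + 1)) (u + n * p ^ s) / A (r + (d + 1)) u‖ ≤
        max ‖A r (l0 + (l1 + u * p ^ d) * p + n * p ^ (d + s + 1)) /
          A r (l0 + (l1 + u * p ^ d) * p) -
          A (r + 1) (l1 + (u + n * p ^ s) * p ^ d) / A (r + 1) (l1 + u * p ^ d)‖
        ‖A (r + 1) (l1 + (u + n * p ^ s) * p ^ d) / A (r + 1) (l1 + u * p ^ d)
          - A (r + (d + 1)) (u + n * p ^ s) / A (r + (d + 1)) u‖ := by
      rw [← sub_add_sub_cancel _ (A (r + 1) (l1 + (u + n * p ^ s) * p ^ d) /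
        A (r + 1) (l1 + u * p ^ d)) _]
      exact IsUltrametricDist.norm_add_le_max _ _
    refine (mul_le_mul_of_nonneg_left h3 (h.gauge_nonneg _ _)).trans ?_
    rw [mul_max_of_nonneg _ _ (h.gauge_nonneg _ _)]
    refine max_le (h1.trans (mul_le_mul_of_nonneg_right ?_ hg)) (le_trans ?_ h2)
    · exact pow_le_pow_of_le_one hε hε1 (by lia)
    · exact mul_le_mul_of_nonneg_right (hG _ _ _ hl0) (norm_nonneg _)

/-- The congruences between the subsequence `j ↦ A 0 (l + j p^d)` and the sequence `A d`. -/
theorem DworkChain.norm_blockSum_iterate_le (h : DworkChain p ε A G) (hp : 0 < p) (hε : 0 ≤ ε)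
    (hε1 : ε ≤ 1) (hG : ∀ r l u, l < p → G r (l + u * p) ≤ G (r + 1) u)
    {d l : ℕ} (hl : l < p ^ d) (s : ℕ) (N : ℤ) :
    ‖blockSum p (fun j => A 0 (l + j * p ^ d)) (A d) N s 0‖ ≤ ε ^ (s + 1) := by
  have h1 := (h.shift d).norm_blockSum_le hp hε (B := fun j => A 0 (l + j * p ^ d))
    (fun s u n hu => by
      have h2 := h.congr_iterate hp hε hε1 hG d 0 l s u n hl hu
      rw [zero_add] at h2
      have h0 := h.ne_zero 0 (l + u * p ^ d)
      have e : A 0 (l + (u + n * p ^ s) * p ^ d)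
          - A 0 (l + u * p ^ d) * (A (d + 0) (u + n * p ^ s) / A (d + 0) u)
          = A 0 (l + u * p ^ d) * (A 0 (l + (u + n * p ^ s) * p ^ d) / A 0 (l + u * p ^ d)
            - A d (u + n * p ^ s) / A d u) := by
        rw [mul_sub, mul_div_cancel₀ _ h0]; rfl
      rw [e, norm_mul]
      exact (mul_le_mul_of_nonneg_right (h.norm_le _ _) (norm_nonneg _)).trans h2) s N 0
  exact h1.trans (mul_le_of_le_one_right (by positivity) (h.gauge_le _ _))

end Chain

/-! ### Ultrametric comparison of products -/

section Products

variable {k : Type*} [NormedField k]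

theorem norm_prod_le_one {ι : Type*} (s : Finset ι) (f : ι → k) (h : ∀ i ∈ s, ‖f i‖ ≤ 1) :
    ‖∏ i ∈ s, f i‖ ≤ 1 := by
  rw [norm_prod]
  exact Finset.prod_le_one (fun i _ => norm_nonneg _) h

variable [IsUltrametricDist k]

theorem mul_norm_mul_sub_mul_le {c δ : ℝ} (hc : 0 ≤ c) {x y x' y' : k}
    (h : c * ‖x - y‖ ≤ δ) (h' : c * ‖x' - y'‖ ≤ δ) (hx : ‖x'‖ ≤ 1) (hy : ‖y‖ ≤ 1) :
    c * ‖x * x' - y * y'‖ ≤ δ := by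
  have e : x * x' - y * y' = (x - y) * x' + y * (x' - y') := by ring
  rw [e]
  refine (mul_le_mul_of_nonneg_left (IsUltrametricDist.norm_add_le_max _ _) hc).trans ?_
  rw [mul_max_of_nonneg _ _ hc, norm_mul, norm_mul]
  refine max_le (le_trans ?_ h) (le_trans ?_ h')
  · exact mul_le_mul_of_nonneg_left (mul_le_of_le_one_right (norm_nonneg _) hx) hc
  · exact mul_le_mul_of_nonneg_left (mul_le_of_le_one_left (norm_nonneg _) hy) hc

theorem mul_norm_prod_sub_prod_le {ι : Type*} {c δ : ℝ} (hc : 0 ≤ c) (hδ : 0 ≤ δ)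
    (s : Finset ι) (f g : ι → k) (h : ∀ i ∈ s, c * ‖f i - g i‖ ≤ δ)
    (hf : ∀ i ∈ s, ‖f i‖ ≤ 1) (hg : ∀ i ∈ s, ‖g i‖ ≤ 1) :
    c * ‖∏ i ∈ s, f i - ∏ i ∈ s, g i‖ ≤ δ := by
  classical
  induction s using Finset.induction_on with
  | empty => simpa using hδ
  | insert a s ha ih =>
    rw [Finset.prod_insert ha, Finset.prod_insert ha]
    simp only [Finset.mem_insert, forall_eq_or_imp] at h hf hg
    exact mul_norm_mul_sub_mul_le hc h.1 (ih h.2 hf.2 hg.2) (norm_prod_le_one _ _ hf.2) hg.1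

end Products

/-! ### Hypergeometric coefficients and their reduction to Dwork primes -/

section Coefficients

variable {p : ℕ} [Fact p.Prime] {ι : Type*} [Fintype ι]

theorem dworkIter_zero (α : ℤ_[p]) : dworkIter 0 α = α := rfl

theorem dworkIter_succ (r : ℕ) (α : ℤ_[p]) :
    dworkIter (r + 1) α = dworkPrime (dworkIter r α) := Function.iterate_succ_apply' _ _ _

theorem lastDigit_one : lastDigit (1 : ℤ_[p]) = p - 1 := by
  have hp : 1 ≤ p := (Fact.out : p.Prime).one_lt.le
  refine ((dvd_add_iff_eq_lastDigit (1 : ℤ_[p]) (l := p - 1) (by lia) 0).1 ?_).symm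
  rw [zero_mul, add_zero, Nat.cast_sub hp]
  simp

theorem dworkPrime_one : dworkPrime (1 : ℤ_[p]) = 1 := by
  have hp : 1 ≤ p := (Fact.out : p.Prime).one_lt.le
  have h := mul_dworkPrime (1 : ℤ_[p])
  rw [lastDigit_one, Nat.cast_sub hp] at h
  have hp0 : (p : ℤ_[p]) ≠ 0 := by exact_mod_cast (Fact.out : p.Prime).ne_zero
  refine mul_left_cancel₀ hp0 ?_
  rw [h]; simp

theorem dworkIter_one (r : ℕ) : dworkIter r (1 : ℤ_[p]) = 1 := by
  induction r with
  | zero => rfl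
  | succ r ih => rw [dworkIter_succ, ih, dworkPrime_one]

theorem dworkPrime_ne_neg {α : ℤ_[p]} (h : ∀ m : ℕ, α ≠ -(m : ℤ_[p])) (m : ℕ) :
    dworkPrime α ≠ -(m : ℤ_[p]) := by
  intro hm
  refine h (lastDigit α + m * p) ?_
  have := add_lastDigit_eq α m
  rw [hm, neg_add_cancel, mul_zero] at this
  exact eq_neg_of_add_eq_zero_left this

theorem norm_add_eq_one {α : ℤ_[p]} {l : ℕ} (hl : l < p) (h : lastDigit α ≠ l) (u : ℕ) :
    ‖α + ((l + u * p : ℕ) : ℤ_[p])‖ = 1 :=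
  PadicInt.isUnit_iff.1 (isUnit_of_not_dvd fun hd =>
    h ((dvd_add_iff_eq_lastDigit α hl u).1 hd).symm)

theorem norm_add_eq {α : ℤ_[p]} {l : ℕ} (hl : l < p) (u : ℕ) :
    ‖α + ((l + u * p : ℕ) : ℤ_[p])‖ =
      if lastDigit α = l then (p : ℝ)⁻¹ * ‖dworkPrime α + u‖ else 1 := by
  split_ifs with h
  · subst h
    rw [add_lastDigit_eq, norm_mul, PadicInt.norm_p]
  · exact norm_add_eq_one hl h u

/-- Parameters `a`, `b` of a balanced hypergeometric series subject to Dwork's conditions, where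
`J` is a set of indices outside of which `b` is `1`. -/
structure DworkData (a b : ι → ℤ_[p]) (J : Finset ι) : Prop where
  num_ne : ∀ i (m : ℕ), a i ≠ -(m : ℤ_[p])
  den_ne : ∀ i (m : ℕ), b i ≠ -(m : ℤ_[p])
  norm_eq_one : ∀ j ∈ J, ∀ r, ‖dworkIter r (b j)‖ = 1
  eq_one : ∀ j, j ∉ J → b j = 1
  card_lt : ∀ r l, (∃ j ∈ J, dworkDigit r (b j) ≤ l) →
    (J.filter fun j => dworkDigit r (b j) ≤ l).card <
      (Finset.univ.filter fun i => dworkDigit r (a i) < l).card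

/-- The coefficients `∏ (a_i)_n / ∏ (b_i)_n`. -/
def coefRatio (a b : ι → ℤ_[p]) (n : ℕ) : ℚ_[p] :=
  (∏ i, (rising (a i) n : ℚ_[p])) / ∏ i, (rising (b i) n : ℚ_[p])

/-- Dwork's gauge of the coefficient sequence. -/
def coefGauge (a b : ι → ℤ_[p]) (J : Finset ι) (n : ℕ) : ℝ :=
  ‖coefRatio a b n‖ / ∏ j ∈ J, ‖b j + n‖

/-- The ratio of the unit parts of the coefficients. -/
def unitRatio (a b : ι → ℤ_[p]) (n : ℕ) : ℚ_[p] :=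
  (∏ i, (unitProd (a i) n : ℚ_[p])) / ∏ i, (unitProd (b i) n : ℚ_[p])

theorem norm_unitProd (α : ℤ_[p]) (n : ℕ) : ‖(unitProd α n : ℚ_[p])‖ = 1 :=
  PadicInt.isUnit_iff.1 (isUnit_unitProd α n)

theorem norm_unitRatio (a b : ι → ℤ_[p]) (n : ℕ) : ‖unitRatio a b n‖ = 1 := by
  simp only [unitRatio, norm_div, norm_prod, norm_unitProd, Finset.prod_const_one, div_one]

theorem coefRatio_ne_zero {a b : ι → ℤ_[p]} {J : Finset ι} (h : DworkData a b J) (n : ℕ) :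
    coefRatio a b n ≠ 0 := by
  refine div_ne_zero (Finset.prod_ne_zero_iff.2 fun i _ => ?_)
    (Finset.prod_ne_zero_iff.2 fun i _ => ?_)
  · exact PadicInt.coe_ne_zero.2 (rising_ne_zero (h.num_ne i) n)
  · exact PadicInt.coe_ne_zero.2 (rising_ne_zero (h.den_ne i) n)

theorem coefRatio_zero (a b : ι → ℤ_[p]) : coefRatio a b 0 = 1 := by
  simp [coefRatio, rising]

/-- The powers `p^u` cancel because there are as many upper as lower parameters. The remaining
quotient comes from the last, incomplete block of `l` factors, which contains a multiple of `p`
exactly when the digit is less than `l`. -/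
theorem coefRatio_step (a b : ι → ℤ_[p]) {l : ℕ} (hl : l ≤ p) (u : ℕ) :
    coefRatio a b (l + u * p) =
      coefRatio (fun i => dworkPrime (a i)) (fun i => dworkPrime (b i)) u *
      (unitRatio a b (l + u * p) *
        (∏ i with lastDigit (a i) < l, ((p : ℚ_[p]) * (dworkPrime (a i) + u : ℤ_[p]))) /
        ∏ i with lastDigit (b i) < l, ((p : ℚ_[p]) * (dworkPrime (b i) + u : ℤ_[p]))) := by
  have key : ∀ c : ι → ℤ_[p], (∏ i, (rising (c i) (l + u * p) : ℚ_[p])) =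
      (∏ i, (unitProd (c i) (l + u * p) : ℚ_[p])) * ((∏ _i : ι, (p : ℚ_[p]) ^ u) *
      (∏ i, (rising (dworkPrime (c i)) u : ℚ_[p])) *
      ∏ i with lastDigit (c i) < l, ((p : ℚ_[p]) * (dworkPrime (c i) + u : ℤ_[p]))) := by
    intro c
    rw [Finset.prod_filter, ← Finset.prod_mul_distrib, ← Finset.prod_mul_distrib,
      ← Finset.prod_mul_distrib]
    refine Finset.prod_congr rfl fun i _ => ?_
    rw [rising_eq _ hl]
    split_ifs <;> simp
  have hp0 : (∏ _i : ι, (p : ℚ_[p]) ^ u) ≠ 0 := Finset.prod_ne_zero_iff.2 fun i _ =>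
    pow_ne_zero _ (by exact_mod_cast (Fact.out : p.Prime).ne_zero)
  rw [coefRatio, key a, key b, coefRatio, unitRatio, mul_div_mul_comm, mul_assoc, mul_assoc,
    mul_div_mul_left _ _ hp0, mul_div_mul_comm (∏ i, (rising (dworkPrime (a i)) u : ℚ_[p])),
    mul_div_assoc]
  ring

end Coefficients

/-! ### Estimates for Dwork's gauge -/

section Gauge

variable {p : ℕ} [Fact p.Prime] {ι : Type*} [Fintype ι] {a b : ι → ℤ_[p]} {J : Finset ι}

theorem DworkData.prime (h : DworkData a b J) :
    DworkData (fun i => dworkPrime (a i)) (fun i => dworkPrime (b i)) J where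
  num_ne i := dworkPrime_ne_neg (h.num_ne i)
  den_ne i := dworkPrime_ne_neg (h.den_ne i)
  norm_eq_one j hj r := h.norm_eq_one j hj (r + 1)
  eq_one j hj := by rw [h.eq_one j hj, dworkPrime_one]
  card_lt r := h.card_lt (r + 1)

theorem DworkData.iter (h : DworkData a b J) (r : ℕ) :
    DworkData (fun i => dworkIter r (a i)) (fun i => dworkIter r (b i)) J := by
  induction r with
  | zero => exact h
  | succ r ih => simpa only [dworkIter_succ] using ih.prime

theorem DworkData.mem_of_lastDigit_lt (h : DworkData a b J) {j : ι} {l : ℕ} (hl : l < p)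
    (hj : lastDigit (b j) < l) : j ∈ J := by
  by_contra hJ
  rw [h.eq_one j hJ, lastDigit_one] at hj
  lia

theorem DworkData.filter_eq (h : DworkData a b J) {l : ℕ} (hl : l < p) :
    (Finset.univ.filter fun j => lastDigit (b j) < l) = J.filter fun j => lastDigit (b j) < l := by
  ext j
  simp only [Finset.mem_filter, Finset.mem_univ, true_and]
  exact ⟨fun hj => ⟨h.mem_of_lastDigit_lt hl hj, hj⟩, fun hj => hj.2⟩

theorem DworkData.norm_add_pos (h : DworkData a b J) (j : ι) (n : ℕ) : 0 < ‖b j + n‖ :=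
  norm_pos_iff.2 fun h0 => h.den_ne j n (eq_neg_of_add_eq_zero_left h0)

theorem DworkData.prod_norm_add_pos (h : DworkData a b J) (s : Finset ι) (n : ℕ) :
    0 < ∏ j ∈ s, ‖b j + n‖ := Finset.prod_pos fun j _ => h.norm_add_pos j n

theorem DworkData.coefGauge_nonneg (h : DworkData a b J) (n : ℕ) : 0 ≤ coefGauge a b J n :=
  div_nonneg (norm_nonneg _) (h.prod_norm_add_pos J n).le

theorem DworkData.coefGauge_mul (h : DworkData a b J) (n : ℕ) :
    coefGauge a b J n * ∏ j ∈ J, ‖b j + n‖ = ‖coefRatio a b n‖ :=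
  div_mul_cancel₀ _ (h.prod_norm_add_pos J n).ne'

theorem DworkData.norm_coefRatio_le (h : DworkData a b J) (n : ℕ) :
    ‖coefRatio a b n‖ ≤ coefGauge a b J n := by
  rw [← h.coefGauge_mul]
  refine mul_le_of_le_one_right (h.coefGauge_nonneg n) (Finset.prod_le_one ?_ ?_)
  · exact fun _ _ => norm_nonneg _
  · exact fun _ _ => PadicInt.norm_le_one _

theorem DworkData.coefGauge_zero (h : DworkData a b J) : coefGauge a b J 0 = 1 := by
  rw [coefGauge, coefRatio_zero, norm_one, Finset.prod_eq_one, div_one]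
  intro j hj
  simpa [dworkIter_zero] using h.norm_eq_one j hj 0

/-- Either there are more numerator digits `< l` than denominator digits `≤ l`, or there are
none of either kind. -/
theorem DworkData.card_cases (h : DworkData a b J) (l : ℕ) :
    (J.filter fun j => lastDigit (b j) ≤ l).card <
      (Finset.univ.filter fun i => lastDigit (a i) < l).card ∨
    ((J.filter fun j => lastDigit (b j) ≤ l).card = 0 ∧
      (Finset.univ.filter fun i => lastDigit (a i) < l).card = 0) := by
  by_cases hJ : ∃ j ∈ J, lastDigit (b j) ≤ l
  · exact Or.inl (h.card_lt 0 l hJ)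
  · have h0 : (J.filter fun j => lastDigit (b j) ≤ l).card = 0 := by
      rw [Finset.card_eq_zero, Finset.filter_eq_empty_iff]
      exact fun j hj hjl => hJ ⟨j, hj, hjl⟩
    rw [h0]
    rcases Nat.eq_zero_or_pos (Finset.univ.filter fun i => lastDigit (a i) < l).card with h1 | h1
    · exact Or.inr ⟨rfl, h1⟩
    · exact Or.inl h1

theorem inv_prime_pos : 0 < (p : ℝ)⁻¹ := inv_pos.2 (by exact_mod_cast (Fact.out : p.Prime).pos)

theorem inv_prime_le_one : (p : ℝ)⁻¹ ≤ 1 :=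
  inv_le_one_of_one_le₀ (by exact_mod_cast (Fact.out : p.Prime).one_lt.le)

/-- Every numerator digit below `l` contributes a factor of norm at most `1/p`. On the other side,
denominator digits below `l` contribute `‖b' + u‖/p` through the coefficient and digits equal to `l`
contribute the same through the gauge's own denominator. Together they are controlled by the
denominator of the gauge at the next level, which is the purpose of dividing by `∏ ‖b_j + n‖`. -/
theorem DworkData.coefGauge_step_le (h : DworkData a b J) {l : ℕ} (hl : l < p) (u : ℕ) :
    coefGauge a b J (l + u * p) * (p : ℝ)⁻¹ ^ (J.filter fun j => lastDigit (b j) ≤ l).card ≤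
      (p : ℝ)⁻¹ ^ (Finset.univ.filter fun i => lastDigit (a i) < l).card *
      coefGauge (fun i => dworkPrime (a i)) (fun i => dworkPrime (b i)) J u := by
  set ε : ℝ := (p : ℝ)⁻¹ with hε
  have hε0 : 0 < ε := inv_prime_pos
  have hε1 : ε ≤ 1 := inv_prime_le_one
  have hB := h.prime.prod_norm_add_pos J u
  have hb := h.prod_norm_add_pos J (l + u * p)
  have hlt : 0 < ∏ j ∈ J with lastDigit (b j) < l, (ε * ‖dworkPrime (b j) + u‖) :=
    Finset.prod_pos fun j _ => mul_pos hε0 (h.prime.norm_add_pos j u)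
  have hnum : ∏ i with lastDigit (a i) < l, (ε * ‖dworkPrime (a i) + u‖) ≤
      ε ^ (Finset.univ.filter fun i => lastDigit (a i) < l).card := by
    rw [Finset.prod_mul_distrib, Finset.prod_const]
    exact mul_le_of_le_one_right (pow_nonneg hε0.le _)
      (Finset.prod_le_one (fun _ _ => norm_nonneg _) fun _ _ => PadicInt.norm_le_one _)
  have hden : ε ^ (J.filter fun j => lastDigit (b j) ≤ l).card *
      ∏ j ∈ J, ‖dworkPrime (b j) + u‖ ≤
      (∏ j ∈ J with lastDigit (b j) < l, (ε * ‖dworkPrime (b j) + u‖)) *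
      ∏ j ∈ J, ‖b j + ((l + u * p : ℕ) : ℤ_[p])‖ := by
    rw [← Finset.prod_const, Finset.prod_filter, Finset.prod_filter, ← Finset.prod_mul_distrib,
      ← Finset.prod_mul_distrib]
    refine Finset.prod_le_prod (fun j _ => by positivity) fun j _ => ?_
    rw [norm_add_eq hl]
    have h1 := PadicInt.norm_le_one (dworkPrime (b j) + (u : ℤ_[p]))
    rcases lt_trichotomy (lastDigit (b j)) l with h2 | h2 | h2
    · simp [h2, h2.le, h2.ne, ε]
    · simp [h2, ε]
    · simpa [h2.not_ge, h2.not_gt, h2.ne'] using h1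
  have hA : ‖coefRatio a b (l + u * p)‖ * ∏ j ∈ J with lastDigit (b j) < l,
      (ε * ‖dworkPrime (b j) + u‖) =
      ‖coefRatio (fun i => dworkPrime (a i)) (fun i => dworkPrime (b i)) u‖ *
      ∏ i with lastDigit (a i) < l, (ε * ‖dworkPrime (a i) + u‖) := by
    rw [coefRatio_step a b hl.le, h.filter_eq hl, norm_mul, norm_div, norm_mul, norm_unitRatio,
      one_mul, norm_prod, norm_prod]
    simp only [norm_mul, Padic.norm_p, PadicInt.padic_norm_e_of_padicInt]
    rw [mul_assoc, div_mul_cancel₀ _ hlt.ne']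
  have e1 := h.coefGauge_mul (l + u * p)
  have e2 := h.prime.coefGauge_mul u
  rw [← e1, ← e2] at hA
  refine le_of_mul_le_mul_right ?_ hB
  calc _ = coefGauge a b J (l + u * p) * (ε ^ (J.filter fun j => lastDigit (b j) ≤ l).card *
      ∏ j ∈ J, ‖dworkPrime (b j) + u‖) := by ring
    _ ≤ coefGauge a b J (l + u * p) *
      ((∏ j ∈ J with lastDigit (b j) < l, (ε * ‖dworkPrime (b j) + u‖)) *
      ∏ j ∈ J, ‖b j + ((l + u * p : ℕ) : ℤ_[p])‖) :=
        mul_le_mul_of_nonneg_left hden (h.coefGauge_nonneg _)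
    _ = coefGauge (fun i => dworkPrime (a i)) (fun i => dworkPrime (b i)) J u *
        (∏ j ∈ J, ‖dworkPrime (b j) + u‖) *
        ∏ i with lastDigit (a i) < l, (ε * ‖dworkPrime (a i) + u‖) := by
        rw [← hA]; ring
    _ ≤ coefGauge (fun i => dworkPrime (a i)) (fun i => dworkPrime (b i)) J u *
        (∏ j ∈ J, ‖dworkPrime (b j) + u‖) *
        ε ^ (Finset.univ.filter fun i => lastDigit (a i) < l).card :=
        mul_le_mul_of_nonneg_left hnum (mul_nonneg (h.prime.coefGauge_nonneg _) hB.le)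
    _ = _ := by ring

theorem DworkData.coefGauge_le_prime (h : DworkData a b J) {l : ℕ} (hl : l < p) (u : ℕ) :
    coefGauge a b J (l + u * p) ≤
      coefGauge (fun i => dworkPrime (a i)) (fun i => dworkPrime (b i)) J u := by
  have h1 := h.coefGauge_step_le hl u
  have hε0 : 0 < (p : ℝ)⁻¹ := inv_prime_pos
  refine le_of_mul_le_mul_right (h1.trans ?_)
    (pow_pos hε0 (J.filter fun j => lastDigit (b j) ≤ l).card)
  rw [mul_comm]
  refine mul_le_mul_of_nonneg_left (pow_le_pow_of_le_one hε0.le inv_prime_le_one ?_)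
    (h.prime.coefGauge_nonneg _)
  rcases h.card_cases l with h2 | ⟨h2, h3⟩
  · exact h2.le
  · rw [h2]; exact Nat.zero_le _

theorem DworkData.coefGauge_le_prime_mul (h : DworkData a b J) {l : ℕ} (hl : l < p) (u : ℕ)
    (hJ : ∃ j ∈ J, lastDigit (b j) ≤ l) :
    coefGauge a b J (l + u * p) ≤
      coefGauge (fun i => dworkPrime (a i)) (fun i => dworkPrime (b i)) J u * (p : ℝ)⁻¹ := by
  have h1 := h.coefGauge_step_le hl u
  have hε0 : 0 < (p : ℝ)⁻¹ := inv_prime_pos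
  refine le_of_mul_le_mul_right (h1.trans ?_)
    (pow_pos hε0 (J.filter fun j => lastDigit (b j) ≤ l).card)
  rw [mul_comm, mul_assoc, ← pow_succ']
  refine mul_le_mul_of_nonneg_left (pow_le_pow_of_le_one hε0.le inv_prime_le_one ?_)
    (h.prime.coefGauge_nonneg _)
  exact h.card_lt 0 l hJ

/-- The coefficients with parameters replaced by their `r`-th Dwork primes. -/
def coefIter (a b : ι → ℤ_[p]) (r : ℕ) : ℕ → ℚ_[p] :=
  coefRatio (fun i => dworkIter r (a i)) (fun i => dworkIter r (b i))

/-- The gauge of `coefIter`. -/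
def gaugeIter (a b : ι → ℤ_[p]) (J : Finset ι) (r : ℕ) : ℕ → ℝ :=
  coefGauge (fun i => dworkIter r (a i)) (fun i => dworkIter r (b i)) J

theorem DworkData.gaugeIter_nonneg (h : DworkData a b J) (r n : ℕ) : 0 ≤ gaugeIter a b J r n :=
  (h.iter r).coefGauge_nonneg n

theorem DworkData.gaugeIter_le_succ (h : DworkData a b J) (r l u : ℕ) (hl : l < p) :
    gaugeIter a b J r (l + u * p) ≤ gaugeIter a b J (r + 1) u := by
  simpa only [gaugeIter, dworkIter_succ] using (h.iter r).coefGauge_le_prime hl u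

theorem DworkData.gaugeIter_le_one (h : DworkData a b J) (r n : ℕ) : gaugeIter a b J r n ≤ 1 := by
  induction n using Nat.strong_induction_on generalizing r with
  | _ n ih =>
  have hp : p.Prime := Fact.out
  rcases Nat.eq_zero_or_pos n with rfl | hn
  · exact (h.iter r).coefGauge_zero.le
  · have h1 := h.gaugeIter_le_succ r (n % p) (n / p) (Nat.mod_lt _ hp.pos)
    rw [mul_comm (n / p), Nat.mod_add_div] at h1
    exact h1.trans (ih _ (Nat.div_lt_self hn hp.one_lt) _)

theorem DworkData.gaugeIter_le_add (h : DworkData a b J) (r s u n : ℕ) (hu : u < p ^ s) :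
    gaugeIter a b J r (u + n * p ^ s) ≤ gaugeIter a b J (r + s) n := by
  have hp : p.Prime := Fact.out
  induction s generalizing r u with
  | zero =>
    obtain rfl : u = 0 := by simpa using hu
    simp
  | succ s ih =>
    have hu1 : u / p < p ^ s := Nat.div_lt_of_lt_mul (by rwa [pow_succ'] at hu)
    have e : u + n * p ^ (s + 1) = u % p + (u / p + n * p ^ s) * p := by
      conv_lhs => rw [← Nat.mod_add_div u p]
      ring
    rw [e]
    refine (h.gaugeIter_le_succ r _ _ (Nat.mod_lt _ hp.pos)).trans ((ih (r + 1) _ hu1).trans ?_)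
    rw [show r + 1 + s = r + (s + 1) by ring]

/-- Each successive digit of `u` that agrees with that of `b j` multiplies `‖b j + u‖` by `1/p`, and
the strict inequality of digit counts makes the gauge drop by at least as much. After the first
disagreement the norm is 1. This bound pays for the denominators `b' + u` in `ratioDiff`. -/
theorem DworkData.gaugeIter_le_mul_norm (h : DworkData a b J) {j : ι} (hj : j ∈ J)
    (r s u n : ℕ) (hu : u < p ^ s) :
    gaugeIter a b J r (u + n * p ^ s) ≤ gaugeIter a b J (r + s) n * ‖dworkIter r (b j) + u‖ := by
  have hp : p.Prime := Fact.out
  induction s generalizing r u with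
  | zero =>
    obtain rfl : u = 0 := by simpa using hu
    simp [h.norm_eq_one j hj r]
  | succ s ih =>
    have hu1 : u / p < p ^ s := Nat.div_lt_of_lt_mul (by rwa [pow_succ'] at hu)
    have hup : u % p < p := Nat.mod_lt _ hp.pos
    by_cases hd : lastDigit (dworkIter r (b j)) = u % p
    · have e : u + n * p ^ (s + 1) = u % p + (u / p + n * p ^ s) * p := by
        conv_lhs => rw [← Nat.mod_add_div u p]
        ring
      have h1 := (h.iter r).coefGauge_le_prime_mul hup (u / p + n * p ^ s) ⟨j, hj, hd.le⟩
      simp only [← dworkIter_succ] at h1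
      have h2 : ‖dworkIter r (b j) + u‖ = (p : ℝ)⁻¹ * ‖dworkIter (r + 1) (b j) + (u / p : ℕ)‖ := by
        have := norm_add_eq (α := dworkIter r (b j)) hup (u / p)
        rw [if_pos hd, mul_comm (u / p), Nat.mod_add_div, ← dworkIter_succ] at this
        exact this
      rw [e, h2]
      have h3 := ih (r + 1) (u / p) hu1
      rw [show r + 1 + s = r + (s + 1) by ring] at h3
      calc _ ≤ _ := h1
        _ ≤ gaugeIter a b J (r + (s + 1)) n * ‖dworkIter (r + 1) (b j) + (u / p : ℕ)‖ *
          (p : ℝ)⁻¹ := mul_le_mul_of_nonneg_right h3 inv_prime_pos.le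
        _ = _ := by ring
    · have h2 : ‖dworkIter r (b j) + u‖ = 1 := by
        have := norm_add_eq (α := dworkIter r (b j)) hup (u / p)
        rwa [if_neg hd, mul_comm (u / p), Nat.mod_add_div] at this
      rw [h2, mul_one]
      exact h.gaugeIter_le_add r (s + 1) u n hu

/-- At most `s` digits can agree, after which a unit `b_j^{(i)}` remains. -/
theorem DworkData.le_norm_add (h : DworkData a b J) {j : ι} (hj : j ∈ J)
    (r s u : ℕ) (hu : u < p ^ s) : (p : ℝ)⁻¹ ^ s ≤ ‖dworkIter r (b j) + u‖ := by
  have hp : p.Prime := Fact.out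
  induction s generalizing r u with
  | zero =>
    obtain rfl : u = 0 := by simpa using hu
    simp [h.norm_eq_one j hj r]
  | succ s ih =>
    have hu1 : u / p < p ^ s := Nat.div_lt_of_lt_mul (by rwa [pow_succ'] at hu)
    have hup : u % p < p := Nat.mod_lt _ hp.pos
    have := norm_add_eq (α := dworkIter r (b j)) hup (u / p)
    rw [mul_comm (u / p), Nat.mod_add_div] at this
    rw [this]
    split_ifs
    · rw [pow_succ', ← dworkIter_succ]
      exact mul_le_mul_of_nonneg_left (ih _ _ hu1) inv_prime_pos.le
    · exact pow_le_one₀ inv_prime_pos.le inv_prime_le_one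

/-- The extra factors run over intervals of length `n p^(s+1)`, and the product of units over such
an interval is independent of its start modulo `p^(s+1)`. Numerator and denominator have equally
many of them. -/
theorem norm_unitRatio_sub_le (a b : ι → ℤ_[p]) (l u s n : ℕ) :
    ‖unitRatio a b (l + (u + n * p ^ s) * p) - unitRatio a b (l + u * p)‖ ≤
      (p : ℝ)⁻¹ ^ (s + 1) := by
  have e : l + (u + n * p ^ s) * p = (l + u * p) + n * p ^ (s + 1) := by ring
  set M := l + u * p
  set V : ℤ_[p] → ℤ_[p] := fun α => unitProd (α + (M : ℤ_[p])) (n * p ^ (s + 1))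
  have hV : ∀ c : ι → ℤ_[p], ‖∏ i, (V (c i) : ℚ_[p])‖ = 1 := fun c => by
    rw [norm_prod]; exact Finset.prod_eq_one fun i _ => norm_unitProd _ _
  have hb0 : ∏ i, (V (b i) : ℚ_[p]) ≠ 0 := norm_pos_iff.1 (by rw [hV]; exact one_pos)
  have e1 : unitRatio a b (l + (u + n * p ^ s) * p) = unitRatio a b M *
      ((∏ i, (V (a i) : ℚ_[p])) / ∏ i, (V (b i) : ℚ_[p])) := by
    rw [e, unitRatio, unitRatio, div_mul_div_comm, ← Finset.prod_mul_distrib,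
      ← Finset.prod_mul_distrib]
    simp only [V, unitProd_add, PadicInt.coe_mul]
  have e2 : unitRatio a b M * ((∏ i, (V (a i) : ℚ_[p])) / ∏ i, (V (b i) : ℚ_[p])) -
      unitRatio a b M = unitRatio a b M *
        ((∏ i, (V (a i) : ℚ_[p]) - ∏ i, (V (b i) : ℚ_[p])) / ∏ i, (V (b i) : ℚ_[p])) := by
    field_simp
  rw [e1, e2, norm_mul, norm_unitRatio, one_mul, norm_div, hV, div_one]
  have hd : ((p : ℤ_[p]) ^ (s + 1)) ∣ ∏ i, V (a i) - ∏ i, V (b i) :=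
    dvd_prod_sub_prod _ _ _ _ fun i _ =>
      dvd_unitProd_sub (dvd_pow_self _ (Nat.succ_ne_zero s))
        (pow_ne_zero _ (by exact_mod_cast (Fact.out : p.Prime).ne_zero)) (by simp) _ _
  rw [← norm_le_inv_pow_iff, PadicInt.coe_sub, coe_prod, coe_prod] at hd
  exact hd

end Gauge

/-! ### Verification of the chain congruences for hypergeometric coefficients -/

section Chain

variable {p : ℕ} [Fact p.Prime] {ι : Type*} [Fintype ι] {a b : ι → ℤ_[p]} {J : Finset ι}

theorem DworkData.norm_add_le_norm_add (h : DworkData a b J) {j : ι} (hj : j ∈ J)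
    {s u : ℕ} (hu : u < p ^ s) (n : ℕ) :
    ‖dworkPrime (b j) + ((u + n * p ^ s : ℕ) : ℤ_[p])‖ ≤ ‖dworkPrime (b j) + (u : ℤ_[p])‖ := by
  have e : dworkPrime (b j) + ((u + n * p ^ s : ℕ) : ℤ_[p])
      = (dworkPrime (b j) + (u : ℤ_[p])) + n * p ^ s := by push_cast; ring
  rw [e]
  refine (PadicInt.nonarchimedean _ _).trans (max_le le_rfl ?_)
  refine le_trans ?_ (h.le_norm_add hj 1 s u hu)
  rw [norm_mul, norm_pow, PadicInt.norm_p]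
  exact mul_le_of_le_one_left (by positivity) (PadicInt.norm_le_one _)

/-- The numerator of the difference of the ratios `A (l + w p) / A' w` and `A (l + u p) / A' u`
for `w = u + n p^s`. -/
def ratioDiff (a b : ι → ℤ_[p]) (J : Finset ι) (l u w : ℕ) : ℚ_[p] :=
  unitRatio a b (l + w * p) *
      (∏ i with lastDigit (a i) < l, ((dworkPrime (a i) + w : ℤ_[p]) : ℚ_[p])) *
      (∏ j ∈ J with lastDigit (b j) < l, 1) -
    unitRatio a b (l + u * p) *
      (∏ i with lastDigit (a i) < l, ((dworkPrime (a i) + u : ℤ_[p]) : ℚ_[p])) *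
      ∏ j ∈ J with lastDigit (b j) < l,
        (((dworkPrime (b j) + w : ℤ_[p]) : ℚ_[p]) / ((dworkPrime (b j) + u : ℤ_[p]) : ℚ_[p]))

/-- This is one power of `p` short of the chain congruence; the missing one is recovered in
`DworkData.congr`. -/
theorem DworkData.gauge_mul_ratioDiff_le (h : DworkData a b J) (l s u n : ℕ)
    (hu : u < p ^ s) :
    gaugeIter a b J 1 (u + n * p ^ s) * ‖ratioDiff a b J l u (u + n * p ^ s)‖ ≤
      (p : ℝ)⁻¹ ^ s * gaugeIter a b J (s + 1) n := by
  set w := u + n * p ^ s with hw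
  have hG1 : gaugeIter a b J 1 w ≤ gaugeIter a b J (s + 1) n := by
    simpa [add_comm] using h.gaugeIter_le_add 1 s u n hu
  have hG0 := h.gaugeIter_nonneg 1 w
  have hΓ := h.gaugeIter_nonneg (s + 1) n
  have hε0 : 0 < (p : ℝ)⁻¹ := inv_prime_pos
  have hδ : 0 ≤ (p : ℝ)⁻¹ ^ s * gaugeIter a b J (s + 1) n := by positivity
  have hwu : ∀ α : ℤ_[p], ‖((α + w : ℤ_[p]) : ℚ_[p]) - ((α + u : ℤ_[p]) : ℚ_[p])‖ ≤
      (p : ℝ)⁻¹ ^ s := fun α => by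
    rw [← PadicInt.coe_sub, norm_le_inv_pow_iff, hw]
    push_cast
    exact ⟨n, by ring⟩
  have hle : ∀ x : ℤ_[p], ‖(x : ℚ_[p])‖ ≤ 1 := fun x => PadicInt.norm_le_one x
  have hJu : ∀ j, 0 < ‖((dworkPrime (b j) + u : ℤ_[p]) : ℚ_[p])‖ :=
    fun j => h.prime.norm_add_pos j u
  unfold ratioDiff
  -- Compare the three factors one at a time: unit ratios, numerators, denominators. The product of
  -- ones is the partner of the product of `(b' + w) / (b' + u)`.
  refine mul_norm_mul_sub_mul_le hG0 (mul_norm_mul_sub_mul_le hG0 ?_ ?_ ?_ ?_) ?_ ?_ ?_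
  · have h1 := norm_unitRatio_sub_le a b l u s n
    rw [← hw] at h1
    have h2 : (p : ℝ)⁻¹ ^ (s + 1) ≤ (p : ℝ)⁻¹ ^ s :=
      pow_le_pow_of_le_one hε0.le inv_prime_le_one (Nat.le_succ s)
    rw [mul_comm ((p : ℝ)⁻¹ ^ s)]
    exact mul_le_mul hG1 (h1.trans h2) (norm_nonneg _) hΓ
  · refine mul_norm_prod_sub_prod_le hG0 hδ _ _ _ (fun i _ => ?_) (fun i _ => hle _)
      (fun i _ => hle _)
    rw [mul_comm ((p : ℝ)⁻¹ ^ s)]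
    exact mul_le_mul hG1 (hwu _) (norm_nonneg _) hΓ
  · exact norm_prod_le_one _ _ fun i _ => hle _
  · exact (norm_unitRatio _ _ _).le
  · refine mul_norm_prod_sub_prod_le hG0 hδ _ _ _ (fun j hj => ?_) (fun i _ => by simp)
      (fun j hj => ?_)
    · have hj' := (Finset.mem_filter.1 hj).1
      -- The gauge absorbs the possibly large factor `1 / ‖b' + u‖`.
      have h1 := h.gaugeIter_le_mul_norm hj' 1 s u n hu
      rw [← hw, add_comm 1 s] at h1
      have h0 := hJu j
      have e : (1 : ℚ_[p]) - ((dworkPrime (b j) + w : ℤ_[p]) : ℚ_[p]) /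
          ((dworkPrime (b j) + u : ℤ_[p]) : ℚ_[p]) =
          -((((dworkPrime (b j) + w : ℤ_[p]) : ℚ_[p]) - ((dworkPrime (b j) + u : ℤ_[p]) : ℚ_[p])) /
          ((dworkPrime (b j) + u : ℤ_[p]) : ℚ_[p])) := by
        rw [sub_div, div_self (norm_pos_iff.1 h0)]; ring
      rw [e, norm_neg, norm_div, mul_div_assoc', div_le_iff₀ h0]
      calc _ ≤ gaugeIter a b J 1 w * (p : ℝ)⁻¹ ^ s := mul_le_mul_of_nonneg_left (hwu _) hG0
        _ ≤ gaugeIter a b J (s + 1) n * ‖dworkIter 1 (b j) + (u : ℤ_[p])‖ * (p : ℝ)⁻¹ ^ s :=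
          mul_le_mul_of_nonneg_right h1 (by positivity)
        _ = (p : ℝ)⁻¹ ^ s * gaugeIter a b J (s + 1) n * ‖dworkIter 1 (b j) + (u : ℤ_[p])‖ := by
          ring
    · have hj' := (Finset.mem_filter.1 hj).1
      rw [norm_div, div_le_one (hJu j)]
      exact h.norm_add_le_norm_add hj' hu n
  · simp
  · rw [norm_mul, norm_unitRatio, one_mul]
    exact norm_prod_le_one _ _ fun i _ => hle _

/-- By `coefRatio_step` the difference of ratios is `ratioDiff`, times a power of `p` given by the
digit counts, times `A' w / (Pb w · A (l + u p))`. The gauge at `l + u p` removes the norm of `A (l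
+ u p)`, at the price of the factors `‖b_j + l + u p‖`, which are nontrivial only for digits equal
to `l`; writing `‖A' w‖` through its gauge supplies what is needed to compensate them. -/
theorem DworkData.congr (h : DworkData a b J) {l s u : ℕ} (n : ℕ) (hl : l < p) (hu : u < p ^ s) :
    coefGauge a b J (l + u * p) *
      ‖coefRatio a b (l + u * p + n * p ^ (s + 1)) / coefRatio a b (l + u * p) -
        coefRatio (fun i => dworkPrime (a i)) (fun i => dworkPrime (b i)) (u + n * p ^ s) /
          coefRatio (fun i => dworkPrime (a i)) (fun i => dworkPrime (b i)) u‖ ≤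
      (p : ℝ)⁻¹ ^ (s + 1) * gaugeIter a b J (s + 1) n := by
  classical
  have hmain := h.gauge_mul_ratioDiff_le l s u n hu
  have hbw : ∀ j ∈ J, _ := fun j hj => h.norm_add_le_norm_add hj hu n
  have hQ := norm_unitRatio_sub_le a b l u s n
  have hG1 : gaugeIter a b J 1 (u + n * p ^ s) ≤ gaugeIter a b J (s + 1) n := by
    simpa [add_comm] using h.gaugeIter_le_add 1 s u n hu
  rw [show l + u * p + n * p ^ (s + 1) = l + (u + n * p ^ s) * p by ring]
  set w := u + n * p ^ s with hw
  set ε : ℝ := (p : ℝ)⁻¹ with hε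
  have hε0 : 0 < ε := inv_prime_pos
  have hG0 := h.gaugeIter_nonneg 1 w
  have hΓ := h.gaugeIter_nonneg (s + 1) n
  set kk := (Finset.univ.filter fun i => lastDigit (a i) < l).card with hkk
  set β := (J.filter fun j => lastDigit (b j) ≤ l).card with hβ
  set β₁ := (J.filter fun j => lastDigit (b j) < l).card with hβ₁
  set β₂ := (J.filter fun j => lastDigit (b j) = l).card with hβ₂
  have hββ : β₁ + β₂ = β := by
    rw [hβ, hβ₁, hβ₂, ← Finset.card_union_of_disjoint, ← Finset.filter_or]
    · simp only [le_iff_lt_or_eq]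
    · exact Finset.disjoint_filter.2 fun j _ h1 h2 => h1.ne h2
  set Pa : ℕ → ℚ_[p] := fun v =>
    ∏ i with lastDigit (a i) < l, ((dworkPrime (a i) + v : ℤ_[p]) : ℚ_[p]) with hPa
  set Pb : ℕ → ℚ_[p] := fun v =>
    ∏ j ∈ J with lastDigit (b j) < l, ((dworkPrime (b j) + v : ℤ_[p]) : ℚ_[p]) with hPb
  have hPb0 : ∀ v, Pb v ≠ 0 := fun v => Finset.prod_ne_zero_iff.2 fun j _ =>
    norm_pos_iff.1 (h.prime.norm_add_pos j v)
  set Q : ℕ → ℚ_[p] := fun v => unitRatio a b (l + v * p)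
  have hp0 : (p : ℚ_[p]) ≠ 0 := by exact_mod_cast (Fact.out : p.Prime).ne_zero
  set A' := coefRatio (fun i => dworkPrime (a i)) (fun i => dworkPrime (b i)) with hA'
  have hstep : ∀ v, coefRatio a b (l + v * p) =
      A' v * (((p : ℚ_[p]) ^ kk / (p : ℚ_[p]) ^ β₁) * (Q v * Pa v / Pb v)) := fun v => by
    rw [coefRatio_step a b hl.le, h.filter_eq hl, Finset.prod_mul_distrib,
      Finset.prod_mul_distrib, Finset.prod_const, Finset.prod_const]
    change A' v * (Q v * ((p : ℚ_[p]) ^ kk * Pa v) / ((p : ℚ_[p]) ^ β₁ * Pb v)) = _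
    have := hPb0 v
    field_simp
  have hA0 := coefRatio_ne_zero h (l + u * p)
  have hA'0 := coefRatio_ne_zero h.prime u
  set Z := ratioDiff a b J l u w with hZ
  have hZ' : Z = Q w * Pa w - Q u * Pa u * (Pb w / Pb u) := by
    rw [hZ, ratioDiff, Finset.prod_div_distrib, Finset.prod_const_one, mul_one]
  have hbr : coefRatio a b (l + w * p) / coefRatio a b (l + u * p) - A' w / A' u =
      A' w * (((p : ℚ_[p]) ^ kk / (p : ℚ_[p]) ^ β₁) * (Z / Pb w)) / coefRatio a b (l + u * p) := by
    have h1 : A' w / A' u = A' w * (((p : ℚ_[p]) ^ kk / (p : ℚ_[p]) ^ β₁) *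
        (Q u * Pa u / Pb u)) / coefRatio a b (l + u * p) := by
      rw [div_eq_div_iff hA'0 hA0, hstep u]; ring
    rw [h1, hstep w, ← sub_div, ← mul_sub, ← mul_sub, hZ']
    congr 3
    have := hPb0 w
    have := hPb0 u
    field_simp
  have hden : ∏ j ∈ J, ‖b j + ((l + u * p : ℕ) : ℤ_[p])‖ =
      ε ^ β₂ * ∏ j ∈ J with lastDigit (b j) = l, ‖dworkPrime (b j) + (u : ℤ_[p])‖ := by
    rw [← Finset.prod_const, ← Finset.prod_mul_distrib, Finset.prod_filter]
    exact Finset.prod_congr rfl fun j _ => norm_add_eq hl u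
  have hD0 : 0 < ∏ j ∈ J with lastDigit (b j) = l, ‖dworkPrime (b j) + (u : ℤ_[p])‖ :=
    h.prime.prod_norm_add_pos _ u
  have hnum : ‖A' w‖ ≤ gaugeIter a b J 1 w * (‖Pb w‖ *
      ∏ j ∈ J with lastDigit (b j) = l, ‖dworkPrime (b j) + (u : ℤ_[p])‖) := by
    rw [hA', ← h.prime.coefGauge_mul w]
    refine mul_le_mul_of_nonneg_left ?_ hG0
    rw [hPb, norm_prod, Finset.prod_filter, Finset.prod_filter, ← Finset.prod_mul_distrib]
    refine Finset.prod_le_prod (fun j _ => norm_nonneg _) fun j hj => ?_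
    rcases lt_trichotomy (lastDigit (b j)) l with h2 | h2 | h2
    · simp only [h2, h2.ne, if_true, if_false, mul_one]
      exact le_rfl
    · simpa [h2] using hbw j hj
    · have := PadicInt.norm_le_one (dworkPrime (b j) + (w : ℤ_[p]))
      simpa [h2.not_gt, h2.ne'] using this
  -- The strict inequality of digit counts yields the missing power of `p`. If it fails, no digit
  -- lies in the relevant range, only the difference of unit ratios remains, and that already has
  -- norm at most `ε ^ (s + 1)`.
  have hfin : gaugeIter a b J 1 w * ‖Z‖ * ε ^ kk ≤
      ε ^ (s + 1) * gaugeIter a b J (s + 1) n * ε ^ β := by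
    rcases h.card_cases l with h2 | ⟨h2, h3⟩
    · have h3 : ε ^ kk ≤ ε ^ (β + 1) := pow_le_pow_of_le_one hε0.le inv_prime_le_one h2
      calc _ ≤ (ε ^ s * gaugeIter a b J (s + 1) n) * ε ^ (β + 1) :=
            mul_le_mul hmain h3 (by positivity) (by positivity)
        _ = _ := by ring
    · have hβ0 : β = 0 := h2
      have hk0 : kk = 0 := h3
      have hβ10 : β₁ = 0 := by lia
      have hZ2 : Z = Q w - Q u := by
        have e1 : ∀ v, Pa v = 1 := fun v => by
          rw [hPa]; simp only [Finset.card_eq_zero.1 h3, Finset.prod_empty]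
        have e2 : ∀ v, Pb v = 1 := fun v => by
          rw [hPb]; simp only [Finset.card_eq_zero.1 hβ10, Finset.prod_empty]
        rw [hZ']; simp [e1, e2]
      rw [hβ0, hk0, pow_zero, mul_one, mul_one, hZ2, mul_comm (ε ^ (s + 1))]
      exact mul_le_mul hG1 hQ (norm_nonneg _) hΓ
  rw [hbr, norm_div, coefGauge, hden, norm_mul, norm_mul, norm_div, norm_div, norm_pow, norm_pow,
    Padic.norm_p, ← hε]
  have hAn : 0 < ‖coefRatio a b (l + u * p)‖ := norm_pos_iff.2 hA0
  have hPbn : 0 < ‖Pb w‖ := norm_pos_iff.2 (hPb0 w)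
  refine le_of_mul_le_mul_right (le_trans ?_ hfin) (pow_pos hε0 β)
  rw [← hββ, pow_add]
  set D := ∏ j ∈ J with lastDigit (b j) = l, ‖dworkPrime (b j) + (u : ℤ_[p])‖
  calc _ = ‖A' w‖ * (‖Z‖ * ε ^ kk / (‖Pb w‖ * D)) := by
        field_simp
    _ ≤ gaugeIter a b J 1 w * (‖Pb w‖ * D) * (‖Z‖ * ε ^ kk / (‖Pb w‖ * D)) :=
        mul_le_mul_of_nonneg_right hnum (by positivity)
    _ = _ := by field_simp

theorem dworkIter_dworkIter (r s : ℕ) (α : ℤ_[p]) :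
    dworkIter s (dworkIter r α) = dworkIter (r + s) α := by
  rw [dworkIter, dworkIter, dworkIter, add_comm r s, Function.iterate_add_apply]

theorem DworkData.dworkChain (h : DworkData a b J) :
    DworkChain p (p : ℝ)⁻¹ (coefIter a b) (gaugeIter a b J) where
  zero _ := coefRatio_zero _ _
  ne_zero r n := coefRatio_ne_zero (h.iter r) n
  norm_le r n := (h.iter r).norm_coefRatio_le n
  gauge_le r n := h.gaugeIter_le_one r n
  congr r s l u n hl hu := by
    have h1 := (h.iter r).congr n hl hu
    simp only [gaugeIter, dworkIter_dworkIter, ← dworkIter_succ] at h1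
    exact h1

/-- The coefficients `∏ (a_i)_n / ∏ (b_i)_n` as `p`-adic integers. -/
def DworkData.coef (h : DworkData a b J) (r n : ℕ) : ℤ_[p] :=
  ⟨coefIter a b r n, h.dworkChain.norm_le_one r n⟩

theorem DworkData.coef_zero (h : DworkData a b J) (r : ℕ) : h.coef r 0 = 1 :=
  Subtype.ext (h.dworkChain.zero r)

theorem DworkData.dvd_sum_range (h : DworkData a b J) {d l : ℕ} (hl : l < p ^ d) (s N : ℕ) :
    (p : ℤ_[p]) ^ (s + 1) ∣ ∑ j ∈ Finset.range (p ^ s) with j ≤ N,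
      (h.coef 0 (l + (N - j) * p ^ d) * h.coef d j -
        h.coef d (N - j) * h.coef 0 (l + j * p ^ d)) := by
  have hp : p.Prime := Fact.out
  have h1 := h.dworkChain.norm_blockSum_iterate_le hp.pos inv_prime_pos.le inv_prime_le_one
    h.gaugeIter_le_succ hl s (N : ℤ)
  rw [← norm_le_inv_pow_iff, PadicInt.coe_sum, Finset.sum_filter]
  refine (congrArg norm (Finset.sum_congr rfl fun j _ => ?_)).trans_le h1
  rw [zero_mul, add_zero]
  split_ifs with hj
  · rw [← Nat.cast_sub hj, zext_natCast, zext_natCast]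
    rfl
  · rw [zext_of_neg _ (by lia), zext_of_neg _ (by lia)]
    simp

end Chain

/-! ### From Dwork's congruences to congruences between truncated quotients -/

section Truncation

variable {R : Type*} [CommRing R]

theorem C_dvd_iff (q : R) (f : R⟦X⟧) : PowerSeries.C q ∣ f ↔ ∀ n, q ∣ PowerSeries.coeff n f := by
  constructor
  · rintro ⟨g, rfl⟩ n
    rw [PowerSeries.coeff_C_mul]
    exact dvd_mul_right _ _
  · intro h
    choose g hg using h
    refine ⟨PowerSeries.mk g, ?_⟩
    ext n
    rw [PowerSeries.coeff_C_mul, PowerSeries.coeff_mk, hg]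

/-- The truncation of a power series, as a power series. -/
def truncSeries (P : ℕ) (f : R⟦X⟧) : R⟦X⟧ := (PowerSeries.trunc P f : Polynomial R)

theorem coeff_truncSeries (P : ℕ) (f : R⟦X⟧) (n : ℕ) :
    PowerSeries.coeff n (truncSeries P f) = if n < P then PowerSeries.coeff n f else 0 := by
  rw [truncSeries, Polynomial.coeff_coe, PowerSeries.coeff_trunc]

theorem coeff_mul_trunc (f g : R⟦X⟧) (P N : ℕ) :
    PowerSeries.coeff N (f * truncSeries P g) =
      ∑ j ∈ Finset.range P with j ≤ N, PowerSeries.coeff (N - j) f * PowerSeries.coeff j g := by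
  rw [mul_comm, PowerSeries.coeff_mul,
    Finset.Nat.sum_antidiagonal_eq_sum_range_succ (fun i j =>
      PowerSeries.coeff i (truncSeries P g) * PowerSeries.coeff j f)]
  have e : ((Finset.range P).filter fun j => j ≤ N) =
      (Finset.range N.succ).filter fun j => j < P := by
    ext j; simp only [Finset.mem_filter, Finset.mem_range]; lia
  rw [e, Finset.sum_filter]
  refine Finset.sum_congr rfl fun j _ => ?_
  rw [coeff_truncSeries]
  split_ifs
  · rw [mul_comm]
  · rw [zero_mul]

theorem isUnit_of_coeff_zero {f : R⟦X⟧} (hf : PowerSeries.coeff 0 f = 1) : IsUnit f := by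
  rw [PowerSeries.isUnit_iff_constantCoeff]
  simp only [PowerSeries.coeff_zero_eq_constantCoeff] at hf
  rw [hf]
  exact isUnit_one

theorem coeff_zero_trunc {f : R⟦X⟧} {P : ℕ} (hP : 0 < P) :
    PowerSeries.coeff 0 (truncSeries P f) =
      PowerSeries.coeff 0 f := by
  rw [coeff_truncSeries, if_pos hP]

/-- The arithmetic progression `l, l + D, …` of coefficients of the sequence `A`. -/
def progSeries (A : ℕ → R) (D l : ℕ) : R⟦X⟧ := PowerSeries.mk fun j => A (l + j * D)

/-- Modulo `q`, each progression has the same quotient by its truncation as the series with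
coefficients `C`. Eliminating that series is legitimate because it and its truncation are units. -/
theorem C_dvd_progSeries_sub {A C : ℕ → R} {q : R} {P D : ℕ} (hP : 0 < P) (hC : C 0 = 1)
    (h : ∀ l < D, ∀ N, q ∣ ∑ j ∈ Finset.range P with j ≤ N,
      (A (l + (N - j) * D) * C j - C (N - j) * A (l + j * D)))
    {l l' : ℕ} (hl : l < D) (hl' : l' < D) :
    PowerSeries.C q ∣
      progSeries A D l * truncSeries P (progSeries A D l') -
        progSeries A D l' * truncSeries P (progSeries A D l) := by
  set Ψ : R⟦X⟧ := PowerSeries.mk C with hΨ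
  set Ψt : R⟦X⟧ := truncSeries P Ψ
  have key : ∀ l < D, PowerSeries.C q ∣ progSeries A D l * Ψt -
      Ψ * truncSeries P (progSeries A D l) := by
    intro l hl
    rw [C_dvd_iff]
    intro N
    rw [map_sub, coeff_mul_trunc, coeff_mul_trunc, ← Finset.sum_sub_distrib]
    simpa [hΨ, progSeries] using h l hl N
  have hΨ0 : PowerSeries.coeff 0 Ψ = 1 := by rw [hΨ, PowerSeries.coeff_mk, hC]
  have hu : IsUnit (Ψ * Ψt) := (isUnit_of_coeff_zero hΨ0).mul
    (isUnit_of_coeff_zero ((coeff_zero_trunc hP).trans hΨ0))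
  refine hu.dvd_mul_left.1 ?_
  obtain ⟨x, hx⟩ := key l hl
  obtain ⟨y, hy⟩ := key l' hl'
  refine ⟨x * Ψ * truncSeries P (progSeries A D l') -
    y * Ψ * truncSeries P (progSeries A D l), ?_⟩
  linear_combination Ψ * (truncSeries P (progSeries A D l')) * hx -
    Ψ * (truncSeries P (progSeries A D l)) * hy

theorem sum_filter_mod_eq (A : ℕ → R) {P D l l' : ℕ} (K : ℕ) (hl : l < D) (hl' : l' < D) :
    ∑ i ∈ (Finset.range (P * D)).filter (fun i => i ≤ l + l' + K * D) with i % D = l,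
        A i * A (l + l' + K * D - i) =
      PowerSeries.coeff K
        (progSeries A D l' * truncSeries P (progSeries A D l)) := by
  rw [coeff_mul_trunc]
  symm
  refine Finset.sum_bij' (fun j _ => l + j * D) (fun i _ => i / D) ?_ ?_ ?_ ?_ ?_
  · intro j hj
    simp only [Finset.mem_filter, Finset.mem_range] at hj ⊢
    have h1 : (j + 1) * D ≤ P * D := Nat.mul_le_mul_right _ hj.1
    have h2 : j * D ≤ K * D := Nat.mul_le_mul_right _ hj.2
    refine ⟨⟨by nlinarith, by lia⟩, ?_⟩
    rw [Nat.add_mul_mod_self_right, Nat.mod_eq_of_lt hl]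
  · intro i hi
    simp only [Finset.mem_filter, Finset.mem_range] at hi ⊢
    have hD : 0 < D := by lia
    refine ⟨Nat.div_lt_of_lt_mul (by rw [mul_comm]; exact hi.1.1), ?_⟩
    have h1 := Nat.div_add_mod i D
    rw [hi.2] at h1
    have h2 : D * (i / D) < D * (K + 1) := by rw [mul_add, mul_comm D K]; lia
    exact Nat.lt_succ_iff.1 (Nat.lt_of_mul_lt_mul_left h2)
  · intro j _
    have hD : 0 < D := by lia
    rw [Nat.add_mul_div_right _ _ hD, Nat.div_eq_of_lt hl, zero_add]
  · intro i hi
    simp only [Finset.mem_filter] at hi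
    have h1 := Nat.mod_add_div i D
    rw [hi.2, mul_comm] at h1
    exact h1
  · intro j hj
    simp only [Finset.mem_filter, Finset.mem_range] at hj
    have h2 : j * D ≤ K * D := Nat.mul_le_mul_right _ hj.2
    have e : l + l' + K * D - (l + j * D) = l' + (K - j) * D := by
      rw [Nat.sub_mul]; lia
    rw [e, progSeries, progSeries, PowerSeries.coeff_mk, PowerSeries.coeff_mk, mul_comm]

/-- Write `N = l + l' + K D`. For `i ≤ N`, the condition `N - i ≡ l` is `i ≡ l'`, so the two sums
are coefficients of the two cross products of progressions with truncations. If `N < l`, both sums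
are empty. -/
theorem dvd_sum_mod_sub_sum_mod {A C : ℕ → R} {q : R} {P D : ℕ} (hP : 0 < P) (hC : C 0 = 1)
    (h : ∀ l < D, ∀ N, q ∣ ∑ j ∈ Finset.range P with j ≤ N,
      (A (l + (N - j) * D) * C j - C (N - j) * A (l + j * D)))
    {l : ℕ} (hl : l < D) (N : ℕ) :
    q ∣ ∑ i ∈ (Finset.range (P * D)).filter (fun i => i ≤ N) with (N - i) % D = l,
        A i * A (N - i) -
      ∑ i ∈ (Finset.range (P * D)).filter (fun i => i ≤ N) with i % D = l, A i * A (N - i) := by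
  have hD : 0 < D := by lia
  rcases lt_or_ge N l with hN | hN
  · have e1 : ∀ i, i ≤ N → i % D ≠ l := fun i hi h0 => by
      have := Nat.mod_le i D
      lia
    have e2 : ∀ i, (N - i) % D ≠ l := fun i h0 => by
      have := Nat.mod_le (N - i) D
      lia
    rw [Finset.sum_eq_zero, Finset.sum_eq_zero]
    · simp
    · intro i hi
      simp only [Finset.mem_filter] at hi
      exact absurd hi.2 (e1 i hi.1.2)
    · intro i hi
      simp only [Finset.mem_filter] at hi
      exact absurd hi.2 (e2 i)
  · obtain ⟨l', K, hl', rfl⟩ : ∃ l' K, l' < D ∧ N = l + l' + K * D := by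
      refine ⟨(N - l) % D, (N - l) / D, Nat.mod_lt _ hD, ?_⟩
      have := Nat.mod_add_div (N - l) D
      rw [mul_comm] at this
      lia
    have e : ((Finset.range (P * D)).filter fun i => i ≤ l + l' + K * D).filter
        (fun i => (l + l' + K * D - i) % D = l) =
        ((Finset.range (P * D)).filter fun i => i ≤ l' + l + K * D).filter
        (fun i => i % D = l') := by
      rw [add_comm l l']
      refine Finset.filter_congr fun i hi => ?_
      have hi' := (Finset.mem_filter.1 hi).2
      have e1 : (l' + l + K * D) % D = (l' + l) % D := Nat.add_mul_mod_self_right _ _ _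
      constructor
      · intro h0
        have h1 : (l' + l) ≡ i + l [MOD D] := by
          have h2 : i + (l' + l + K * D - i) = l' + l + K * D := by lia
          have h3 : i + (l' + l + K * D - i) ≡ i + l [MOD D] :=
            Nat.ModEq.add_left _ (by rw [Nat.ModEq, h0, Nat.mod_eq_of_lt hl])
          rw [h2] at h3
          exact (show _ % _ = _ % _ from e1.symm).trans h3
        have h2 := Nat.ModEq.add_right_cancel' _ h1
        rw [Nat.ModEq, Nat.mod_eq_of_lt hl'] at h2
        exact h2.symm
      · intro h0
        have h1 : i + (l' + l + K * D - i) ≡ i + l [MOD D] := by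
          have h2 : i + (l' + l + K * D - i) = l' + l + K * D := by lia
          rw [h2]
          have h3 : l' + l ≡ i + l [MOD D] :=
            Nat.ModEq.add_right _ (by rw [Nat.ModEq, h0, Nat.mod_eq_of_lt hl'])
          exact (show _ % _ = _ % _ from e1).trans h3
        have h2 := Nat.ModEq.add_left_cancel' _ h1
        rwa [Nat.ModEq, Nat.mod_eq_of_lt hl] at h2
    rw [e, sum_filter_mod_eq A K hl hl', add_comm l l', sum_filter_mod_eq A K hl' hl, ← map_sub]
    exact (C_dvd_iff _ _).1 (C_dvd_progSeries_sub hP hC h hl hl') K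

theorem sum_mul_comp_eq {ι : Type*} (S : Finset ι) (f : ι → R) (g : ι → ℕ) (D : ℕ)
    (hg : ∀ i ∈ S, g i < D) (δ : ℕ → R) :
    ∑ i ∈ S, f i * δ (g i) = ∑ l ∈ Finset.range D, δ l * ∑ i ∈ S with g i = l, f i := by
  rw [← Finset.sum_fiberwise_of_maps_to (t := Finset.range D) (g := g)
    (fun i hi => Finset.mem_range.2 (hg i hi))]
  refine Finset.sum_congr rfl fun l _ => ?_
  rw [Finset.mul_sum]
  refine Finset.sum_congr rfl fun i hi => ?_
  rw [(Finset.mem_filter.1 hi).2, mul_comm]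

/-- If `A` satisfies Dwork's congruences and `α` is `p`-adically continuous on `ℕ` up to a factor
`2`, then the truncations of `∑ A_i t^i` and `∑ A_i α_i t^i` have congruent quotients. -/
theorem pow_dvd_two_mul_sum {p : ℕ} (hp : 0 < p) {A α : ℕ → R}
    (hα : ∀ k x y, x ≡ y [MOD p ^ k] → (p : R) ^ k ∣ 2 * (α x - α y)) (n N : ℕ)
    (hA : ∀ d ≤ n, ∀ l < p ^ d, (p : R) ^ (n - d + 1) ∣
      ∑ i ∈ (Finset.range (p ^ n)).filter (fun i => i ≤ N) with (N - i) % p ^ d = l,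
        A i * A (N - i) -
      ∑ i ∈ (Finset.range (p ^ n)).filter (fun i => i ≤ N) with i % p ^ d = l,
        A i * A (N - i)) :
    (p : R) ^ n ∣ 2 * ∑ i ∈ Finset.range (p ^ n) with i ≤ N,
      (A (N - i) * α (N - i) * A i - A (N - i) * (A i * α i)) := by
  set S := (Finset.range (p ^ n)).filter fun i => i ≤ N
  -- `E k` retains only the dependence of `α` on residues modulo `p ^ k`. It vanishes at `k = 0`,
  -- and at `k = n` it agrees with the wanted sum up to the allowed error.
  set E : ℕ → R := fun k => ∑ i ∈ S, A i * A (N - i) * (α ((N - i) % p ^ k) - α (i % p ^ k))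
    with hE
  have hstep : ∀ k < n, (p : R) ^ n ∣ 2 * (E (k + 1) - E k) := by
    intro k hk
    set δ : ℕ → R := fun l => α l - α (l % p ^ k) with hδ
    have hδ' : ∀ l, (p : R) ^ k ∣ 2 * δ l := fun l => hα k _ _ (Nat.mod_modEq l _).symm
    have hD : 0 < p ^ (k + 1) := pow_pos hp _
    have hmm : ∀ x, x % p ^ (k + 1) % p ^ k = x % p ^ k := fun x =>
      Nat.mod_mod_of_dvd _ (pow_dvd_pow p (Nat.le_succ k))
    have e : E (k + 1) - E k = ∑ l ∈ Finset.range (p ^ (k + 1)), δ l *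
        (∑ i ∈ S with (N - i) % p ^ (k + 1) = l, A i * A (N - i) -
          ∑ i ∈ S with i % p ^ (k + 1) = l, A i * A (N - i)) := by
      simp only [mul_sub, Finset.sum_sub_distrib]
      rw [← sum_mul_comp_eq S (fun i => A i * A (N - i)) (fun i => (N - i) % p ^ (k + 1)) _
        (fun i _ => Nat.mod_lt _ hD), ← sum_mul_comp_eq S (fun i => A i * A (N - i))
        (fun i => i % p ^ (k + 1)) _ (fun i _ => Nat.mod_lt _ hD)]
      simp only [hE, hδ, hmm, ← Finset.sum_sub_distrib]
      refine Finset.sum_congr rfl fun i _ => ?_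
      ring
    rw [e, Finset.mul_sum]
    refine Finset.dvd_sum fun l hl => ?_
    -- A factor `p ^ k` comes from `δ l` and a factor `p ^ (n - k)` from Dwork's congruence at level
    -- `k + 1`.
    have h1 := hA (k + 1) hk l (Finset.mem_range.1 hl)
    have h2 := mul_dvd_mul (hδ' l) h1
    rw [← pow_add, mul_assoc] at h2
    rwa [show k + (n - (k + 1) + 1) = n by lia] at h2
  have hE' : ∀ k ≤ n, (p : R) ^ n ∣ 2 * E k := by
    intro k
    induction k with
    | zero => simp [hE, Nat.mod_one]
    | succ k ih =>
      intro hk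
      have := dvd_add (hstep k hk) (ih (by lia))
      rwa [← mul_add, sub_add_cancel] at this
  have e : (2 * ∑ i ∈ S, (A (N - i) * α (N - i) * A i - A (N - i) * (A i * α i)) : R) =
      2 * E n + ∑ i ∈ S, A i * A (N - i) * (2 * (α (N - i) - α ((N - i) % p ^ n)) -
        2 * (α i - α (i % p ^ n))) := by
    rw [hE, Finset.mul_sum, Finset.mul_sum, ← Finset.sum_add_distrib]
    refine Finset.sum_congr rfl fun i _ => ?_
    ring
  rw [e]
  refine dvd_add (hE' n le_rfl) (Finset.dvd_sum fun i _ => Dvd.dvd.mul_left (dvd_sub ?_ ?_) _)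
  · exact hα n _ _ (Nat.mod_modEq _ _).symm
  · exact hα n _ _ (Nat.mod_modEq _ _).symm

/-- Congruence between the products `G [F]` and `F [G]` for `F = ∑ A_i t^i` and
`G = ∑ A_i α_i t^i`. -/
theorem C_pow_dvd_two_mul {p : ℕ} (hp : 0 < p) {A α : ℕ → R} {C : ℕ → ℕ → R}
    (hα : ∀ k x y, x ≡ y [MOD p ^ k] → (p : R) ^ k ∣ 2 * (α x - α y))
    (hC : ∀ d, C d 0 = 1)
    (h : ∀ d s, ∀ l < p ^ d, ∀ N, (p : R) ^ (s + 1) ∣ ∑ j ∈ Finset.range (p ^ s) with j ≤ N,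
      (A (l + (N - j) * p ^ d) * C d j - C d (N - j) * A (l + j * p ^ d)))
    (F G : R⟦X⟧) (hF : ∀ i, PowerSeries.coeff i F = A i)
    (hG : ∀ i, PowerSeries.coeff i G = A i * α i) (n : ℕ) :
    PowerSeries.C ((p : R) ^ n) ∣ 2 * (G * truncSeries (p ^ n) F -
      F * truncSeries (p ^ n) G) := by
  rw [C_dvd_iff]
  intro N
  have e : (2 : R⟦X⟧) = PowerSeries.C 2 := by rw [map_ofNat]
  rw [e, PowerSeries.coeff_C_mul, map_sub, coeff_mul_trunc, coeff_mul_trunc,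
    ← Finset.sum_sub_distrib]
  simp only [hF, hG]
  refine pow_dvd_two_mul_sum hp hα n N fun d hd l hl => ?_
  have h1 := dvd_sum_mod_sub_sum_mod (pow_pos hp (n - d)) (hC d) (h d (n - d)) hl N
  rwa [← pow_add, Nat.sub_add_cancel hd] at h1

end Truncation

/-! ### The `p`-adic digamma function -/

section Digamma

variable {p : ℕ} [Fact p.Prime]

theorem prime_cast_ne_zero : (p : ℤ_[p]) ≠ 0 := by exact_mod_cast (Fact.out : p.Prime).ne_zero

theorem natCast_dvd_natCast_iff (n : ℕ) : (p : ℤ_[p]) ∣ n ↔ p ∣ n := by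
  rw [← PadicInt.norm_lt_one_iff_dvd, PadicInt.norm_natCast_lt_one_iff]

theorem coe_unitInv_natCast (n : ℕ) :
    (unitInv (n : ℤ_[p]) : ℚ_[p]) = if p ∣ n then 0 else 1 / (n : ℚ_[p]) := by
  split_ifs with h
  · rw [unitInv, if_pos ((natCast_dvd_natCast_iff n).2 h)]; rfl
  · have h1 := mul_unitInv (x := (n : ℤ_[p])) (fun h' => h ((natCast_dvd_natCast_iff n).1 h'))
    have h2 : (n : ℚ_[p]) * (unitInv (n : ℤ_[p]) : ℚ_[p]) = 1 := by
      have h3 := congrArg (fun x : ℤ_[p] => (x : ℚ_[p])) h1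
      simpa using h3
    rw [eq_div_iff (left_ne_zero_of_mul_eq_one h2), mul_comm, h2]

theorem sum_inv_eq_unitHarm (n : ℕ) :
    ∑ k ∈ (Finset.Ico 1 n).filter (fun k => ¬ p ∣ k), (1 / (k : ℚ_[p])) =
      (unitHarm (1 : ℤ_[p]) (n - 1) : ℚ_[p]) := by
  rw [Finset.sum_filter, Finset.sum_Ico_eq_sum_range, unitHarm, PadicInt.coe_sum]
  refine Finset.sum_congr rfl fun i _ => ?_
  have := coe_unitInv_natCast (p := p) (1 + i)
  push_cast at this
  rw [this]
  by_cases h : p ∣ 1 + i <;> simp [h]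

theorem pow_dvd_two_mul_unitHarm_sub {w : ℕ} (hw : w ≠ 0) {m n : ℕ}
    (h : (p : ℤ_[p]) ^ w ∣ (m : ℤ_[p]) - n) :
    (p : ℤ_[p]) ^ w ∣ 2 * (unitHarm (1 : ℤ_[p]) m - unitHarm 1 n) := by
  wlog hmn : n ≤ m generalizing m n
  · have := this (m := n) (n := m) (by rw [← dvd_neg, neg_sub]; exact h) (by lia)
    rw [← dvd_neg, ← mul_neg, neg_sub] at this
    exact this
  obtain ⟨d, rfl⟩ := Nat.exists_eq_add_of_le hmn
  rw [unitHarm_add, add_sub_cancel_left]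
  refine dvd_two_mul_unitHarm (dvd_pow_self _ hw) (pow_ne_zero _ prime_cast_ne_zero) ?_ _
  simpa using h

theorem neBot_comap_natCast (z : ℤ_[p]) :
    (comap (fun n : ℕ => (n : ℤ_[p])) (𝓝 z) ⊓ 𝓟 {n | 0 < n}).NeBot := by
  rw [inf_principal_neBot_iff]
  rintro U ⟨t, ht, hU⟩
  obtain ⟨ε, hε, hball⟩ := Metric.mem_nhds_iff.1 ht
  obtain ⟨w, hw⟩ := PadicInt.exists_pow_neg_lt p hε
  obtain ⟨n, hn⟩ := exists_nat_dvd_sub (pow_ne_zero w (prime_cast_ne_zero (p := p))) z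
  have hp : 0 < p := (Fact.out : p.Prime).pos
  refine ⟨n + p ^ w, hU (hball ?_), Nat.add_pos_right _ (pow_pos hp w)⟩
  rw [Metric.mem_ball, dist_comm, dist_eq_norm]
  refine lt_of_le_of_lt ?_ hw
  rw [PadicInt.norm_le_pow_iff_mem_span_pow, Ideal.mem_span_singleton]
  have : z - ((n + p ^ w : ℕ) : ℤ_[p]) = (z - n) - p ^ w := by push_cast; ring
  rw [this]
  exact dvd_sub hn dvd_rfl

theorem eventually_pow_dvd_sub (z : ℤ_[p]) (w : ℕ) :
    ∀ᶠ n : ℕ in comap (fun n : ℕ => (n : ℤ_[p])) (𝓝 z) ⊓ 𝓟 {n | 0 < n},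
      0 < n ∧ (p : ℤ_[p]) ^ w ∣ z - n := by
  have h1 : {x : ℤ_[p] | (p : ℤ_[p]) ^ w ∣ z - x} ∈ 𝓝 z := by
    have hp : (0 : ℝ) < (p : ℝ) ^ (-(w : ℤ)) :=
      zpow_pos (by exact_mod_cast (Fact.out : p.Prime).pos) _
    refine mem_of_superset (Metric.ball_mem_nhds z hp) fun x hx => ?_
    rw [Metric.mem_ball, dist_comm, dist_eq_norm] at hx
    exact Ideal.mem_span_singleton.1 ((PadicInt.norm_le_pow_iff_mem_span_pow _ w).1 hx.le)
  have h2 := (mem_inf_of_right (f := comap (fun n : ℕ => (n : ℤ_[p])) (𝓝 z))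
    (mem_principal_self {n : ℕ | 0 < n}))
  filter_upwards [h2, mem_inf_of_left (preimage_mem_comap h1)] with n hn hn'
  exact ⟨hn, hn'⟩

/-- Harmonic sums with congruent endpoints agree up to a factor 2, so they are Cauchy along the
filter; the loss is compensated by `‖2‖` in the choice of `w`. -/
theorem exists_tendsto_unitHarm (z : ℤ_[p]) :
    ∃ x : ℚ_[p], Tendsto (fun n : ℕ => (unitHarm (1 : ℤ_[p]) (n - 1) : ℚ_[p]))
      (comap (fun n : ℕ => (n : ℤ_[p])) (𝓝 z) ⊓ 𝓟 {n | 0 < n}) (𝓝 x) := by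
  have := neBot_comap_natCast z
  rw [← cauchy_map_iff_exists_tendsto, Metric.cauchy_iff]
  refine ⟨inferInstance, fun ε hε => ?_⟩
  have h2 : 0 < ‖(2 : ℚ_[p])‖ := norm_pos_iff.2 two_ne_zero
  obtain ⟨w, hw⟩ := PadicInt.exists_pow_neg_lt p (mul_pos h2 hε)
  refine ⟨_, image_mem_map (eventually_pow_dvd_sub z (w + 1)), ?_⟩
  rintro _ ⟨m, ⟨hm, hm'⟩, rfl⟩ _ ⟨n, ⟨hn, hn'⟩, rfl⟩
  have h3 : (p : ℤ_[p]) ^ (w + 1) ∣ ((m - 1 : ℕ) : ℤ_[p]) - ((n - 1 : ℕ) : ℤ_[p]) := by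
    rw [Nat.cast_sub hm, Nat.cast_sub hn]
    have := dvd_sub hn' hm'
    ring_nf at this ⊢
    exact this
  have h4 := pow_dvd_two_mul_unitHarm_sub (Nat.succ_ne_zero w) h3
  rw [← norm_le_inv_pow_iff] at h4
  push_cast at h4
  rw [norm_mul] at h4
  rw [dist_eq_norm]
  refine lt_of_mul_lt_mul_left (lt_of_le_of_lt h4 (lt_of_le_of_lt ?_ hw)) h2.le
  rw [zpow_neg, zpow_natCast, ← inv_pow]
  exact pow_le_pow_of_le_one inv_prime_pos.le inv_prime_le_one (Nat.le_succ w)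

theorem psiTilde_spec (z : ℤ_[p]) : ∃ x : ℤ_[p], psiTilde z = x ∧
    ∀ w : ℕ, ∃ n : ℕ, (p : ℤ_[p]) ^ w ∣ z - (1 + n) ∧ (p : ℤ_[p]) ^ w ∣ x - unitHarm 1 n := by
  have hne := neBot_comap_natCast z
  obtain ⟨x, hx⟩ := exists_tendsto_unitHarm z
  have hx1 : ‖x‖ ≤ 1 := by
    have := (Metric.isClosed_closedBall (x := (0 : ℚ_[p])) (ε := 1)).mem_of_tendsto hx
      (Eventually.of_forall fun n => by
        rw [mem_closedBall_zero_iff]; exact PadicInt.norm_le_one _)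
    simpa using this
  refine ⟨⟨x, hx1⟩, ?_, fun w => ?_⟩
  · simp only [psiTilde, sum_inv_eq_unitHarm]
    exact hx.limUnder_eq
  · have hpos : 0 < (p : ℝ)⁻¹ ^ w := pow_pos inv_prime_pos w
    have h1 := hx (Metric.ball_mem_nhds x hpos)
    obtain ⟨n, ⟨hn, hn'⟩, hn2⟩ := ((eventually_pow_dvd_sub z w).and h1).exists
    refine ⟨n - 1, ?_, ?_⟩
    · rw [Nat.cast_sub hn]; simpa using hn'
    · rw [← norm_le_inv_pow_iff]
      simp only [Metric.mem_ball, dist_comm _ x, dist_eq_norm] at hn2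
      exact hn2.le

/-- `psiTilde` as a `p`-adic integer. -/
def psiInt (z : ℤ_[p]) : ℤ_[p] := (psiTilde_spec z).choose

theorem coe_psiInt (z : ℤ_[p]) : (psiInt z : ℚ_[p]) = psiTilde z :=
  (psiTilde_spec z).choose_spec.1.symm

theorem exists_pow_dvd {d : ℤ_[p]} (hd : d ≠ 0) : ∃ w : ℕ, w ≠ 0 ∧ d ∣ (p : ℤ_[p]) ^ w := by
  refine ⟨d.valuation + 1, Nat.succ_ne_zero _, ?_⟩
  conv_lhs => rw [PadicInt.unitCoeff_spec hd]
  exact Units.mul_left_dvd.2 (pow_dvd_pow _ (Nat.le_succ _))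

/-- This is where digamma values enter: `ψ̃_p` is the logarithmic derivative of the unit product.
Approximate `z` by `1 + n` so closely that neither the product nor `ψ̃_p(z)` changes modulo `M^2`,
and use the harmonic sum up to `n`. -/
theorem sq_dvd_unitProd_sub {M : ℕ} (hM : p ∣ M) (z : ℤ_[p]) :
    (M : ℤ_[p]) ^ 2 ∣ unitProd z M - unitProd 1 M * (1 + (M : ℤ_[p]) * psiInt z) := by
  rcases eq_or_ne M 0 with rfl | hM0
  · simp [unitProd]
  have hM' : (M : ℤ_[p]) ^ 2 ≠ 0 := pow_ne_zero _ (by exact_mod_cast hM0)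
  obtain ⟨w, hw, hd⟩ := exists_pow_dvd hM'
  obtain ⟨n, h1, h2⟩ := (psiTilde_spec z).choose_spec.2 w
  have h3 := unitProd_congr_left (dvd_pow_self _ hw) h1 M
  have h4 := sq_dvd_unitProd_one_add hM n
  have e : unitProd z M - unitProd 1 M * (1 + (M : ℤ_[p]) * psiInt z) =
      (unitProd z M - unitProd (1 + (n : ℤ_[p])) M) +
      (unitProd (1 + (n : ℤ_[p])) M - unitProd 1 M * (1 + (M : ℤ_[p]) * unitHarm 1 n)) -
      unitProd 1 M * (M : ℤ_[p]) * (psiInt z - unitHarm 1 n) := by ring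
  rw [e]
  exact dvd_sub (dvd_add (hd.trans h3) h4) (Dvd.dvd.mul_left (hd.trans h2) _)

end Digamma

/-! ### The inverse ratios of unit parts -/

section InvRatio

variable {p : ℕ} [Fact p.Prime] {ι : Type*} [Fintype ι]

theorem dvd_mul_prod_sub_prod {R ι : Type*} [CommRing R] (c d : R) (s : Finset ι) (f g : ι → R)
    (h : ∀ i ∈ s, d ∣ c * (f i - g i)) : d ∣ c * (∏ i ∈ s, f i - ∏ i ∈ s, g i) := by
  classical
  induction s using Finset.induction_on with
  | empty => simp
  | insert a s ha ih =>
    simp only [Finset.mem_insert, forall_eq_or_imp] at h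
    rw [Finset.prod_insert ha, Finset.prod_insert ha,
      show c * (f a * ∏ i ∈ s, f i - g a * ∏ i ∈ s, g i) =
        c * (f a - g a) * ∏ i ∈ s, f i + g a * (c * (∏ i ∈ s, f i - ∏ i ∈ s, g i)) by ring]
    exact dvd_add (Dvd.dvd.mul_right h.1 _) (Dvd.dvd.mul_left (ih h.2) _)

/-- The product of the units `unitProd (a i) M`. -/
def unitProds (a : ι → ℤ_[p]) (M : ℕ) : ℤ_[p] := ∏ i, unitProd (a i) M

theorem isUnit_unitProds (a : ι → ℤ_[p]) (M : ℕ) : IsUnit (unitProds a M) :=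
  IsUnit.prod_iff.2 fun i _ => isUnit_unitProd (a i) M

/-- The inverse of `unitRatio`, as a `p`-adic integer. -/
def invRatio (a b : ι → ℤ_[p]) (M : ℕ) : ℤ_[p] := unitProds b M * (unitProds a M).inv

theorem mul_invRatio (a b : ι → ℤ_[p]) (M : ℕ) :
    unitProds a M * invRatio a b M = unitProds b M := by
  have h := PadicInt.mul_inv (PadicInt.isUnit_iff.1 (isUnit_unitProds a M))
  rw [invRatio]
  linear_combination unitProds b M * h

theorem unitRatio_mul_invRatio (a b : ι → ℤ_[p]) (M : ℕ) :
    unitRatio a b M * (invRatio a b M : ℚ_[p]) = 1 := by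
  have h := congrArg (fun x : ℤ_[p] => (x : ℚ_[p])) (mul_invRatio a b M)
  simp only [PadicInt.coe_mul, unitProds, coe_prod] at h
  have hb : ∏ i, (unitProd (b i) M : ℚ_[p]) ≠ 0 := by
    rw [← coe_prod]
    exact PadicInt.coe_ne_zero.2 (isUnit_unitProds b M).ne_zero
  rw [unitRatio, div_mul_eq_mul_div, h, div_self hb]

theorem dvd_invRatio_sub_one (a b : ι → ℤ_[p]) {M : ℕ} (hM : p ∣ M) :
    (M : ℤ_[p]) ∣ invRatio a b M - 1 := by
  rcases eq_or_ne M 0 with rfl | hM0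
  · have h := mul_invRatio a b 0
    simp only [unitProds, unitProd, Finset.range_zero, Finset.prod_empty, Finset.prod_const_one,
      one_mul] at h
    simp [h]
  have hM' : (M : ℤ_[p]) ≠ 0 := by exact_mod_cast hM0
  refine (isUnit_unitProds a M).dvd_mul_left.1 ?_
  rw [mul_sub, mul_invRatio, mul_one]
  exact dvd_prod_sub_prod _ _ _ _ fun i _ =>
    dvd_unitProd_sub ((natCast_dvd_natCast_iff M).2 hM) hM' dvd_rfl _ _

theorem sq_dvd_unitProds_sub (a : ι → ℤ_[p]) {M : ℕ} (hM : p ∣ M) :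
    (M : ℤ_[p]) ^ 2 ∣ unitProds a M -
      unitProd 1 M ^ Fintype.card ι * (1 + (M : ℤ_[p]) * ∑ i, psiInt (a i)) := by
  have h1 : (M : ℤ_[p]) ^ 2 ∣ unitProds a M -
      ∏ i, (unitProd 1 M * (1 + (M : ℤ_[p]) * psiInt (a i))) :=
    dvd_prod_sub_prod _ _ _ _ fun i _ => sq_dvd_unitProd_sub hM (a i)
  have h2 := sq_dvd_prod_one_add_sub (M : ℤ_[p]) Finset.univ fun i => psiInt (a i)
  rw [Finset.prod_mul_distrib, Finset.prod_const, Finset.card_univ] at h1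
  have h3 := dvd_add h1 (Dvd.dvd.mul_left h2 (unitProd 1 M ^ Fintype.card ι))
  rwa [mul_sub, sub_add_sub_cancel] at h3

/-- The common power of `unitProd 1 M` cancels, leaving the first-order term of the quotient. -/
theorem sq_dvd_invRatio_sub (a b : ι → ℤ_[p]) {M : ℕ} (hM : p ∣ M) :
    (M : ℤ_[p]) ^ 2 ∣ invRatio a b M -
      (1 - (M : ℤ_[p]) * (∑ i, psiInt (a i) - ∑ i, psiInt (b i))) := by
  refine (isUnit_unitProds a M).dvd_mul_left.1 ?_
  obtain ⟨x, hx⟩ := sq_dvd_unitProds_sub a hM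
  obtain ⟨y, hy⟩ := sq_dvd_unitProds_sub b hM
  have h := mul_invRatio a b M
  set u := unitProd (1 : ℤ_[p]) M ^ Fintype.card ι
  set s := ∑ i, psiInt (a i)
  set t := ∑ i, psiInt (b i)
  refine ⟨y - x * (1 - M * (s - t)) + u * s * (s - t), ?_⟩
  linear_combination h + hy - (1 - (M : ℤ_[p]) * (s - t)) * hx

theorem mul_dvd_invRatio_add (a b : ι → ℤ_[p]) {M N : ℕ} (hM : p ∣ M) (hN : p ∣ N) :
    (M * N : ℤ_[p]) ∣ 2 * (invRatio a b (M + N) - invRatio a b M * invRatio a b N) := by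
  have key : ∀ c : ι → ℤ_[p], (M * N : ℤ_[p]) ∣
      2 * (unitProds c (M + N) - unitProds c M * unitProds c N) := fun c => by
    rw [unitProds, unitProds, unitProds, ← Finset.prod_mul_distrib]
    exact dvd_mul_prod_sub_prod _ _ _ _ _ fun i _ => mul_dvd_unitProd_add hM hN (c i)
  refine (isUnit_unitProds a (M + N)).dvd_mul_left.1 ?_
  obtain ⟨x, hx⟩ := key a
  obtain ⟨y, hy⟩ := key b
  have h1 := mul_invRatio a b M
  have h2 := mul_invRatio a b N
  have h3 := mul_invRatio a b (M + N)
  refine ⟨y - x * (invRatio a b M * invRatio a b N), ?_⟩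
  linear_combination 2 * h3 + hy - (invRatio a b M * invRatio a b N) * hx -
    2 * unitProds a N * invRatio a b N * h1 - 2 * unitProds b M * h2

end InvRatio

/-! ### The logarithm on `1 + pW` -/

section PadicEstimates

variable {p : ℕ} [Fact p.Prime]

theorem natCast_eq_pow_mul_unit {n : ℕ} (hn : n ≠ 0) :
    ∃ u : ℤ_[p], IsUnit u ∧ (n : ℤ_[p]) = p ^ padicValNat p n * u := by
  obtain ⟨m, hm⟩ : p ^ padicValNat p n ∣ n := pow_padicValNat_dvd
  refine ⟨m, isUnit_of_not_dvd fun h => ?_, by exact_mod_cast congrArg (Nat.cast (R := ℤ_[p])) hm⟩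
  obtain ⟨d, rfl⟩ := (natCast_dvd_natCast_iff m).1 h
  refine pow_succ_padicValNat_not_dvd (p := p) hn ⟨d, ?_⟩
  rw [pow_succ, mul_assoc]
  exact hm

theorem two_mul_padicValNat_le {n : ℕ} (hn : n ≠ 0) : 2 * padicValNat p n ≤ n := by
  have hp : p.Prime := Fact.out
  have h1 : p ^ padicValNat p n ≤ n := Nat.le_of_dvd (Nat.pos_of_ne_zero hn) pow_padicValNat_dvd
  have h2 : 2 ^ padicValNat p n ≤ p ^ padicValNat p n := Nat.pow_le_pow_left hp.two_le _
  have h3 : ∀ v : ℕ, 2 * v ≤ 2 ^ v := fun v => by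
    induction v with
    | zero => simp
    | succ v ih =>
      have : 1 ≤ 2 ^ v := Nat.one_le_two_pow
      rw [pow_succ]
      lia
  exact (h3 _).trans (h2.trans h1)

/-- The `p`-adic integer `p^k / (k + 1)`. -/
theorem exists_pow_div_succ (k : ℕ) : ∃ q : ℤ_[p], ((k + 1 : ℕ) : ℤ_[p]) * q = p ^ k ∧
    ∀ B, 2 * B + 1 ≤ k → (p : ℤ_[p]) ^ B ∣ q := by
  obtain ⟨u, hu, hk⟩ := natCast_eq_pow_mul_unit (p := p) (Nat.succ_ne_zero k)
  obtain ⟨u, rfl⟩ := hu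
  have hv := two_mul_padicValNat_le (p := p) (Nat.succ_ne_zero k)
  set v := padicValNat p (k + 1)
  refine ⟨p ^ (k - v) * (u⁻¹ : ℤ_[p]ˣ), ?_, fun B hB => Dvd.dvd.mul_right (pow_dvd_pow _ (by lia)) _⟩
  rw [hk, mul_mul_mul_comm, Units.mul_inv, mul_one, ← pow_add]
  congr 1
  lia

/-- Legendre's formula gives `(p - 1) v(k!) ≤ k - 1`. For odd `p` this suffices without the factor
2; for `p = 2` that factor supplies the last power. -/
theorem factorial_mul_sq_dvd {k : ℕ} (hk : 2 ≤ k) :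
    ((k.factorial : ℕ) : ℤ_[p]) * p ^ 2 ∣ 2 * p ^ k := by
  have hp : p.Prime := Fact.out
  obtain ⟨u, hu, h1⟩ := natCast_eq_pow_mul_unit (p := p) (Nat.factorial_ne_zero k)
  have h2 := sub_one_mul_padicValNat_factorial (p := p) k
  have h3 : 1 ≤ (p.digits k).sum := by
    by_contra h0
    have h4 : (p.digits k).sum = 0 := by lia
    rw [List.sum_eq_zero_iff] at h4
    have h6 : p.digits k ≠ [] := Nat.digits_ne_nil_iff_ne_zero.2 (by lia)
    exact Nat.getLast_digit_ne_zero p (by lia : k ≠ 0) (h4 _ (List.getLast_mem h6))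
  set v := padicValNat p k.factorial
  rw [h1, mul_right_comm, ← pow_add]
  rw [hu.mul_right_dvd]
  rcases hp.eq_two_or_odd' with rfl | hodd
  · have : v + 2 ≤ k + 1 := by lia
    have h4 := pow_dvd_pow ((2 : ℕ) : ℤ_[2]) this
    rw [pow_succ' _ k] at h4
    exact_mod_cast h4
  · have hp3 : 3 ≤ p := by
      have := hp.two_le
      rcases hodd with ⟨t, ht⟩
      lia
    have h5 : 2 * v ≤ (p - 1) * v := Nat.mul_le_mul_right _ (by lia)
    exact Dvd.dvd.mul_left (pow_dvd_pow _ (by lia)) _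

/-- The difference between the `k`-th term of `(1 + pw)^m - 1` and that of `m log(1 + pw)` is
divisible by `(pm)^2`, up to a factor `2`. -/
theorem sq_dvd_two_mul_choose_sub (m k : ℕ) {q : ℤ_[p]}
    (hq : ((k + 1 : ℕ) : ℤ_[p]) * q = p ^ k) :
    ((p * m : ℕ) : ℤ_[p]) ^ 2 ∣
      2 * (p ^ (k + 1) * (m.choose (k + 1) : ℕ) - (p * m : ℕ) * ((-1) ^ k * q)) := by
  rcases Nat.eq_zero_or_pos k with rfl | hk
  · have : q = 1 := by simpa using hq
    simp [this]
  have hf0 : (((k + 1).factorial : ℕ) : ℤ_[p]) ≠ 0 := by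
    exact_mod_cast Nat.factorial_ne_zero (k + 1)
  -- Multiplication by `(k + 1)!` turns the two terms into `p^(k+1) m` times `∏ (m - i)` and `∏
  -- (-i)`, `1 ≤ i ≤ k`, which agree modulo `m`.
  have h1 : (((k + 1).factorial : ℕ) : ℤ_[p]) * (m.choose (k + 1) : ℕ) =
      m * ∏ i ∈ Finset.range k, ((m : ℤ_[p]) - (i + 1 : ℕ)) := by
    rw [← Nat.cast_mul, ← Nat.descFactorial_eq_factorial_mul_choose,
      ← descPochhammer_eval_eq_descFactorial, descPochhammer_eval_eq_prod_range,
      Finset.prod_range_succ']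
    simp [mul_comm]
  have h2 : (((k + 1).factorial : ℕ) : ℤ_[p]) * ((-1) ^ k * q) =
      p ^ k * ∏ i ∈ Finset.range k, (-((i + 1 : ℕ) : ℤ_[p])) := by
    rw [Finset.prod_neg, Finset.card_range, ← Nat.cast_prod, Finset.prod_range_add_one_eq_factorial,
      Nat.factorial_succ, ← hq]
    push_cast
    ring
  obtain ⟨z, hz⟩ : (m : ℤ_[p]) ∣ ∏ i ∈ Finset.range k, ((m : ℤ_[p]) - (i + 1 : ℕ)) -
      ∏ i ∈ Finset.range k, (-((i + 1 : ℕ) : ℤ_[p])) :=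
    dvd_prod_sub_prod _ _ _ _ fun i _ => ⟨1, by ring⟩
  obtain ⟨y, hy⟩ := factorial_mul_sq_dvd (p := p) (k := k + 1) (by lia)
  refine ⟨y * z, mul_left_cancel₀ hf0 ?_⟩
  push_cast at h1 h2 hz hy ⊢
  linear_combination 2 * (p : ℤ_[p]) ^ (k + 1) * h1 - 2 * p * m * h2 +
    2 * (p : ℤ_[p]) ^ (k + 1) * m * hz + (m : ℤ_[p]) ^ 2 * z * hy

/-- Use `(k + 1) C(m, k + 1) = m C(m - 1, k)` and the integrality of `p^k / (k + 1)`. -/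
theorem dvd_pow_mul_choose (m k : ℕ) : ((p * m : ℕ) : ℤ_[p]) ∣ p ^ (k + 1) * (m.choose (k + 1) : ℕ) := by
  obtain ⟨q, hq, -⟩ := exists_pow_div_succ (p := p) k
  rcases m with _ | m
  · simp
  have h := congrArg (Nat.cast (R := ℤ_[p])) (Nat.add_one_mul_choose_eq m k)
  refine ⟨q * (m.choose k : ℕ), ?_⟩
  push_cast at h hq ⊢
  linear_combination (-(p : ℤ_[p]) * q) * h - p * ((m + 1).choose (k + 1) : ℤ_[p]) * hq

end PadicEstimates

/-! ### Limits in `W` and the second-order expansion of `(1 + pw)^m` -/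

section Log

variable {p : ℕ} [Fact p.Prime]

theorem qpToK_coe (x : ℤ_[p]) : qpToK p (x : ℚ_[p]) = algebraMap (W p) (K p) (zpToW p x) := by
  have := IsFractionRing.lift_algebraMap (A := ℤ_[p]) (K := ℚ_[p])
    (g := (algebraMap (W p) (K p)).comp (zpToW p))
    ((IsFractionRing.injective (W p) (K p)).comp (zpToW_injective p)) x
  exact this

instance charZero_K : CharZero (K p) := charZero_of_injective_ringHom (qpToK p).injective

instance charZero_W : CharZero (W p) := charZero_of_injective_ringHom (zpToW_injective p)

theorem eq_zero_of_forall_pow_dvd {w : W p} (h : ∀ N : ℕ, (p : W p) ^ N ∣ w) : w = 0 := by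
  refine IsHausdorff.haus (I := Ideal.span {(p : W p)}) inferInstance w fun N => ?_
  rw [SModEq.zero, smul_eq_mul, Ideal.mul_top, Ideal.span_singleton_pow,
    Ideal.mem_span_singleton]
  exact h N

theorem HasPadicLimit.unique {u : ℕ → K p} {x y : K p} (hx : HasPadicLimit u x)
    (hy : HasPadicLimit u y) : x = y := by
  have key : ∀ N : ℕ, ∃ w : W p, x - y = algebraMap (W p) (K p) (p ^ N * w) := by
    intro N
    obtain ⟨n, ⟨v, hv⟩, ⟨w, hw⟩⟩ := ((hx N).and (hy N)).exists
    refine ⟨w - v, ?_⟩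
    rw [map_mul, map_sub, map_pow, map_natCast]
    linear_combination hw - hv
  obtain ⟨w, hw⟩ := key 0
  rw [pow_zero, one_mul] at hw
  have h0 : w = 0 := eq_zero_of_forall_pow_dvd fun N => by
    obtain ⟨v, hv⟩ := key N
    rw [hw] at hv
    exact ⟨v, IsFractionRing.injective (W p) (K p) hv⟩
  rw [h0, map_zero] at hw
  exact sub_eq_zero.1 hw

theorem HasPadicLimit.padicLimit_eq {u : ℕ → K p} {x : K p} (hx : HasPadicLimit u x) :
    padicLimit u = x := by
  have h : ∃ x, HasPadicLimit u x := ⟨x, hx⟩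
  rw [padicLimit, dif_pos h]
  exact h.choose_spec.unique hx

/-- A series in `W` whose terms tend to zero converges. -/
theorem exists_sum_limit (t : ℕ → W p) (ht : ∀ B k, 2 * B + 1 ≤ k → (p : W p) ^ B ∣ t k) :
    ∃ x : W p, ∀ B M, 2 * B + 1 ≤ M → (p : W p) ^ B ∣ ∑ k ∈ Finset.range M, t k - x := by
  have hdiff : ∀ B M N, 2 * B + 1 ≤ M → M ≤ N →
      (p : W p) ^ B ∣ ∑ k ∈ Finset.range M, t k - ∑ k ∈ Finset.range N, t k := by
    intro B M N hM hN
    rw [← dvd_neg, neg_sub, ← Finset.sum_Ico_eq_sub _ hN]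
    exact Finset.dvd_sum fun k hk => ht B k (hM.trans (Finset.mem_Ico.1 hk).1)
  obtain ⟨x, hx⟩ := IsPrecomplete.prec (I := Ideal.span {(p : W p)}) inferInstance
    (f := fun n => ∑ k ∈ Finset.range (2 * n + 1), t k) (by
      intro m n hmn
      rw [SModEq.sub_mem, smul_eq_mul, Ideal.mul_top, Ideal.span_singleton_pow,
        Ideal.mem_span_singleton]
      exact hdiff m _ _ le_rfl (by lia))
  refine ⟨x, fun B M hM => ?_⟩
  have h1 := hx B
  rw [SModEq.sub_mem, smul_eq_mul, Ideal.mul_top, Ideal.span_singleton_pow,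
    Ideal.mem_span_singleton] at h1
  have h2 := hdiff B _ _ le_rfl hM
  have := dvd_sub h1 h2
  rwa [sub_sub_sub_cancel_left] at this

theorem one_add_mul_pow_sub_one (w : W p) (m M : ℕ) (hM : m ≤ M) :
    (1 + (p : W p) * w) ^ m - 1 = ∑ k ∈ Finset.range M,
      zpToW p (p ^ (k + 1) * (m.choose (k + 1) : ℕ)) * w ^ (k + 1) := by
  have h1 : (1 + (p : W p) * w) ^ m =
      ∑ k ∈ Finset.range (M + 1), ((p : W p) * w) ^ k * (m.choose k : ℕ) := by
    rw [add_comm, add_pow]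
    simp only [one_pow, mul_one]
    refine Finset.sum_subset (Finset.range_mono (by lia)) fun k _ hk => ?_
    rw [Nat.choose_eq_zero_of_lt (by simpa using hk)]
    simp
  rw [h1, Finset.sum_range_succ']
  simp only [pow_zero, Nat.choose_zero_right, Nat.cast_one, mul_one, add_sub_cancel_right]
  refine Finset.sum_congr rfl fun k _ => ?_
  rw [map_mul, map_pow, map_natCast, map_natCast]
  ring

theorem dvd_pow_sub_one (w : W p) (m : ℕ) :
    ((p * m : ℕ) : W p) ∣ (1 + (p : W p) * w) ^ m - 1 := by
  rw [one_add_mul_pow_sub_one w m m le_rfl]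
  refine Finset.dvd_sum fun k _ => Dvd.dvd.mul_right ?_ _
  have := map_dvd (zpToW p) (dvd_pow_mul_choose (p := p) m k)
  rwa [map_natCast] at this

theorem two_mul_sub_mul_eq {R : Type*} [CommRing R] (M : ℕ) (f t : ℕ → R) (c x y : R)
    (hy : y = ∑ k ∈ Finset.range M, f k) :
    2 * (y - c * x) = ∑ k ∈ Finset.range M, 2 * (f k - c * t k) +
      2 * c * (∑ k ∈ Finset.range M, t k - x) := by
  rw [hy, ← Finset.mul_sum, Finset.sum_sub_distrib, ← Finset.mul_sum]
  ring

/-- The element `p⁻¹ log(1 + pw)` of `W`. -/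
theorem exists_log (w : W p) : ∃ x : W p,
    iwasawaLog (algebraMap (W p) (K p) (1 + p * w)) = p * algebraMap (W p) (K p) x ∧
    ∀ m : ℕ, ((p * m : ℕ) : W p) ^ 2 ∣
      2 * ((1 + (p : W p) * w) ^ m - 1 - (p * m : ℕ) * x) := by
  choose q hq hqB using exists_pow_div_succ (p := p)
  set t : ℕ → W p := fun k => zpToW p ((-1) ^ k * q k) * w ^ (k + 1) with ht
  obtain ⟨x, hx⟩ := exists_sum_limit t fun B k hk => by
    refine Dvd.dvd.mul_right ?_ _
    have := map_dvd (zpToW p) (Dvd.dvd.mul_left (hqB k B hk) ((-1) ^ k))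
    rwa [map_pow, map_natCast] at this
  refine ⟨x, ?_, fun m => ?_⟩
  · have hpu : IsPrincipalUnit (algebraMap (W p) (K p) (1 + p * w)) := ⟨w, by simp⟩
    rw [iwasawaLog, if_pos hpu, logSeries]
    refine HasPadicLimit.padicLimit_eq fun N => ?_
    filter_upwards [eventually_ge_atTop (2 * N + 1)] with M hM
    obtain ⟨y, hy⟩ := hx N M hM
    refine ⟨p * y, ?_⟩
    have e : -∑ n ∈ Finset.Icc 1 M, (1 - algebraMap (W p) (K p) (1 + p * w)) ^ n / (n : K p) =
        p * algebraMap (W p) (K p) (∑ k ∈ Finset.range M, t k) := by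
      rw [← Finset.Ico_succ_right_eq_Icc, Finset.sum_Ico_eq_sum_range, ← Finset.sum_neg_distrib,
        map_sum, Finset.mul_sum]
      refine Finset.sum_congr rfl fun k _ => ?_
      have hk : ((k + 1 : ℕ) : K p) ≠ 0 := by exact_mod_cast Nat.succ_ne_zero k
      have h1 := congrArg (fun z => algebraMap (W p) (K p) (zpToW p z)) (hq k)
      simp only [map_mul, map_pow, map_natCast] at h1
      rw [add_comm 1 k, neg_eq_iff_eq_neg, div_eq_iff hk]
      simp only [ht, map_mul, map_pow, map_add, map_one, map_natCast, map_neg]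
      push_cast at h1 ⊢
      linear_combination (-1) ^ (k + 1) * (p : K p) * (algebraMap (W p) (K p) w) ^ (k + 1) * (-h1)
    rw [e, ← mul_sub, ← map_sub, hy]
    simp only [map_mul, map_pow, map_natCast]
    ring
  · rcases Nat.eq_zero_or_pos m with rfl | hm
    · simp
    have hpm : ((p * m : ℕ) : ℤ_[p]) ^ 2 ≠ 0 := pow_ne_zero _ (by
      exact_mod_cast Nat.mul_ne_zero (Fact.out : p.Prime).ne_zero hm.ne')
    obtain ⟨B, -, hB⟩ := exists_pow_dvd hpm
    have hB' := map_dvd (zpToW p) hB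
    rw [map_pow, map_pow, map_natCast, map_natCast] at hB'
    -- `M ≥ m` makes the binomial expansion complete, and `M ≥ 2 * B + 1` makes the tail of the
    -- logarithm series divisible by `(p m)^2`.
    set M := m + (2 * B + 1)
    have h1 := hB'.trans (hx B M (by lia))
    rw [two_mul_sub_mul_eq M _ t _ x _ (one_add_mul_pow_sub_one w m M (by lia))]
    refine dvd_add (Finset.dvd_sum fun k _ => ?_) (Dvd.dvd.mul_left h1 _)
    have h2 := map_dvd (zpToW p) (sq_dvd_two_mul_choose_sub m k (hq k))
    rw [map_pow, map_natCast, map_mul, map_sub, map_mul (zpToW p) ((p * m : ℕ) : ℤ_[p]),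
      map_natCast (zpToW p) (p * m), map_ofNat] at h2
    have h3 := Dvd.dvd.mul_right h2 (w ^ (k + 1))
    rw [mul_assoc, sub_mul, mul_assoc ((p * m : ℕ) : W p)] at h3
    exact h3

end Log

/-! ### Continuity of the quotients of the coefficients of `G` and `F` -/

section Theta

/-- If `f m` behaves like `exp (-p m θ₀)`, the quotients `θ m = (1 - f m) / (p m)` are `p`-adically
continuous in `m`, up to a factor `2`. -/
theorem exists_theta {R : Type*} [CommRing R] [IsDomain R] [CharZero R] {p : ℕ} (hp : p.Prime)
    (hunit : ∀ x : ℕ, ¬ p ∣ x → IsUnit (x : R)) (f : ℕ → R) (θ₀ : R)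
    (h1 : ∀ m, ((p * m : ℕ) : R) ∣ 1 - f m)
    (h2 : ∀ m, ((p * m : ℕ) : R) ^ 2 ∣ 2 * (f m - (1 - (p * m : ℕ) * θ₀)))
    (h3 : ∀ m n, ((p * m : ℕ) : R) * (p * n : ℕ) ∣ 2 * (f (m + n) - f m * f n)) :
    ∃ θ : ℕ → R, θ 0 = θ₀ ∧ (∀ m, ((p * m : ℕ) : R) * θ m = 1 - f m) ∧
      ∀ n m m', p * m ≡ p * m' [MOD p ^ n] → (p : R) ^ n ∣ 2 * (θ m - θ m') := by
  choose g hg using h1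
  set θ : ℕ → R := fun m => if m = 0 then θ₀ else g m with hθ
  have hθf : ∀ m, ((p * m : ℕ) : R) * θ m = 1 - f m := by
    intro m
    by_cases hm : m = 0
    · subst hm
      rw [hg 0]; simp
    · rw [hg m]; simp [hθ, hm]
  have hθ0 : ∀ m, ((p * m : ℕ) : R) ∣ 2 * (θ m - θ₀) := by
    intro m
    by_cases hm : m = 0
    · subst hm; simp [hθ]
    · have hpm : ((p * m : ℕ) : R) ≠ 0 := by exact_mod_cast Nat.mul_ne_zero hp.ne_zero hm
      obtain ⟨y, hy⟩ := h2 m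
      refine ⟨-y, mul_left_cancel₀ hpm ?_⟩
      linear_combination 2 * hθf m - hy
  refine ⟨θ, by simp [hθ], hθf, ?_⟩
  have main : ∀ n m h, p ^ n ∣ p * h → (p : R) ^ n ∣ 2 * (θ (m + h) - θ m) := by
    intro n m h hh
    have hcast : ∀ x : ℕ, p ^ n ∣ x → (p : R) ^ n ∣ (x : R) := fun x hx => by
      exact_mod_cast Nat.cast_dvd_cast (α := R) hx
    -- If `p m` is itself divisible by `p ^ n`, both values are close to `θ₀`. Otherwise `p m` and
    -- `p (m + h)` have the same valuation `e < n`, and the multiplicativity of `f` is used.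
    by_cases hm : p ^ n ∣ p * m
    · have ha := (hcast _ hm).trans (hθ0 m)
      have hb := (hcast _ (by rw [mul_add]; exact dvd_add hm hh)).trans (hθ0 (m + h))
      have := dvd_sub hb ha
      rwa [← mul_sub, sub_sub_sub_cancel_right] at this
    · have hpm : p * m ≠ 0 := fun h0 => hm (by rw [h0]; exact dvd_zero _)
      obtain ⟨e, x, hx, hex⟩ := Nat.exists_eq_pow_mul_and_not_dvd hpm p hp.ne_one
      have hen : e < n := by
        by_contra hle
        exact hm (by rw [hex]; exact Dvd.dvd.mul_right (pow_dvd_pow _ (by lia)) _)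
      obtain ⟨y, hy⟩ := hh
      set x' := x + p ^ (n - e) * y with hx'
      have hx'u : IsUnit (x' : R) := hunit x' fun hd => hx (by
        refine (Nat.dvd_add_left (Dvd.dvd.mul_right ?_ _)).1 hd
        exact dvd_pow_self _ (by lia))
      have hmh : p * (m + h) = p ^ e * x' := by
        rw [mul_add, hex, hy, hx', mul_add, ← mul_assoc, ← pow_add, Nat.add_sub_cancel' hen.le]
      have hpe : ((p : R) ^ e) ≠ 0 := pow_ne_zero _ (by exact_mod_cast hp.ne_zero)
      have hPm : ((p * m : ℕ) : R) = (p : R) ^ e * x := by rw [hex]; push_cast; ring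
      have hPh : ((p * h : ℕ) : R) = (p : R) ^ n * y := by rw [hy]; push_cast; ring
      have hPmh : ((p * (m + h) : ℕ) : R) = (p : R) ^ e * x' := by rw [hmh]; push_cast; ring
      have hadd : ((p * (m + h) : ℕ) : R) = (p * m : ℕ) + (p * h : ℕ) := by push_cast; ring
      obtain ⟨E, hE⟩ := h3 m h
      obtain ⟨s, hs⟩ : (p : R) ^ e ∣ 2 * (θ h - θ m) := by
        have ha : (p : R) ^ e ∣ 2 * (θ m - θ₀) :=
          Dvd.dvd.trans (by rw [hPm]; exact dvd_mul_right _ _) (hθ0 m)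
        have hb : (p : R) ^ e ∣ 2 * (θ h - θ₀) :=
          Dvd.dvd.trans (by
            rw [hPh]; exact Dvd.dvd.mul_right (pow_dvd_pow _ hen.le) _) (hθ0 h)
        have := dvd_sub hb ha
        rwa [← mul_sub, sub_sub_sub_cancel_right] at this
      have ha := hθf m
      have hb := hθf h
      have hc := hθf (m + h)
      refine hx'u.dvd_mul_left.1 ⟨y * s - x * y * (2 * θ m * θ h + E), mul_left_cancel₀ hpe ?_⟩
      -- Multiplicativity of `f` rewritten for `θ`. The right side is divisible by `p ^ (n + e)`, as
      -- `θ h` and `θ m` are both close to `θ₀` modulo `p ^ e` up to the factor 2; then `p ^ e x'`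
      -- is divided out.
      have key : ((p * (m + h) : ℕ) : R) * (2 * (θ (m + h) - θ m)) =
          (p * h : ℕ) * (2 * (θ h - θ m)) -
          (p * m : ℕ) * (p * h : ℕ) * (2 * θ m * θ h + E) := by
        linear_combination 2 * hc - hE - 2 * θ m * hadd -
          2 * (1 - (p * h : ℕ) * θ h) * ha - 2 * f m * hb
      rw [hs, hPmh, hPh, hPm] at key
      linear_combination key
  intro n m m' hmm
  rcases le_total m m' with hle | hle
  · obtain ⟨h, rfl⟩ := Nat.exists_eq_add_of_le hle
    have hd := (Nat.modEq_iff_dvd' (Nat.mul_le_mul_left p hle)).1 hmm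
    rw [mul_add, Nat.add_sub_cancel_left] at hd
    have := main n m h hd
    rwa [← dvd_neg, ← mul_neg, neg_sub] at this
  · obtain ⟨h, rfl⟩ := Nat.exists_eq_add_of_le hle
    have hd := (Nat.modEq_iff_dvd' (Nat.mul_le_mul_left p hle)).1 hmm.symm
    rw [mul_add, Nat.add_sub_cancel_left] at hd
    exact main n m' h hd

end Theta

/-! ### The sequence of quotients of coefficients -/

section Alpha

variable {p : ℕ} [Fact p.Prime] {ι : Type*} [Fintype ι]

theorem isUnit_natCast_W {x : ℕ} (hx : ¬ p ∣ x) : IsUnit (x : W p) := by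
  have h : IsUnit (x : ℤ_[p]) := isUnit_of_not_dvd fun h => hx ((natCast_dvd_natCast_iff x).1 h)
  have := h.map (zpToW p)
  rwa [map_natCast] at this

theorem pow_dvd_zpToW {n : ℕ} {x : ℤ_[p]} (h : (p : ℤ_[p]) ^ n ∣ x) :
    (p : W p) ^ n ∣ zpToW p x := by
  have := map_dvd (zpToW p) h
  rwa [map_pow, map_natCast] at this

/-- To second order `c ^ m` is `1 + p m x` and the inverse unit ratio is `1 - p m t`, with `t` the
difference of digamma sums; their product thus has `θ₀ = t - x`. -/
theorem exists_theta_of_log (a b : ι → ℤ_[p]) (c x : W p)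
    (hc1 : ∀ m : ℕ, ((p * m : ℕ) : W p) ∣ c ^ m - 1)
    (hc2 : ∀ m : ℕ, ((p * m : ℕ) : W p) ^ 2 ∣ 2 * (c ^ m - 1 - (p * m : ℕ) * x)) :
    ∃ θ : ℕ → W p, θ 0 = zpToW p (∑ i, psiInt (a i) - ∑ i, psiInt (b i)) - x ∧
      (∀ m, ((p * m : ℕ) : W p) * θ m = 1 - c ^ m * zpToW p (invRatio a b (p * m))) ∧
      ∀ n m m', p * m ≡ p * m' [MOD p ^ n] → (p : W p) ^ n ∣ 2 * (θ m - θ m') := by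
  refine exists_theta (R := W p) Fact.out (fun x hx => isUnit_natCast_W hx)
    (fun m => c ^ m * zpToW p (invRatio a b (p * m))) _ ?_ ?_ ?_
  · intro m
    have h := map_dvd (zpToW p) (dvd_invRatio_sub_one a b (dvd_mul_right p m))
    rw [map_natCast, map_sub, map_one] at h
    obtain ⟨y, hy⟩ := h
    obtain ⟨z, hz⟩ := hc1 m
    refine ⟨-(z * zpToW p (invRatio a b (p * m)) + y), ?_⟩
    linear_combination -(zpToW p (invRatio a b (p * m))) * hz - hy
  · intro m
    have h := map_dvd (zpToW p) (sq_dvd_invRatio_sub a b (dvd_mul_right p m))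
    rw [map_pow, map_natCast, map_sub, map_sub, map_mul, map_natCast, map_one] at h
    obtain ⟨y, hy⟩ := h
    obtain ⟨z, hz⟩ := hc2 m
    set t := zpToW p (∑ i, psiInt (a i) - ∑ i, psiInt (b i))
    set P := ((p * m : ℕ) : W p)
    refine ⟨z * zpToW p (invRatio a b (p * m)) + 2 * (1 + P * x) * y - 2 * x * t, ?_⟩
    linear_combination (zpToW p (invRatio a b (p * m))) * hz + 2 * (1 + P * x) * hy
  · intro m n
    have h := map_dvd (zpToW p)
      (mul_dvd_invRatio_add a b (dvd_mul_right p m) (dvd_mul_right p n))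
    rw [map_mul, map_natCast, map_natCast, map_mul, map_sub, map_mul, map_ofNat, ← mul_add] at h
    obtain ⟨y, hy⟩ := h
    refine ⟨c ^ (m + n) * y, ?_⟩
    rw [pow_add]
    linear_combination c ^ m * c ^ n * hy

/-- The quotients of the coefficients of `G` by those of `F`. -/
def alphaSeq (θ : ℕ → W p) (k : ℕ) : W p :=
  if p ∣ k then θ (k / p) else zpToW p (unitInv (k : ℤ_[p]))

theorem pow_dvd_alphaSeq_sub {θ : ℕ → W p}
    (hθ : ∀ n m m', p * m ≡ p * m' [MOD p ^ n] → (p : W p) ^ n ∣ 2 * (θ m - θ m'))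
    (n x y : ℕ) (h : x ≡ y [MOD p ^ n]) :
    (p : W p) ^ n ∣ 2 * (alphaSeq θ x - alphaSeq θ y) := by
  rcases Nat.eq_zero_or_pos n with rfl | hn
  · simp
  have hpn : p ∣ p ^ n := dvd_pow_self _ hn.ne'
  have hxy : p ∣ x ↔ p ∣ y := by
    have := h.of_dvd hpn
    exact this.dvd_iff dvd_rfl
  simp only [alphaSeq, hxy]
  split_ifs with hy
  · refine hθ n _ _ ?_
    rwa [Nat.mul_div_cancel' hy, Nat.mul_div_cancel' (hxy.2 hy)]
  · refine Dvd.dvd.mul_left ?_ _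
    rw [← map_sub]
    refine pow_dvd_zpToW (unitInv_congr (dvd_pow_self _ hn.ne') ?_)
    have h1 := (Nat.modEq_iff_dvd.1 h.symm)
    have h2 := (PadicInt.pow_p_dvd_int_iff (p := p) n ((x : ℤ) - y)).2 (by exact_mod_cast h1)
    exact_mod_cast h2

end Alpha

/-! ### Dwork's conditions -/

section Conditions

variable {p : ℕ} [Fact p.Prime] {r : ℕ}

/-- If `k` of the `v`'s are at most `l`, so is the `k`-th smallest `v`; it exceeds the `(k + 1)`-st
smallest `u`, so at least `k + 1` of the `u`'s are below `l`. This makes Dwork's condition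
independent of the ordering. -/
theorem card_lt_card_of_sorted {m : ℕ} (u : Fin (m + 1) → ℕ) (v : Fin m → ℕ) (q l : ℕ)
    (h : ∀ (e : Equiv.Perm (Fin (m + 1))) (f : Equiv.Perm (Fin m)),
      Monotone (fun i => u (e i)) → Monotone (fun j => v (f j)) →
      ∀ j : Fin m, (j : ℕ) < q → u (e j.succ) < v (f j))
    (S : Finset (Fin m)) (hS : S.Nonempty) (hSq : S.card ≤ q) (hSl : ∀ j ∈ S, v j ≤ l) :
    S.card < (Finset.univ.filter fun i => u i < l).card := by
  set e := Tuple.sort u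
  set f := Tuple.sort v
  have he : Monotone fun i => u (e i) := Tuple.monotone_sort u
  have hf : Monotone fun i => v (f i) := Tuple.monotone_sort v
  have hpos : 0 < S.card := hS.card_pos
  have hle : S.card ≤ m := by simpa using Finset.card_le_univ S
  set j : Fin m := ⟨S.card - 1, by lia⟩
  have hj : v (f j) ≤ l := by
    by_contra hlt
    have hsub : S ⊆ (Finset.Iio j).image f := by
      intro i hi
      refine Finset.mem_image.2 ⟨f.symm i, Finset.mem_Iio.2 ?_, by simp⟩
      by_contra hge
      have h1 := hf (not_lt.1 hge)
      simp only [Equiv.apply_symm_apply] at h1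
      exact hlt (h1.trans (hSl i hi))
    have h1 := (Finset.card_le_card hsub).trans Finset.card_image_le
    rw [Fin.card_Iio] at h1
    have h2 : (j : ℕ) = S.card - 1 := rfl
    lia
  have h1 := (h e f he hf j (by change S.card - 1 < q; lia)).trans_le hj
  have hsub : (Finset.Iic j.succ).image e ⊆ Finset.univ.filter fun i => u i < l := by
    intro i hi
    obtain ⟨i', hi', rfl⟩ := Finset.mem_image.1 hi
    exact Finset.mem_filter.2 ⟨Finset.mem_univ _, (he (Finset.mem_Iic.1 hi')).trans_lt h1⟩
  have h2 := Finset.card_le_card hsub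
  rw [Finset.card_image_of_injective _ e.injective, Fin.card_Iic] at h2
  have h3 : ((j.succ : Fin (m + 1)) : ℕ) = S.card - 1 + 1 := by simp [j]
  lia

/-- The lower parameters together with the parameter `1` coming from `n!`. -/
def lowerParams (b : Fin r → ℤ_[p]) : Fin (r + 1) → ℤ_[p] := Fin.cons 1 b

theorem lowerParams_zero (b : Fin r → ℤ_[p]) : lowerParams b 0 = 1 := rfl

theorem lowerParams_succ (b : Fin r → ℤ_[p]) (j : Fin r) : lowerParams b j.succ = b j := rfl

open Classical in
theorem DworkConditions.dworkData {a : Fin (r + 1) → ℤ_[p]} {b : Fin r → ℤ_[p]}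
    (hab : DworkConditions a b)
    (hb : ∀ (j : Fin r) (m : ℕ), b j ≠ -(m : ℤ_[p]))
    (ha : ∀ (i : Fin (r + 1)) (m : ℕ), a i ≠ -(m : ℤ_[p])) :
    DworkData a (lowerParams b) (Finset.univ.filter fun j => lowerParams b j ≠ 1) where
  num_ne := ha
  den_ne i m := by
    refine Fin.cases ?_ (fun j => ?_) i
    · intro h
      have h1 : ((m + 1 : ℕ) : ℤ_[p]) = 0 := by
        have h2 : (1 : ℤ_[p]) = -(m : ℤ_[p]) := h
        push_cast
        linear_combination h2
      exact Nat.succ_ne_zero m (by exact_mod_cast h1)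
    · exact hb j m
  norm_eq_one j := by
    refine Fin.cases ?_ (fun j => ?_) j
    · intro h; simp [lowerParams_zero] at h
    · intro h
      exact hab.norm_eq_one j (by simpa [lowerParams_succ] using h)
  eq_one j hj := by simpa using hj
  card_lt n l := by
    rintro ⟨j, hj, hjl⟩
    set S : Finset (Fin r) := Finset.univ.filter fun j => b j ≠ 1 ∧ dworkDigit n (b j) ≤ l with hS
    have hcard : ((Finset.univ.filter fun j => lowerParams b j ≠ 1).filter
        fun j => dworkDigit n (lowerParams b j) ≤ l) = S.map (Fin.succEmb r) := by
      ext i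
      refine Fin.cases ?_ (fun i => ?_) i
      · simp [lowerParams_zero]
      · simp [lowerParams_succ, hS]
    have hne : S.Nonempty := by
      rw [← Finset.map_nonempty (f := Fin.succEmb r), ← hcard]
      exact ⟨j, Finset.mem_filter.2 ⟨hj, hjl⟩⟩
    rw [hcard, Finset.card_map]
    refine card_lt_card_of_sorted (fun i => dworkDigit n (a i)) (fun j => dworkDigit n (b j))
      {j | b j ≠ 1}.ncard l (hab.digit_lt n) S hne ?_ fun j hj => (Finset.mem_filter.1 hj).2.2
    rw [← Set.ncard_coe_finset]
    refine Set.ncard_le_ncard (fun j hj => ?_) (Set.toFinite _)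
    exact (Finset.mem_filter.1 (Finset.mem_coe.1 hj)).2.1

theorem coeff_hypSeries_iter (a : Fin (r + 1) → ℤ_[p]) (b : Fin r → ℤ_[p]) (k n : ℕ) :
    PowerSeries.coeff n (hypSeries (fun i => dworkIter k (a i)) fun j => dworkIter k (b j)) =
      coefIter a (lowerParams b) k n := by
  rw [hypSeries, PowerSeries.coeff_mk, coefIter, coefRatio, Fin.prod_univ_succ (n := r)
    (f := fun i => (rising (dworkIter k (lowerParams b i)) n : ℚ_[p]))]
  simp only [coe_rising, lowerParams_zero, lowerParams_succ, dworkIter_one,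
    PadicInt.coe_one]
  rw [mul_comm ((ascPochhammer ℚ_[p] n).eval 1)]

end Conditions

/-! ### Integrality and congruences for `G / F` -/

section Final

variable {p : ℕ} [Fact p.Prime]

/-- Frobenius is trivial on `W(𝔽_p)`, so `sigma` affects the coefficients of `F^{(1)}` only through
powers of `c`. -/
theorem frobenius_zpToW (x : ℤ_[p]) : WittVector.frobenius (zpToW p x) = zpToW p x := by
  change WittVector.frobenius (WittVector.map _ _) = WittVector.map _ _
  ext n
  rw [WittVector.coeff_frobenius_charP, WittVector.map_coeff, ← map_pow, ZMod.pow_card]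

theorem frobenius_algebraMap_zpToW (x : ℤ_[p]) :
    WittVector.FractionRing.frobenius p (AlgebraicClosure (ZMod p))
      (algebraMap (W p) (K p) (zpToW p x)) = algebraMap (W p) (K p) (zpToW p x) := by
  rw [WittVector.FractionRing.frobenius, IsFractionRing.ringEquivOfRingEquiv_algebraMap]
  congr 1
  exact frobenius_zpToW x

/-- The defining sum is empty at `n = 1`. Hence counting the parameter 1 of `n!` among the lower
ones leaves the digamma sums unchanged. -/
theorem psiInt_one : psiInt (1 : ℤ_[p]) = 0 := by
  have h : ∀ w : ℕ, (p : ℤ_[p]) ^ w ∣ 2 * psiInt (1 : ℤ_[p]) := fun w => by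
    obtain ⟨n, h1, h2⟩ := (psiTilde_spec (1 : ℤ_[p])).choose_spec.2 (w + 1)
    have h3 := pow_dvd_two_mul_unitHarm_sub (p := p) (m := n) (n := 0) (Nat.succ_ne_zero w) (by
      rw [← dvd_neg]
      convert h1 using 1
      push_cast; ring)
    have h4 := dvd_add (Dvd.dvd.mul_left h2 2) h3
    rw [← mul_add] at h4
    refine (pow_dvd_pow _ (Nat.le_succ w)).trans ?_
    convert h4 using 2
    simp [unitHarm, psiInt]
  by_contra h0
  have h2 : (2 * psiInt (1 : ℤ_[p])) ≠ 0 := mul_ne_zero two_ne_zero h0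
  have h3 := h ((2 * psiInt (1 : ℤ_[p])).valuation + 1)
  rw [← Ideal.mem_span_singleton, PadicInt.mem_span_pow_iff_le_valuation _ h2] at h3
  lia

variable {r : ℕ} {a : Fin (r + 1) → ℤ_[p]} {b : Fin r → ℤ_[p]} {J : Finset (Fin (r + 1))}

theorem coeff_hypFIter (h : DworkData a (lowerParams b) J) (k n : ℕ) :
    PowerSeries.coeff n (hypFIter k a b) = algebraMap (W p) (K p) (zpToW p (h.coef k n)) := by
  rw [hypFIter, hypF, PowerSeries.coeff_map, coeff_hypSeries_iter, ← qpToK_coe]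
  rfl

theorem coeff_hypF (h : DworkData a (lowerParams b) J) (n : ℕ) :
    PowerSeries.coeff n (hypF a b) = algebraMap (W p) (K p) (zpToW p (h.coef 0 n)) :=
  coeff_hypFIter h 0 n

/-- This is `coefRatio_step` with `l = 0`, where there is no incomplete block. -/
theorem coef_one_eq (h : DworkData a (lowerParams b) J) (m : ℕ) :
    h.coef 1 m = h.coef 0 (p * m) * invRatio a (lowerParams b) (p * m) := by
  refine PadicInt.ext ?_
  have h1 := coefRatio_step a (lowerParams b) (Nat.zero_le p) m
  simp only [not_lt_zero, Finset.filter_false, Finset.prod_empty, mul_one, div_one, zero_add]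
    at h1
  have h2 := unitRatio_mul_invRatio a (lowerParams b) (p * m)
  change coefIter a (lowerParams b) 1 m = coefIter a (lowerParams b) 0 (p * m) * _
  have h3 : coefIter a (lowerParams b) 0 (p * m) =
    coefIter a (lowerParams b) 1 m * unitRatio a (lowerParams b) (p * m) := by
    rw [mul_comm p m]; exact h1
  rw [h3, mul_assoc, h2, mul_one]

/-- The Euler constants cancel: `r + 1` upper digammas, `r` lower ones and the explicit `γ_p`. The
value of `γ_p` is therefore irrelevant. -/
theorem coeff_zero_hypG (c x : W p)
    (hx : iwasawaLog (algebraMap (W p) (K p) c) = p * algebraMap (W p) (K p) x) :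
    PowerSeries.coeff 0 (hypG c a b) = algebraMap (W p) (K p)
      (zpToW p (∑ i, psiInt (a i) - ∑ i, psiInt (lowerParams b i)) - x) := by
  have hp0 : (p : K p) ≠ 0 := by exact_mod_cast (Fact.out : p.Prime).ne_zero
  have hψ : ∀ z : ℤ_[p], digamma z = -eulerConst p + algebraMap (W p) (K p) (zpToW p (psiInt z)) :=
    fun z => by rw [digamma, ← coe_psiInt, qpToK_coe]
  rw [hypG, hx, map_add, PowerSeries.coeff_zero_C, logIntegral, PowerSeries.coeff_mk,
    Nat.cast_zero, div_zero, add_zero, inv_mul_cancel_left₀ hp0,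
    Fin.sum_univ_succ (fun i => psiInt (lowerParams b i))]
  simp only [hψ, lowerParams_zero, lowerParams_succ, psiInt_one, zero_add, map_sub, map_sum,
    Finset.sum_add_distrib, Finset.sum_const, Finset.card_univ, Fintype.card_fin, nsmul_eq_mul]
  push_cast
  ring

theorem map_sub_div_eq {R S : Type*} [CommRing R] [Field S] (φ : R →+* S) {A c v θ : R} {k : ℕ}
    (hk : (k : S) ≠ 0) (h : (k : R) * θ = 1 - c * v) :
    (φ A - φ (A * v) * φ c) / k = φ (A * θ) := by
  have h1 := congrArg φ h
  simp only [map_mul, map_sub, map_one, map_natCast] at h1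
  rw [div_eq_iff hk]
  simp only [map_mul]
  linear_combination -φ A * h1

theorem map_div_eq {R S : Type*} [CommRing R] [Field S] (φ : R →+* S) {A y : R} {k : ℕ}
    (hk : (k : S) ≠ 0) (h : (k : R) * y = 1) : φ A / k = φ (A * y) := by
  have h1 := congrArg φ h
  simp only [map_mul, map_one, map_natCast] at h1
  rw [div_eq_iff hk]
  simp only [map_mul]
  linear_combination -φ A * h1

/-- At `k = p m` the coefficient is `(A_k - c^m A'_m) / k`, and factoring out `A_k` leaves `(1 - f
m) / k = θ m`. At `k` prime to `p` the series `sigma c` contributes nothing. -/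
theorem coeff_hypG (h : DworkData a (lowerParams b) J) (c x : W p)
    (hx : iwasawaLog (algebraMap (W p) (K p) c) = p * algebraMap (W p) (K p) x) (θ : ℕ → W p)
    (hθ0 : θ 0 = zpToW p (∑ i, psiInt (a i) - ∑ i, psiInt (lowerParams b i)) - x)
    (hθ : ∀ m, ((p * m : ℕ) : W p) * θ m =
      1 - c ^ m * zpToW p (invRatio a (lowerParams b) (p * m))) (k : ℕ) :
    PowerSeries.coeff k (hypG c a b) =
      algebraMap (W p) (K p) (zpToW p (h.coef 0 k) * alphaSeq θ k) := by
  have hp : p.Prime := Fact.out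
  rcases Nat.eq_zero_or_pos k with rfl | hk
  · rw [coeff_zero_hypG c x hx, ← hθ0, h.coef_zero, alphaSeq, if_pos (dvd_zero p), Nat.zero_div,
      map_one, one_mul]
  · have hk0 : (k : K p) ≠ 0 := by exact_mod_cast hk.ne'
    rw [hypG, map_add, PowerSeries.coeff_C, if_neg hk.ne', zero_add, logIntegral,
      PowerSeries.coeff_mk, map_sub, coeff_hypF h, sigma, PowerSeries.coeff_mk, alphaSeq]
    split_ifs with hpk
    · obtain ⟨m, rfl⟩ := hpk
      have h1 := map_sub_div_eq (algebraMap (W p) (K p)) (A := zpToW p (h.coef 0 (p * m))) hk0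
        (hθ m)
      rw [map_pow] at h1
      rw [Nat.mul_div_cancel_left m hp.pos, coeff_hypFIter h, frobenius_algebraMap_zpToW,
        coef_one_eq h, map_mul (zpToW p)]
      exact h1
    · have h1 := congrArg (zpToW p) (mul_unitInv (x := (k : ℤ_[p]))
        (fun hd => hpk ((natCast_dvd_natCast_iff k).1 hd)))
      rw [map_mul, map_natCast, map_one] at h1
      rw [sub_zero]
      exact map_div_eq (algebraMap (W p) (K p)) hk0 h1

theorem truncLT_map (P : ℕ) (f : (W p)⟦X⟧) :
    truncLT P (PowerSeries.map (algebraMap (W p) (K p)) f) =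
      PowerSeries.map (algebraMap (W p) (K p)) (truncSeries P f) := by
  ext n
  rw [PowerSeries.coeff_map, coeff_truncSeries, truncLT, Polynomial.coeff_coe,
    PowerSeries.coeff_trunc, PowerSeries.coeff_map, apply_ite (algebraMap (W p) (K p)), map_zero]

theorem map_inv_eq {f g : (W p)⟦X⟧} (h : f * g = 1) :
    (PowerSeries.map (algebraMap (W p) (K p)) f)⁻¹ =
      PowerSeries.map (algebraMap (W p) (K p)) g := by
  have h1 : PowerSeries.map (algebraMap (W p) (K p)) f *
      PowerSeries.map (algebraMap (W p) (K p)) g = 1 := by rw [← map_mul, h, map_one]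
  symm
  rw [PowerSeries.eq_inv_iff_mul_eq_one, mul_comm, h1]
  intro h0
  have h2 := congrArg PowerSeries.constantCoeff h1
  rw [map_mul, h0, zero_mul, map_one] at h2
  exact zero_ne_one h2

theorem congrModPow_of_dvd {m P : ℕ} {F G u v : (W p)⟦X⟧} (hu : F * u = 1)
    (hv : truncSeries P F * v = 1)
    (h : PowerSeries.C ((p : W p) ^ m) ∣ G * truncSeries P F - F * truncSeries P G) :
    CongrModPow m (PowerSeries.map (algebraMap (W p) (K p)) (G * u))
      (PowerSeries.map (algebraMap (W p) (K p)) (truncSeries P G * v)) := by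
  obtain ⟨y, hy⟩ := h
  refine ⟨y * u * v, ?_⟩
  have e : G * u - truncSeries P G * v = PowerSeries.C ((p : W p) ^ m) * (y * u * v) := by
    linear_combination u * v * hy - G * u * hv + truncSeries P G * v * hu
  rw [← map_sub, e, map_mul, PowerSeries.map_C, map_pow, map_natCast]

theorem C_pow_dvd_of_two_mul_odd (hp2 : p ≠ 2) {n : ℕ} {D : (W p)⟦X⟧}
    (h : PowerSeries.C ((p : W p) ^ n) ∣ 2 * D) : PowerSeries.C ((p : W p) ^ n) ∣ D := by
  have h2 : IsUnit ((2 : ℕ) : W p) := isUnit_natCast_W fun hd =>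
    hp2 ((Nat.prime_dvd_prime_iff_eq Fact.out Nat.prime_two).1 hd)
  have h3 : IsUnit (2 : (W p)⟦X⟧) := by
    have := h2.map (PowerSeries.C (R := W p))
    rwa [map_natCast, Nat.cast_ofNat] at this
  exact h3.dvd_mul_left.1 h

theorem C_pow_dvd_of_two_mul_even (hp2 : p = 2) {n : ℕ} (hn : 1 ≤ n) {D : (W p)⟦X⟧}
    (h : PowerSeries.C ((p : W p) ^ n) ∣ 2 * D) : PowerSeries.C ((p : W p) ^ (n - 1)) ∣ D := by
  rw [C_dvd_iff] at h ⊢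
  intro k
  have h1 := h k
  have e : (2 : (W p)⟦X⟧) = PowerSeries.C (p : W p) := by
    rw [map_natCast]; exact_mod_cast congrArg (Nat.cast (R := (W p)⟦X⟧)) hp2.symm
  have hp0 : (p : W p) ≠ 0 := by exact_mod_cast (Fact.out : p.Prime).ne_zero
  rw [e, PowerSeries.coeff_C_mul, ← Nat.sub_add_cancel hn, pow_succ'] at h1
  exact (mul_dvd_mul_iff_left hp0).1 h1

end Final

end LogHyp

end

theorem theorem1p1 (p : ℕ) [Fact p.Prime] (r : ℕ)
    (a : Fin (r + 1) → ℤ_[p]) (b : Fin r → ℤ_[p])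
    (hb : ∀ (j : Fin r) (m : ℕ), b j ≠ -(m : ℤ_[p]))
    (hab : LogHyp.DworkConditions a b)
    (ha : ∀ (i : Fin (r + 1)) (m : ℕ), a i ≠ -(m : ℤ_[p]))
    (c : LogHyp.W p) (hc : ∃ w : LogHyp.W p, c = 1 + (p : LogHyp.W p) * w) :
    LogHyp.IsIntegralSeries (LogHyp.logTypeHyp c a b) ∧
    (p ≠ 2 → ∀ n : ℕ, 1 ≤ n →
      LogHyp.CongrModPow n (LogHyp.logTypeHyp c a b)
        (LogHyp.truncLT (p ^ n) (LogHyp.hypG c a b) *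
          (LogHyp.truncLT (p ^ n) (LogHyp.hypF a b))⁻¹)) ∧
    (p = 2 → ∀ n : ℕ, 1 ≤ n →
      LogHyp.CongrModPow (n - 1) (LogHyp.logTypeHyp c a b)
        (LogHyp.truncLT (p ^ n) (LogHyp.hypG c a b) *
          (LogHyp.truncLT (p ^ n) (LogHyp.hypF a b))⁻¹)) := by
  open LogHyp in
  classical
  have hp : p.Prime := Fact.out
  obtain ⟨w, rfl⟩ := hc
  have h := hab.dworkData hb ha
  obtain ⟨x, hx, hx2⟩ := exists_log w
  obtain ⟨θ, hθ0, hθ, hθc⟩ := exists_theta_of_log a (lowerParams b) (1 + (p : W p) * w) x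
    (dvd_pow_sub_one w) hx2
  set A : ℕ → W p := fun n => zpToW p (h.coef 0 n) with hA
  set α : ℕ → W p := alphaSeq θ with hα
  set F : PowerSeries (W p) := PowerSeries.mk A with hF
  set G : PowerSeries (W p) := PowerSeries.mk fun n => A n * α n with hG
  have hFm : hypF a b = PowerSeries.map (algebraMap (W p) (K p)) F := by
    ext n
    rw [coeff_hypF h, PowerSeries.coeff_map, hF, PowerSeries.coeff_mk]
  have hGm : hypG (1 + (p : W p) * w) a b = PowerSeries.map (algebraMap (W p) (K p)) G := by
    ext n
    rw [coeff_hypG h _ x hx θ hθ0 hθ, PowerSeries.coeff_map, hG, PowerSeries.coeff_mk]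
  have hF0 : PowerSeries.coeff 0 F = 1 := by
    rw [hF, PowerSeries.coeff_mk, hA]
    simp only [h.coef_zero, map_one]
  obtain ⟨u, hu⟩ := (isUnit_of_coeff_zero hF0).exists_right_inv
  have hFt : ∀ n, ∃ v, truncSeries (p ^ n) F * v = 1 := fun n =>
    (isUnit_of_coeff_zero ((coeff_zero_trunc (pow_pos hp.pos n)).trans hF0)).exists_right_inv
  have hlog : logTypeHyp (1 + (p : W p) * w) a b =
      PowerSeries.map (algebraMap (W p) (K p)) (G * u) := by
    rw [logTypeHyp, hFm, hGm, map_inv_eq hu, map_mul]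
  -- Dwork's congruences over `ℤ_p`, transported to `W`, meet the continuity of `α`; the comparison
  -- sequences are the coefficients of the `F^{(d)}`.
  have hD : ∀ n, PowerSeries.C ((p : W p) ^ n) ∣
      2 * (G * truncSeries (p ^ n) F - F * truncSeries (p ^ n) G) := by
    refine C_pow_dvd_two_mul hp.pos (A := A) (α := α) (C := fun d n => zpToW p (h.coef d n))
      (pow_dvd_alphaSeq_sub hθc) (fun d => by simp only [h.coef_zero, map_one])
      (fun d s l hl N => ?_) F G (fun i => PowerSeries.coeff_mk _ _)
      (fun i => PowerSeries.coeff_mk _ _)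
    have h1 := pow_dvd_zpToW (h.dvd_sum_range hl s N)
    rw [map_sum] at h1
    simpa only [map_sub, map_mul] using h1
  refine ⟨⟨G * u, hlog⟩, fun hp2 n hn => ?_, fun hp2 n hn => ?_⟩
  · obtain ⟨v, hv⟩ := hFt n
    rw [hlog, hFm, hGm, truncLT_map, truncLT_map, map_inv_eq hv, ← map_mul]
    exact congrModPow_of_dvd hu hv (C_pow_dvd_of_two_mul_odd hp2 (hD n))
  · obtain ⟨v, hv⟩ := hFt n
    rw [hlog, hFm, hGm, truncLT_map, truncLT_map, map_inv_eq hv, ← map_mul]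
    exact congrModPow_of_dvd hu hv (C_pow_dvd_of_two_mul_even hp2 hn (hD n))
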